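/- Let $M$ be a smooth, Hausdorff, $\sigma$-compact $n$-dimensional manifold without boundary, let $\mathscr{E}$ and $\mathscr{F}$ be smooth complex vector bundles of finite rank on $M$ with smooth hermitian fibre inner products, let $D : C^\infty(\mathscr{E}) \to C^\infty(\mathscr{F})$ be a smooth linear first-order differential operator with symbol $\sigma_1(D)$, so that $D(hf) = \sigma_1(D)(dh) f + h\,Df$, and let $g$ be a riemannian metric on $M$. For a fibre seminorm $P$ on $T^*M$, let $P^*(v) = \sup\{|\xi(v)| : \xi \in T^*_xM,\ P(\xi) \le 1\} \in [0,\infty]$ for $v \in T_xM$. A curve $\gamma : [0,T] \to M$ is $P$-subunit if it is absolutely continuous and $P^*(\gamma'(t)) \le 1$ for almost every $t$. Let $\varrho_P(x,y) \in [0,\infty]$ be the infimum of all $T > 0$ for which there is a $P$-subunit curve $\gamma : [0,T] \to M$ with $\gamma(0) = x$ and $\gamma(T) = y$. The seminorm $P$ is complete if $\{x \in M : \inf_{y\in K} \varrho_P(y,x) \le R\}$ is relatively compact in $M$ for all compact $K \subseteq M$ and all $R > 0$. Let $P_D(\xi) = |\sigma_1(D)(\xi)|_{\mathrm{op}}$ for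 $\xi \in T^*M$, let $\varrho_D = \varrho_{P_D}$, and call $D$ complete if $P_D$ is complete; use the same terms for other first-order operators. For a real function $\xi \in C^\infty(M)$, let $\delta_D \xi = \sigma_1(D)(d\xi)$, a section of $\mathrm{Hom}(\mathscr{E},\mathscr{F})$. For $m \in \mathbb{N} = \{0,1,2,\dots\}$, let $$D_m(f,g') = (Df,\ 2^{-m}\,dg'),$$ a first-order differential operator from $\mathscr{E} \oplus \mathscr{T}$ to $\mathscr{F} \oplus \mathbb{C}T^*M$, where $\mathscr{T} = M \times \mathbb{C}$ is the trivial bundle, $\mathbb{C}T^*M$ carries the hermitian inner product induced by $g$, and the direct sums are orthogonal. Suppose that $D_0$ is complete. Then, for all $x, y \in M$, $$\varrho_D(x,y) = \sup_{m \in \mathbb{N}} \varrho_{D_m}(x,y),$$ and moreover $$\varrho_D(x,y) = \sup\left\{ |\xi(x) - \xi(y)| \,:\, \xi \in C^\infty_{\mathrm{c}}(M;\mathbb{R}),\ |\delta_D \xi|_{\mathrm{op}} \le 1 \text{ everywhere on } M \right\}.$$ -/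

import Mathlib

open Bundle Set Filter MeasureTheory Topology
open scoped Manifold ContDiff ENNReal Bundle

noncomputable section

namespace ControlDistance

/-! ### Fibre seminorms on the cotangent bundle and their control distances -/

section SubFinsler

variable {n : ℕ} {M : Type*} [TopologicalSpace M] [ChartedSpace (EuclideanSpace ℝ (Fin n)) M]

/-- The real cotangent space of `M` at `x`. -/
abbrev Cotangent (n : ℕ) {M : Type*} [TopologicalSpace M]
    [ChartedSpace (EuclideanSpace ℝ (Fin n)) M] (x : M) : Type :=
  TangentSpace (𝓡 n) x →L[ℝ] ℝ

/-- The differential at `x` of a real function on `M`, as an element of the cotangent space. -/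
def differential (n : ℕ) {M : Type*} [TopologicalSpace M]
    [ChartedSpace (EuclideanSpace ℝ (Fin n)) M] (h : M → ℝ) (x : M) : Cotangent n x :=
  mfderiv (𝓡 n) 𝓘(ℝ, ℝ) h x

/-- The extended fibre norm `P*` on `TM` dual to `P`: `P*(v) = sup {|ξ(v)| : P(ξ) ≤ 1}`. -/
def dualNorm (P : ∀ x : M, Cotangent n x → ℝ) (x : M) (v : TangentSpace (𝓡 n) x) : ℝ≥0∞ :=
  ⨆ (ξ : Cotangent n x) (_ : P x ξ ≤ 1), ENNReal.ofReal |ξ v|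

/-- A curve `γ : [a, b] → M` is absolutely continuous if it is continuous and its expression in
each chart of the atlas is absolutely continuous on each compact interval which `γ` maps into the
domain of the chart. (The values of `γ` outside `[a, b]` play no role.) -/
def IsAbsolutelyContinuousCurve (n : ℕ) {M : Type*} [TopologicalSpace M]
    [ChartedSpace (EuclideanSpace ℝ (Fin n)) M] (γ : ℝ → M) (a b : ℝ) : Prop :=
  ContinuousOn γ (Icc a b) ∧
    ∀ φ ∈ atlas (EuclideanSpace ℝ (Fin n)) M, ∀ s t : ℝ, s ≤ t → Icc s t ⊆ Icc a b →
      MapsTo γ (Icc s t) φ.source → AbsolutelyContinuousOnInterval (fun r => φ (γ r)) s t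

/-- A curve `γ : [a, b] → M` is `P`-subunit if it is absolutely continuous and, for almost every
`t`, its velocity `v = γ'(t)` exists and satisfies `P*(v) ≤ 1`. -/
def IsSubunitCurve (P : ∀ x : M, Cotangent n x → ℝ) (γ : ℝ → M) (a b : ℝ) : Prop :=
  IsAbsolutelyContinuousCurve n γ a b ∧
    ∀ᵐ t ∂(volume : Measure ℝ), t ∈ Ioo a b →
      ∃ v : TangentSpace (𝓡 n) (γ t),
        HasMFDerivAt 𝓘(ℝ, ℝ) (𝓡 n) γ t (ContinuousLinearMap.toSpanSingleton ℝ v) ∧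
          dualNorm P (γ t) v ≤ 1

/-- The control distance `ϱ_P(x, y)`: the infimum (in `[0, ∞]`) of the set of all `T > 0` for which
some `P`-subunit curve `γ : [0, T] → M` joins `x` to `y`. -/
def controlDist (P : ∀ x : M, Cotangent n x → ℝ) (x y : M) : ℝ≥0∞ :=
  ⨅ (T : ℝ) (_ : 0 < T ∧ ∃ γ : ℝ → M, IsSubunitCurve P γ 0 T ∧ γ 0 = x ∧ γ T = y),
    ENNReal.ofReal T

/-- The set `{x : ϱ_P(K, x) ≤ R}`, where `ϱ_P(K, x) = inf {ϱ_P(y, x) : y ∈ K}`. -/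
def closedBallAround (P : ∀ x : M, Cotangent n x → ℝ) (K : Set M) (R : ℝ) : Set M :=
  {x | ⨅ y ∈ K, controlDist P y x ≤ ENNReal.ofReal R}

/-- `P` is complete if the closed `R`-neighbourhood for `ϱ_P` of every compact set is relatively
compact (in the manifold topology), for all positive `R`. -/
def IsCompleteSeminorm (P : ∀ x : M, Cotangent n x → ℝ) : Prop :=
  ∀ K : Set M, IsCompact K → ∀ R : ℝ, 0 < R → IsCompact (closure (closedBallAround P K R))

end SubFinsler

/-! ### First-order differential operators and their symbols -/

section Operators

variable {n : ℕ} {M : Type*} [TopologicalSpace M] [ChartedSpace (EuclideanSpace ℝ (Fin n)) M]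
variable {V : Type*} [NormedAddCommGroup V] [NormedSpace ℝ V]
  {E : M → Type*} [TopologicalSpace (TotalSpace V E)] [∀ x, TopologicalSpace (E x)]
  [∀ x, AddCommGroup (E x)] [∀ x, Module ℝ (E x)] [FiberBundle V E] [VectorBundle ℝ V E]
variable {W : Type*} [NormedAddCommGroup W] [NormedSpace ℝ W]
  {F : M → Type*} [TopologicalSpace (TotalSpace W F)] [∀ x, TopologicalSpace (F x)]
  [∀ x, AddCommGroup (F x)] [∀ x, Module ℝ (F x)] [FiberBundle W F] [VectorBundle ℝ W F]

/-- The product `h f` of a smooth real function `h` and a smooth section `f`. -/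
def mulSection (h : C^∞⟮𝓡 n, M; 𝓘(ℝ, ℝ), ℝ⟯) (f : Cₛ^∞⟮𝓡 n; V, E⟯) : Cₛ^∞⟮𝓡 n; V, E⟯ :=
  ⟨(h : M → ℝ) • (f : ∀ x, E x), h.contMDiff.smul_section f.contMDiff⟩

/-- The `j`-th partial derivative at `x`, in the coordinates of the preferred chart at `x₀` and the
preferred trivialisation of `E` at `x₀`, of a section `f` of `E`. -/
def partialDeriv (x₀ : M) (f : ∀ x, E x) (j : Fin n) (x : M) : V :=
  fderiv ℝ
    (fun y : EuclideanSpace ℝ (Fin n) =>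
      (trivializationAt V E x₀ ⟨(chartAt (EuclideanSpace ℝ (Fin n)) x₀).symm y,
        f ((chartAt (EuclideanSpace ℝ (Fin n)) x₀).symm y)⟩).2)
    (chartAt (EuclideanSpace ℝ (Fin n)) x₀ x) (EuclideanSpace.single j 1)

/-- `D : C^∞(E) → C^∞(F)` is a smooth linear differential operator of order (at most) one between
the complex vector bundles `E` and `F`: in local coordinates and trivialisations,
`D f = ∑ⱼ aⱼ ∂ⱼ f + b f`, where the `aⱼ` and `b` are smooth functions with values in the complex
linear maps between the model fibres. (Since the trivialisations of complex vector bundles are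
complex linear on the fibres, such a `D` is automatically complex linear.) -/
def IsFirstOrder [NormedSpace ℂ V] [NormedSpace ℂ W]
    (D : Cₛ^∞⟮𝓡 n; V, E⟯ →ₗ[ℝ] Cₛ^∞⟮𝓡 n; W, F⟯) : Prop :=
  ∀ x₀ : M, ∃ (a : Fin n → M → (V →L[ℂ] W)) (b : M → (V →L[ℂ] W)),
    (∀ j, ContMDiffOn (𝓡 n) 𝓘(ℝ, V →L[ℂ] W) ∞ (a j)
      ((chartAt (EuclideanSpace ℝ (Fin n)) x₀).source ∩
        ((trivializationAt V E x₀).baseSet ∩ (trivializationAt W F x₀).baseSet))) ∧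
    ContMDiffOn (𝓡 n) 𝓘(ℝ, V →L[ℂ] W) ∞ b
      ((chartAt (EuclideanSpace ℝ (Fin n)) x₀).source ∩
        ((trivializationAt V E x₀).baseSet ∩ (trivializationAt W F x₀).baseSet)) ∧
    ∀ f : Cₛ^∞⟮𝓡 n; V, E⟯,
      ∀ x ∈ (chartAt (EuclideanSpace ℝ (Fin n)) x₀).source ∩
        ((trivializationAt V E x₀).baseSet ∩ (trivializationAt W F x₀).baseSet),
        (trivializationAt W F x₀ ⟨x, D f x⟩).2 =
          ∑ j, a j x (partialDeriv x₀ (fun z => f z) j x) +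
            b x (trivializationAt V E x₀ ⟨x, f x⟩).2

/-- The commutator `[D, m(h)] f = D (h f) - h D f`. -/
def commutator (D : Cₛ^∞⟮𝓡 n; V, E⟯ →ₗ[ℝ] Cₛ^∞⟮𝓡 n; W, F⟯)
    (h : C^∞⟮𝓡 n, M; 𝓘(ℝ, ℝ), ℝ⟯) (f : Cₛ^∞⟮𝓡 n; V, E⟯) : Cₛ^∞⟮𝓡 n; W, F⟯ :=
  D (mulSection h f) - mulSection h (D f)

/-- The symbol of a first-order operator `D` at the real covector `ξ` at `x`: the map
`σ₁(D)(ξ) : E_x → F_x` characterised by `σ₁(D)(dh) f = [D, m(h)] f`. Its value at `v ∈ E_x` is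
computed from any `h` such that `dh = ξ` at `x` and any `f` such that `f(x) = v`; by `symbol_eq`
below, the choice of `h` and `f` is immaterial. -/
def symbol (D : Cₛ^∞⟮𝓡 n; V, E⟯ →ₗ[ℝ] Cₛ^∞⟮𝓡 n; W, F⟯) (x : M) (ξ : Cotangent n x) (v : E x) :
    F x :=
  commutator D
    (Classical.epsilon fun h : C^∞⟮𝓡 n, M; 𝓘(ℝ, ℝ), ℝ⟯ => differential n (fun z => h z) x = ξ)
    (Classical.epsilon fun f : Cₛ^∞⟮𝓡 n; V, E⟯ => f x = v) x

theorem eventually_triv_smul (x : M) (h : M → ℝ) (f : ∀ x, E x) :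
    (fun y : EuclideanSpace ℝ (Fin n) =>
      (trivializationAt V E x ⟨(chartAt (EuclideanSpace ℝ (Fin n)) x).symm y,
        h ((chartAt (EuclideanSpace ℝ (Fin n)) x).symm y) •
          f ((chartAt (EuclideanSpace ℝ (Fin n)) x).symm y)⟩).2) =ᶠ[
            𝓝 (chartAt (EuclideanSpace ℝ (Fin n)) x x)]
    fun y => h ((chartAt (EuclideanSpace ℝ (Fin n)) x).symm y) •
      (trivializationAt V E x ⟨(chartAt (EuclideanSpace ℝ (Fin n)) x).symm y,
        f ((chartAt (EuclideanSpace ℝ (Fin n)) x).symm y)⟩).2 := by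
  have hx := mem_chart_source (EuclideanSpace ℝ (Fin n)) x
  have hc : ContinuousAt (chartAt (EuclideanSpace ℝ (Fin n)) x).symm
      (chartAt (EuclideanSpace ℝ (Fin n)) x x) :=
    (chartAt (EuclideanSpace ℝ (Fin n)) x).continuousAt_symm
      ((chartAt (EuclideanSpace ℝ (Fin n)) x).map_source hx)
  have hm : (trivializationAt V E x).baseSet ∈
      𝓝 ((chartAt (EuclideanSpace ℝ (Fin n)) x).symm
        (chartAt (EuclideanSpace ℝ (Fin n)) x x)) := by
    rw [(chartAt (EuclideanSpace ℝ (Fin n)) x).left_inv hx]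
    exact (trivializationAt V E x).open_baseSet.mem_nhds (mem_baseSet_trivializationAt V E x)
  filter_upwards [hc hm] with y hy
  exact ((trivializationAt V E x).linear ℝ hy).2 _ _

theorem partialDeriv_mulSection (x : M) (h : C^∞⟮𝓡 n, M; 𝓘(ℝ, ℝ), ℝ⟯)
    (f : Cₛ^∞⟮𝓡 n; V, E⟯) (j : Fin n) :
    partialDeriv (V := V) x (fun z => mulSection h f z) j x =
      h x • partialDeriv (V := V) x (fun z => f z) j x +
        (differential n (fun z => h z) x : EuclideanSpace ℝ (Fin n) →L[ℝ] ℝ)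
          (EuclideanSpace.single j 1) • (trivializationAt V E x ⟨x, f x⟩).2 := by
  have hx := mem_chart_source (EuclideanSpace ℝ (Fin n)) x
  have hh : DifferentiableAt ℝ
      (fun y => h ((chartAt (EuclideanSpace ℝ (Fin n)) x).symm y))
      (chartAt (EuclideanSpace ℝ (Fin n)) x x) := by
    have := (h.contMDiff x).mdifferentiableAt (by simp)
    have := this.differentiableWithinAt_writtenInExtChartAt
    simpa [writtenInExtChartAt, Function.comp_def, differentiableWithinAt_univ,
      chartAt_self_eq] using this
  have hf : DifferentiableAt ℝ
      (fun y => (trivializationAt V E x ⟨(chartAt (EuclideanSpace ℝ (Fin n)) x).symm y,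
        f ((chartAt (EuclideanSpace ℝ (Fin n)) x).symm y)⟩).2)
      (chartAt (EuclideanSpace ℝ (Fin n)) x x) := by
    have := ((contMDiffAt_section x).1 (f.contMDiff x)).mdifferentiableAt (by simp)
    have := this.differentiableWithinAt_writtenInExtChartAt
    simpa [writtenInExtChartAt, Function.comp_def, differentiableWithinAt_univ,
      chartAt_self_eq] using this
  have hd : (differential n (fun z => h z) x : EuclideanSpace ℝ (Fin n) →L[ℝ] ℝ) =
      fderiv ℝ (fun y => h ((chartAt (EuclideanSpace ℝ (Fin n)) x).symm y))
        (chartAt (EuclideanSpace ℝ (Fin n)) x x) := by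
    have := (h.contMDiff x).mdifferentiableAt (by simp)
    simp [differential, mfderiv, this, writtenInExtChartAt, Function.comp_def, fderivWithin_univ,
      chartAt_self_eq]
    rfl
  have hv : (differential n (fun z => h z) x : EuclideanSpace ℝ (Fin n) →L[ℝ] ℝ)
      (EuclideanSpace.single j 1) =
      fderiv ℝ (fun y => h ((chartAt (EuclideanSpace ℝ (Fin n)) x).symm y))
        (chartAt (EuclideanSpace ℝ (Fin n)) x x) (EuclideanSpace.single j 1) :=
    congrArg (fun L : EuclideanSpace ℝ (Fin n) →L[ℝ] ℝ => L (EuclideanSpace.single j 1)) hd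
  have he := (eventually_triv_smul (n := n) (V := V) x (fun z => h z) (fun z => f z)).fderiv_eq (𝕜 := ℝ)
  rw [hv]
  unfold partialDeriv
  refine (DFunLike.congr_fun he _).trans ?_
  have hp : ∀ z, z = x → (trivializationAt V E x ⟨z, f z⟩).2 =
      (trivializationAt V E x ⟨x, f x⟩).2 := by
    rintro _ rfl
    rfl
  rw [fderiv_fun_smul hh hf, hp _ ((chartAt (EuclideanSpace ℝ (Fin n)) x).left_inv hx)]
  simp [(chartAt (EuclideanSpace ℝ (Fin n)) x).left_inv hx]

/-- The commutator `[D, m(h)]` acts at `x` by a linear map which depends only on `dh` at `x`. -/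
theorem commutator_eq [NormedSpace ℂ V] [NormedSpace ℂ W] [IsScalarTower ℝ ℂ V]
    [IsScalarTower ℝ ℂ W] (D : Cₛ^∞⟮𝓡 n; V, E⟯ →ₗ[ℝ] Cₛ^∞⟮𝓡 n; W, F⟯) (hD : IsFirstOrder D)
    (x : M) {h h' : C^∞⟮𝓡 n, M; 𝓘(ℝ, ℝ), ℝ⟯} {f f' : Cₛ^∞⟮𝓡 n; V, E⟯}
    (hh : differential n (fun z => h z) x = differential n (fun z => h' z) x) (hf : f x = f' x) :
    commutator D h f x = commutator D h' f' x := by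
  obtain ⟨a, b, -, -, hab⟩ := hD x
  have hxE := mem_baseSet_trivializationAt V E x
  have hxF := mem_baseSet_trivializationAt W F x
  have hx := mem_chart_source (EuclideanSpace ℝ (Fin n)) x
  have key : ∀ (h : C^∞⟮𝓡 n, M; 𝓘(ℝ, ℝ), ℝ⟯) (f : Cₛ^∞⟮𝓡 n; V, E⟯),
      (trivializationAt W F x ⟨x, commutator D h f x⟩).2 =
        ∑ j, (differential n (fun z => h z) x : EuclideanSpace ℝ (Fin n) →L[ℝ] ℝ)
          (EuclideanSpace.single j 1) • a j x (trivializationAt V E x ⟨x, f x⟩).2 := by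
    intro h f
    have h₁ : (trivializationAt W F x ⟨x, commutator D h f x⟩).2 =
        (trivializationAt W F x ⟨x, D (mulSection h f) x⟩).2 -
          h x • (trivializationAt W F x ⟨x, D f x⟩).2 := by
      have hl := (trivializationAt W F x).linear ℝ hxF
      have := hl.map_sub (D (mulSection h f) x) (h x • D f x)
      rw [hl.map_smul] at this
      exact this
    have h₂ : (trivializationAt V E x ⟨x, mulSection h f x⟩).2 =
        h x • (trivializationAt V E x ⟨x, f x⟩).2 :=
      ((trivializationAt V E x).linear ℝ hxE).2 _ _
    rw [h₁, hab _ x ⟨hx, hxE, hxF⟩, hab _ x ⟨hx, hxE, hxF⟩, h₂]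
    have hs : ∀ (T : V →L[ℂ] W) (c : ℝ) (v : V), T (c • v) = c • T v := fun T c v =>
      map_smul (T.restrictScalars ℝ) c v
    simp only [partialDeriv_mulSection, map_add, hs, Finset.sum_add_distrib, smul_add,
      Finset.smul_sum]
    abel
  have : (trivializationAt W F x ⟨x, commutator D h f x⟩).2 =
      (trivializationAt W F x ⟨x, commutator D h' f' x⟩).2 := by rw [key, key, hh, hf]
  exact ((trivializationAt W F x).continuousLinearEquivAt ℝ x hxF).injective this

/-- The symbol is well defined: `σ₁(D)(dh) f = [D, m(h)] f`. -/
theorem symbol_eq [NormedSpace ℂ V] [NormedSpace ℂ W] [IsScalarTower ℝ ℂ V]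
    [IsScalarTower ℝ ℂ W] (D : Cₛ^∞⟮𝓡 n; V, E⟯ →ₗ[ℝ] Cₛ^∞⟮𝓡 n; W, F⟯) (hD : IsFirstOrder D)
    (h : C^∞⟮𝓡 n, M; 𝓘(ℝ, ℝ), ℝ⟯) (f : Cₛ^∞⟮𝓡 n; V, E⟯) (x : M) :
    symbol D x (differential n (fun z => h z) x) (f x) = commutator D h f x :=
  commutator_eq D hD x
    (Classical.epsilon_spec (p := fun h' : C^∞⟮𝓡 n, M; 𝓘(ℝ, ℝ), ℝ⟯ =>
      differential n (fun z => h' z) x = differential n (fun z => h z) x) ⟨h, rfl⟩)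
    (Classical.epsilon_spec (p := fun f' : Cₛ^∞⟮𝓡 n; V, E⟯ => f' x = f x) ⟨f, rfl⟩)

/-- The fibre seminorm `P_D(ξ) = |σ₁(D)(ξ)|_op` on the cotangent bundle, where the fibres of `E` and
`F` carry the norms `NE` and `NF`. -/
def symbolNorm (NE : ∀ x, E x → ℝ) (NF : ∀ x, F x → ℝ)
    (D : Cₛ^∞⟮𝓡 n; V, E⟯ →ₗ[ℝ] Cₛ^∞⟮𝓡 n; W, F⟯) (x : M) (ξ : Cotangent n x) : ℝ :=
  sSup {r : ℝ | ∃ v : E x, NE x v ≤ 1 ∧ r = NF x (symbol D x ξ v)}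

end Operators

/-! ### The operator `D_m (f, g) = (D f, 2⁻ᵐ dg)` -/

section Augmented

variable {n : ℕ} {M : Type*} [TopologicalSpace M] [ChartedSpace (EuclideanSpace ℝ (Fin n)) M]

theorem contMDiff_trivial_section (g : Cₛ^∞⟮𝓡 n; ℂ, Bundle.Trivial M ℂ⟯) :
    ContMDiff (𝓡 n) 𝓘(ℝ, ℂ) ∞ (fun z => (g z : ℂ)) := fun x =>
  (contMDiffAt_section x).1 (g.contMDiff x)

variable [IsManifold (𝓡 n) ∞ M]

/-- The fibre at `x` of the complexified cotangent bundle `ℂT*M`. -/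
abbrev ComplexCotangent (n : ℕ) {M : Type*} [TopologicalSpace M]
    [ChartedSpace (EuclideanSpace ℝ (Fin n)) M] (x : M) : Type :=
  TangentSpace (𝓡 n) x →L[ℝ] Bundle.Trivial M ℂ x


/-- The exterior derivative `g ↦ dg`, from smooth complex functions on `M` (sections of the trivial
bundle with fibre `ℂ`) to smooth sections of the complexified cotangent bundle. -/
def extDeriv : Cₛ^∞⟮𝓡 n; ℂ, Bundle.Trivial M ℂ⟯ →ₗ[ℝ]
    Cₛ^∞⟮𝓡 n; EuclideanSpace ℝ (Fin n) →L[ℝ] ℂ, (ComplexCotangent n : M → Type)⟯ where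
  toFun g := ⟨fun x => (mfderiv (𝓡 n) 𝓘(ℝ, ℂ) (fun z => (g z : ℂ)) x : _ →L[ℝ] ℂ), by
    intro x
    refine (contMDiffAt_hom_bundle _).2 ⟨contMDiffAt_id, ?_⟩
    have h := (contMDiff_trivial_section g x).mfderiv_const (m := ∞) le_rfl
    unfold inTangentCoordinates ContinuousLinearMap.inCoordinates at h
    unfold ContinuousLinearMap.inCoordinates
    simp only [TangentBundle.continuousLinearMapAt_model_space] at h
    simp only [Bundle.Trivial.continuousLinearMapAt_trivialization, Bundle.Trivial.fiberBundle_trivializationAt']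
    exact h⟩
  map_add' g₁ g₂ := by
    ext1 x
    exact mfderiv_add ((contMDiff_trivial_section g₁).mdifferentiableAt (by simp))
      ((contMDiff_trivial_section g₂).mdifferentiableAt (by simp))
  map_smul' c g := by
    ext1 x
    exact const_smul_mfderiv ((contMDiff_trivial_section g).mdifferentiableAt (by simp)) c

section Sum

variable {V : Type*} [NormedAddCommGroup V] [NormedSpace ℝ V]
  {E : M → Type*} [TopologicalSpace (TotalSpace V E)] [∀ x, TopologicalSpace (E x)]
  [∀ x, AddCommGroup (E x)] [∀ x, Module ℝ (E x)] [FiberBundle V E] [VectorBundle ℝ V E]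
variable {W : Type*} [NormedAddCommGroup W] [NormedSpace ℝ W]
  {F : M → Type*} [TopologicalSpace (TotalSpace W F)] [∀ x, TopologicalSpace (F x)]
  [∀ x, AddCommGroup (F x)] [∀ x, Module ℝ (F x)] [FiberBundle W F] [VectorBundle ℝ W F]

/-- The section `(f, g)` of the direct sum `E ⊕ F`. -/
def pairSection (f : Cₛ^∞⟮𝓡 n; V, E⟯) (g : Cₛ^∞⟮𝓡 n; W, F⟯) :
    Cₛ^∞⟮𝓡 n; V × W, (E ×ᵇ F)⟯ :=
  ⟨fun x => (f x, g x), fun x => (contMDiffAt_section x).2 <|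
    ((contMDiffAt_section x).1 (f.contMDiff x)).prodMk_space
      ((contMDiffAt_section x).1 (g.contMDiff x))⟩

/-- The component in `E` of a section of the direct sum `E ⊕ F`. -/
def fstSection (f : Cₛ^∞⟮𝓡 n; V × W, (E ×ᵇ F)⟯) : Cₛ^∞⟮𝓡 n; V, E⟯ :=
  ⟨fun x => (f x).1, fun x => (contMDiffAt_section x).2 <|
    (contDiff_fst (𝕜 := ℝ) (E := V) (F := W) (n := ∞)).contMDiff.contMDiffAt.comp x
      ((contMDiffAt_section x).1 (f.contMDiff x))⟩

/-- The component in `F` of a section of the direct sum `E ⊕ F`. -/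
def sndSection (f : Cₛ^∞⟮𝓡 n; V × W, (E ×ᵇ F)⟯) : Cₛ^∞⟮𝓡 n; W, F⟯ :=
  ⟨fun x => (f x).2, fun x => (contMDiffAt_section x).2 <|
    (contDiff_snd (𝕜 := ℝ) (E := V) (F := W) (n := ∞)).contMDiff.contMDiffAt.comp x
      ((contMDiffAt_section x).1 (f.contMDiff x))⟩

/-- The operator `D_m (f, g) = (D f, 2⁻ᵐ dg)`, from sections of `E ⊕ (M × ℂ)` to sections of
`F ⊕ ℂT*M`. -/
def augmented (D : Cₛ^∞⟮𝓡 n; V, E⟯ →ₗ[ℝ] Cₛ^∞⟮𝓡 n; W, F⟯) (m : ℕ) :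
    Cₛ^∞⟮𝓡 n; V × ℂ, (E ×ᵇ Bundle.Trivial M ℂ)⟯ →ₗ[ℝ]
      Cₛ^∞⟮𝓡 n; W × (EuclideanSpace ℝ (Fin n) →L[ℝ] ℂ), (F ×ᵇ (ComplexCotangent n : M → Type))⟯ where
  toFun u := pairSection (D (fstSection u)) ((2 : ℝ)⁻¹ ^ m • extDeriv (sndSection u))
  map_add' u v := by
    have h₁ : fstSection (u + v) = fstSection u + fstSection v := rfl
    have h₂ : sndSection (u + v) = sndSection u + sndSection v := rfl
    rw [h₁, h₂, map_add, map_add]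
    ext1 x
    exact Prod.ext rfl (smul_add ((2 : ℝ)⁻¹ ^ m) (extDeriv (sndSection u) x)
      (extDeriv (sndSection v) x))
  map_smul' c u := by
    have h₁ : fstSection (c • u) = c • fstSection u := rfl
    have h₂ : sndSection (c • u) = c • sndSection u := rfl
    rw [h₁, h₂, map_smul, map_smul]
    ext1 x
    exact Prod.ext rfl (smul_comm ((2 : ℝ)⁻¹ ^ m) c (extDeriv (sndSection u) x))

end Sum

/-! ### The fibre norms -/

/-- The norm `|ξ|_g` of a real covector, dual to the norm of the riemannian metric `g` on `TM`. -/
def covectorNorm (g : ContMDiffRiemannianMetric (𝓡 n) ∞ (EuclideanSpace ℝ (Fin n))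
    (fun x : M => TangentSpace (𝓡 n) x)) (x : M) (ξ : Cotangent n x) : ℝ :=
  sSup {r : ℝ | ∃ v : TangentSpace (𝓡 n) x, g.inner x v v ≤ 1 ∧ r = |ξ v|}

/-- The norm on the fibres of `ℂT*M` of the hermitian inner product induced by `g`:
`|ξ + iη|² = |ξ|_g² + |η|_g²` for real covectors `ξ` and `η`. -/
def complexCovectorNorm (g : ContMDiffRiemannianMetric (𝓡 n) ∞ (EuclideanSpace ℝ (Fin n))
    (fun x : M => TangentSpace (𝓡 n) x)) (x : M) (α : ComplexCotangent n x) : ℝ :=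
  √(covectorNorm g x (Complex.reCLM.comp (α : TangentSpace (𝓡 n) x →L[ℝ] ℂ)) ^ 2 +
    covectorNorm g x (Complex.imCLM.comp (α : TangentSpace (𝓡 n) x →L[ℝ] ℂ)) ^ 2)

/-- The norm of the orthogonal direct sum of two normed bundles: `|(v, w)|² = |v|² + |w|²`. -/
def sumNorm {E F : M → Type*} (NE : ∀ x, E x → ℝ) (NF : ∀ x, F x → ℝ) (x : M) (u : E x × F x) : ℝ :=
  √(NE x u.1 ^ 2 + NF x u.2 ^ 2)

section Seminorms

variable {V : Type*} [NormedAddCommGroup V] [NormedSpace ℝ V]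
  {E : M → Type*} [TopologicalSpace (TotalSpace V E)] [∀ x, NormedAddCommGroup (E x)]
  [∀ x, NormedSpace ℝ (E x)] [FiberBundle V E] [VectorBundle ℝ V E]
variable {W : Type*} [NormedAddCommGroup W] [NormedSpace ℝ W]
  {F : M → Type*} [TopologicalSpace (TotalSpace W F)] [∀ x, NormedAddCommGroup (F x)]
  [∀ x, NormedSpace ℝ (F x)] [FiberBundle W F] [VectorBundle ℝ W F]

/-- The hermitian inner products on the fibres of the complex bundle `E` vary smoothly: in the local
frames given by the trivialisations, their coefficients are smooth functions. -/
def IsSmoothHermitian (n : ℕ) {M : Type*} [TopologicalSpace M]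
    [ChartedSpace (EuclideanSpace ℝ (Fin n)) M] (V : Type*) [NormedAddCommGroup V]
    (E : M → Type*) [TopologicalSpace (TotalSpace V E)] [∀ x, NormedAddCommGroup (E x)]
    [∀ x, InnerProductSpace ℂ (E x)] [FiberBundle V E] : Prop :=
  ∀ (x₀ : M) (v w : V), ContMDiffOn (𝓡 n) 𝓘(ℝ, ℂ) ∞
    (fun x => inner ℂ ((trivializationAt V E x₀).symm x v) ((trivializationAt V E x₀).symm x w))
    (trivializationAt V E x₀).baseSet

/-- The fibre seminorm `P_D(ξ) = |σ₁(D)(ξ)|_op` of an operator between normed bundles. -/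
def opSeminorm (D : Cₛ^∞⟮𝓡 n; V, E⟯ →ₗ[ℝ] Cₛ^∞⟮𝓡 n; W, F⟯) (x : M) (ξ : Cotangent n x) : ℝ :=
  symbolNorm (fun _ v => ‖v‖) (fun _ w => ‖w‖) D x ξ

/-- The fibre seminorm `P_{D_m}` of the operator `D_m`, where `E ⊕ (M × ℂ)` and `F ⊕ ℂT*M` carry the
direct sums of the given hermitian inner products, the standard one of `ℂ`, and the one induced by
the riemannian metric `g`. -/
def augmentedSeminorm (g : ContMDiffRiemannianMetric (𝓡 n) ∞ (EuclideanSpace ℝ (Fin n))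
    (fun x : M => TangentSpace (𝓡 n) x)) (D : Cₛ^∞⟮𝓡 n; V, E⟯ →ₗ[ℝ] Cₛ^∞⟮𝓡 n; W, F⟯) (m : ℕ)
    (x : M) (ξ : Cotangent n x) : ℝ :=
  symbolNorm (sumNorm (fun _ v => ‖v‖) (fun _ c => ‖(c : ℂ)‖))
    (sumNorm (fun _ w => ‖w‖) (complexCovectorNorm g)) (augmented D m) x ξ

end Seminorms

end Augmented
end ControlDistance
end

noncomputable section

namespace ControlDistance

/-! The symbol of `D_m` is block diagonal: `σ₁(D)(ξ)` on `E` and `2⁻ᵐ` times multiplication by `ξ`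
on the trivial bundle. Its operator norm is therefore `max (P_D ξ) (2⁻ᵐ |ξ|_g)`
(`augmentedSeminorm_eq`). So the `P_{D_m}` are continuous norms which decrease pointwise to `P_D`,
itself possibly degenerate.

A larger seminorm has a smaller dual norm and hence more subunit curves, which gives `ϱ_{D_m} ≤ ϱ_D`
(`controlDist_mono`). Conversely, if `T` exceeds every `ϱ_{D_m}(x, y)`, there are `P_{D_m}`-subunit
curves from `x` to `y` of duration `T`. They all remain in a `ϱ_{D_0}`-ball, which is relatively
compact, and they are locally equicontinuous. A limit curve is subunit for each `P_{D_k}`, hence for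
`P_D` (`controlDist_le_iSup`).

For the second formula, integration along curves shows that test functions are `1`-Lipschitz for
`ϱ_D` (`ofReal_abs_sub_le_controlDist`). By the first formula, the other inequality need only be
proved with `ϱ_{D_m}` on the left. Each `D_m` is complete because `ϱ_{D_0} ≤ ϱ_{D_m}`, so `z ↦ (R -
ϱ_{D_m}(x, z))₊` is a compactly supported `1`-Lipschitz function. As `P_{D_m}` is a continuous norm,
it is almost constant near each point of a chart, and mollification there almost preserves the
Lipschitz bound (`exists_local_approx`). A partition of unity glues the pieces
(`exists_global_approx`), and rescaling yields a test function (`controlDist_le_iSup_test`),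
admissible for `D` because `P_D ≤ P_{D_m}`.

The subunit condition is used in three forms: almost everywhere on velocities, integrated
(`IsWeaklySubunit`) and infinitesimal (`IsLocallySubunit`). The last two are tested on global smooth
functions. The integrated form suits reversal, concatenation and comparison of seminorms; the
infinitesimal form survives pointwise limits and leads back to the first by almost everywhere
differentiability of Lipschitz functions (`IsLocallySubunit.isSubunitCurve`). -/

theorem eq_sum_smul_proj {n : ℕ} (ζ : EuclideanSpace ℝ (Fin n) →L[ℝ] ℝ) :
    ζ = ∑ i, ζ (EuclideanSpace.single i 1) •
      (EuclideanSpace.proj i : EuclideanSpace ℝ (Fin n) →L[ℝ] ℝ) := by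
  ext v
  conv_lhs => rw [← (EuclideanSpace.basisFun (Fin n) ℝ).sum_repr v]
  simp [mul_comm]

/-! ### Continuous fibre seminorms on the cotangent bundle, read in charts. -/

section Seminorm

variable {n : ℕ} {M : Type*} [TopologicalSpace M] [ChartedSpace (EuclideanSpace ℝ (Fin n)) M]

/-- A continuous fibre seminorm on the cotangent bundle; continuity is tested on differentials of
smooth functions. -/
structure IsContinuousSeminorm (P : ∀ x : M, Cotangent n x → ℝ) : Prop where
  add_le : ∀ x ξ η, P x (ξ + η) ≤ P x ξ + P x η
  smul : ∀ x (c : ℝ) ξ, P x (c • ξ) = |c| * P x ξ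
  continuous_differential : ∀ h : M → ℝ, ContMDiff (𝓡 n) 𝓘(ℝ, ℝ) ∞ h →
    Continuous fun x => P x (differential n h x)

namespace IsContinuousSeminorm

variable {P : ∀ x : M, Cotangent n x → ℝ} (hP : IsContinuousSeminorm P)
include hP

theorem zero (x : M) : P x 0 = 0 := by
  have := hP.smul x 0 0
  simpa using this

theorem neg (x : M) (ξ : Cotangent n x) : P x (-ξ) = P x ξ := by
  have h : -ξ = (-1 : ℝ) • ξ := (neg_one_smul ℝ ξ).symm
  rw [h, hP.smul]
  simp

theorem nonneg (x : M) (ξ : Cotangent n x) : 0 ≤ P x ξ := by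
  have h := hP.add_le x ξ (-ξ)
  rw [hP.neg, add_neg_cancel, hP.zero] at h
  linarith

theorem sum_le {ι : Type*} (s : Finset ι) (x : M) (ξ : ι → Cotangent n x) :
    P x (∑ i ∈ s, ξ i) ≤ ∑ i ∈ s, P x (ξ i) := by
  classical
  induction s using Finset.induction_on with
  | empty => simp [hP.zero]
  | insert a s ha ih =>
    rw [Finset.sum_insert ha, Finset.sum_insert ha]
    exact (hP.add_le _ _ _).trans (by gcongr)

end IsContinuousSeminorm

/-- The covector at `z` which in the chart `e` is the linear form `η`. -/
def chartCovector (e : OpenPartialHomeomorph M (EuclideanSpace ℝ (Fin n))) (z : M)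
    (η : EuclideanSpace ℝ (Fin n) →L[ℝ] ℝ) : Cotangent n z :=
  η.comp (mfderiv (𝓡 n) (𝓡 n) e z : EuclideanSpace ℝ (Fin n) →L[ℝ] EuclideanSpace ℝ (Fin n))

theorem chartCovector_add (e : OpenPartialHomeomorph M (EuclideanSpace ℝ (Fin n))) (z : M)
    (η ζ : EuclideanSpace ℝ (Fin n) →L[ℝ] ℝ) :
    chartCovector e z (η + ζ) = chartCovector e z η + chartCovector e z ζ :=
  ContinuousLinearMap.add_comp _ _ _

theorem chartCovector_smul (e : OpenPartialHomeomorph M (EuclideanSpace ℝ (Fin n))) (z : M)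
    (c : ℝ) (η : EuclideanSpace ℝ (Fin n) →L[ℝ] ℝ) :
    chartCovector e z (c • η) = c • chartCovector e z η :=
  ContinuousLinearMap.smul_comp _ _ _

variable [IsManifold (𝓡 n) ∞ M]

theorem mdifferentiable_of_mem_atlas_inf {e : OpenPartialHomeomorph M (EuclideanSpace ℝ (Fin n))}
    (he : e ∈ atlas (EuclideanSpace ℝ (Fin n)) M) : e.MDifferentiable (𝓡 n) (𝓡 n) :=
  haveI : IsManifold (𝓡 n) 1 M := IsManifold.of_le (n := ∞) (by simp)
  mdifferentiable_of_mem_atlas he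

theorem chartCovector_surjective {e : OpenPartialHomeomorph M (EuclideanSpace ℝ (Fin n))}
    (he : e ∈ atlas (EuclideanSpace ℝ (Fin n)) M) {z : M} (hz : z ∈ e.source)
    (ξ : Cotangent n z) : ∃ η, chartCovector e z η = ξ := by
  have hd := mdifferentiable_of_mem_atlas_inf he
  refine ⟨(ξ : EuclideanSpace ℝ (Fin n) →L[ℝ] ℝ).comp (mfderiv (𝓡 n) (𝓡 n) e.symm (e z) :
    EuclideanSpace ℝ (Fin n) →L[ℝ] EuclideanSpace ℝ (Fin n)), ?_⟩
  have h := hd.symm_comp_deriv hz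
  unfold chartCovector
  ext v
  exact congrArg ξ (DFunLike.congr_fun h v)

theorem chartCovector_eq_zero {e : OpenPartialHomeomorph M (EuclideanSpace ℝ (Fin n))}
    (he : e ∈ atlas (EuclideanSpace ℝ (Fin n)) M) {z : M} (hz : z ∈ e.source)
    {η : EuclideanSpace ℝ (Fin n) →L[ℝ] ℝ} (h : chartCovector e z η = 0) : η = 0 := by
  have hd := mdifferentiable_of_mem_atlas_inf he
  ext v
  obtain ⟨w, rfl⟩ := hd.mfderiv_surjective hz v
  exact DFunLike.congr_fun h w

theorem differential_of_eventuallyEq_comp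
    {e : OpenPartialHomeomorph M (EuclideanSpace ℝ (Fin n))}
    (he : e ∈ atlas (EuclideanSpace ℝ (Fin n)) M) {z : M} (hz : z ∈ e.source)
    {F : EuclideanSpace ℝ (Fin n) → ℝ} (hF : DifferentiableAt ℝ F (e z)) {h : M → ℝ}
    (hh : h =ᶠ[𝓝 z] F ∘ e) : differential n h z = chartCovector e z (fderiv ℝ F (e z)) := by
  have hd := mdifferentiable_of_mem_atlas_inf he
  have h1 : MDifferentiableAt (𝓡 n) 𝓘(ℝ, ℝ) F (e z) := hF.mdifferentiableAt
  unfold differential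
  rw [hh.mfderiv_eq, mfderiv_comp z h1 (hd.mdifferentiableAt hz), mfderiv_eq_fderiv]
  rfl

variable [T2Space M]

/-- Cut-off functions. -/
theorem exists_bump {p : M} {U : Set M} (hU : U ∈ 𝓝 p) :
    ∃ χ : M → ℝ, ContMDiff (𝓡 n) 𝓘(ℝ, ℝ) ∞ χ ∧ HasCompactSupport χ ∧ tsupport χ ⊆ U ∧
      χ =ᶠ[𝓝 p] 1 := by
  obtain ⟨χ, -, hχ⟩ := (SmoothBumpFunction.nhds_basis_tsupport (I := 𝓡 n) p).mem_iff.1 hU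
  exact ⟨χ, χ.contMDiff, χ.hasCompactSupport, hχ, χ.eventuallyEq_one⟩

/-- Smooth functions of the coordinates extend from a neighbourhood to the whole manifold. -/
theorem exists_extension {e : OpenPartialHomeomorph M (EuclideanSpace ℝ (Fin n))}
    (he : e ∈ atlas (EuclideanSpace ℝ (Fin n)) M) {x₀ : M} (hx₀ : x₀ ∈ e.source) :
    ∃ U : Set M, IsOpen U ∧ x₀ ∈ U ∧ U ⊆ e.source ∧ (∃ K, IsCompact K ∧ U ⊆ K) ∧
      ∀ F : EuclideanSpace ℝ (Fin n) → ℝ, ContDiff ℝ ∞ F → ∃ h : M → ℝ,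
        ContMDiff (𝓡 n) 𝓘(ℝ, ℝ) ∞ h ∧ ∀ z ∈ U, h z = F (e z) := by
  obtain ⟨χ, hχ, hχc, hχs, hχ1⟩ := exists_bump (n := n) (e.open_source.mem_nhds hx₀)
  obtain ⟨U, hU, hUo, hxU⟩ := eventually_nhds_iff.1 hχ1
  have hUs : U ⊆ tsupport χ := fun z hz => subset_tsupport χ (by simp [hU z hz])
  refine ⟨U, hUo, hxU, hUs.trans hχs, ⟨tsupport χ, hχc, hUs⟩, fun F hF =>
    ⟨fun z => χ z * F (e z), ?_, fun z hz => by simp [hU z hz]⟩⟩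
  refine contMDiff_of_tsupport fun z hz => ?_
  have hz' : z ∈ e.source := hχs (tsupport_mul_subset_left hz)
  have h1 : ContMDiffAt (𝓡 n) (𝓡 n) ∞ e z :=
    contMDiffAt_of_mem_maximalAtlas (IsManifold.subset_maximalAtlas he) hz'
  exact (hχ z).mul ((hF.contMDiff (e z)).comp z h1)

theorem exists_differential_eq (x : M) (ξ : Cotangent n x) :
    ∃ h : M → ℝ, ContMDiff (𝓡 n) 𝓘(ℝ, ℝ) ∞ h ∧ differential n h x = ξ := by
  have he := chart_mem_atlas (EuclideanSpace ℝ (Fin n)) x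
  have hx := mem_chart_source (EuclideanSpace ℝ (Fin n)) x
  obtain ⟨U, hUo, hxU, -, -, hU⟩ := exists_extension he hx
  obtain ⟨η, rfl⟩ := chartCovector_surjective he hx ξ
  obtain ⟨h, hh, heq⟩ := hU η η.contDiff
  refine ⟨h, hh, ?_⟩
  rw [differential_of_eventuallyEq_comp he hx η.differentiableAt
    (eventually_of_mem (hUo.mem_nhds hxU) heq), η.fderiv]

namespace IsContinuousSeminorm

variable {P : ∀ x : M, Cotangent n x → ℝ} (hP : IsContinuousSeminorm P)
  {e : OpenPartialHomeomorph M (EuclideanSpace ℝ (Fin n))}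
  (he : e ∈ atlas (EuclideanSpace ℝ (Fin n)) M) {x₀ : M} (hx₀ : x₀ ∈ e.source)
include hP he hx₀

/-- Near `x₀`, a covector field constant in the chart is the differential of a global smooth
function, so testing continuity on differentials suffices. -/
theorem continuousAt_chartCovector (η : EuclideanSpace ℝ (Fin n) →L[ℝ] ℝ) :
    ContinuousAt (fun z => P z (chartCovector e z η)) x₀ := by
  obtain ⟨U, hUo, hxU, hUe, -, hU⟩ := exists_extension he hx₀
  obtain ⟨h, hh, heq⟩ := hU η η.contDiff
  refine (hP.continuous_differential h hh).continuousAt.congr ?_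
  filter_upwards [hUo.mem_nhds hxU] with z hz
  rw [differential_of_eventuallyEq_comp he (hUe hz) η.differentiableAt
    (eventually_of_mem (hUo.mem_nhds hz) heq), η.fderiv]

/-- By the triangle inequality, changing `η₀` to `η` costs at most the sum of `|(η - η₀)ᵢ| P(dxᵢ)`.
This tends to zero because each `P(dxᵢ)` is continuous, hence bounded near `x₀`. -/
theorem continuousAt_uncurry_chartCovector (η₀ : EuclideanSpace ℝ (Fin n) →L[ℝ] ℝ) :
    ContinuousAt (fun q : M × (EuclideanSpace ℝ (Fin n) →L[ℝ] ℝ) =>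
      P q.1 (chartCovector e q.1 q.2)) (x₀, η₀) := by
  have hbound : ∀ z (ζ : EuclideanSpace ℝ (Fin n) →L[ℝ] ℝ), P z (chartCovector e z ζ) ≤
      ∑ i, |ζ (EuclideanSpace.single i 1)| *
        P z (chartCovector e z (EuclideanSpace.proj i)) := by
    intro z ζ
    have hs : chartCovector e z ζ = ∑ i, ζ (EuclideanSpace.single i 1) •
        chartCovector e z (EuclideanSpace.proj i) := by
      conv_lhs => rw [eq_sum_smul_proj ζ]
      simp only [← chartCovector_smul]
      exact map_sum (AddMonoidHom.mk' (chartCovector e z) (chartCovector_add e z)) _ _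
    rw [hs]
    refine (hP.sum_le _ _ _).trans (le_of_eq ?_)
    simp only [hP.smul]
  have hG : Tendsto (fun q : M × (EuclideanSpace ℝ (Fin n) →L[ℝ] ℝ) =>
      ∑ i, |(q.2 - η₀) (EuclideanSpace.single i 1)| *
        P q.1 (chartCovector e q.1 (EuclideanSpace.proj i))) (𝓝 (x₀, η₀)) (𝓝 0) := by
    have h1 : ContinuousAt (fun q : M × (EuclideanSpace ℝ (Fin n) →L[ℝ] ℝ) =>
        ∑ i, |(q.2 - η₀) (EuclideanSpace.single i 1)| *
          P q.1 (chartCovector e q.1 (EuclideanSpace.proj i))) (x₀, η₀) := by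
      refine tendsto_finsetSum _ fun i _ => ContinuousAt.mul ?_ ?_
      · fun_prop
      · exact ContinuousAt.comp (f := Prod.fst) (x := (x₀, η₀))
          (hP.continuousAt_chartCovector he hx₀ _) continuousAt_fst
    have h2 := h1.tendsto
    simpa using h2
  have hF : Tendsto (fun q : M × (EuclideanSpace ℝ (Fin n) →L[ℝ] ℝ) =>
      P q.1 (chartCovector e q.1 η₀)) (𝓝 (x₀, η₀)) (𝓝 (P x₀ (chartCovector e x₀ η₀))) :=
    ContinuousAt.comp (f := Prod.fst) (x := (x₀, η₀))
      (hP.continuousAt_chartCovector he hx₀ η₀) continuousAt_fst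
  have hl := hF.sub hG
  have hr := hF.add hG
  rw [sub_zero] at hl
  rw [add_zero] at hr
  refine tendsto_of_tendsto_of_tendsto_of_le_of_le hl hr (fun q => ?_) (fun q => ?_)
  · have h1 := hP.add_le q.1 (chartCovector e q.1 q.2) (chartCovector e q.1 (-(q.2 - η₀)))
    rw [← chartCovector_add] at h1
    have h2 := hbound q.1 (-(q.2 - η₀))
    have h3 : q.2 + -(q.2 - η₀) = η₀ := by abel
    rw [h3] at h1
    simp only [neg_apply, abs_neg] at h2
    dsimp only
    linarith
  · have h1 := hP.add_le q.1 (chartCovector e q.1 η₀) (chartCovector e q.1 (q.2 - η₀))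
    rw [← chartCovector_add] at h1
    have h2 := hbound q.1 (q.2 - η₀)
    have h3 : η₀ + (q.2 - η₀) = q.2 := by abel
    rw [h3] at h1
    dsimp only
    linarith

/-- A continuous fibre norm is locally almost constant in a chart. -/
theorem eventually_comparable (hN : ∀ x ξ, P x ξ = 0 → ξ = 0) {ε : ℝ} (hε : 0 < ε) :
    ∀ᶠ z in 𝓝 x₀, ∀ η, P z (chartCovector e z η) ≤ (1 + ε) * P x₀ (chartCovector e x₀ η) ∧
      P x₀ (chartCovector e x₀ η) ≤ (1 + ε) * P z (chartCovector e z η) := by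
  have hK : IsCompact (Metric.sphere (0 : EuclideanSpace ℝ (Fin n) →L[ℝ] ℝ) 1) :=
    haveI := FiniteDimensional.proper_real (EuclideanSpace ℝ (Fin n) →L[ℝ] ℝ)
    isCompact_sphere _ _
  -- Both inequalities are homogeneous in `η`, so the compact unit sphere suffices. There they are
  -- strict at `x₀`, because `P x₀` is a norm, and joint continuity spreads them to a common
  -- neighbourhood of `x₀`.
  have key := hK.eventually_forall_of_forall_eventually (x₀ := x₀)
    (P := fun z η => P z (chartCovector e z η) ≤ (1 + ε) * P x₀ (chartCovector e x₀ η) ∧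
      P x₀ (chartCovector e x₀ η) ≤ (1 + ε) * P z (chartCovector e z η)) ?_
  · filter_upwards [key] with z hz η
    by_cases hη : η = 0
    · have h0 : ∀ z : M, chartCovector e z (0 : EuclideanSpace ℝ (Fin n) →L[ℝ] ℝ) = 0 :=
        fun z => ContinuousLinearMap.zero_comp _
      simp [hη, h0, hP.zero]
    have hn : 0 < ‖η‖ := norm_pos_iff.2 hη
    have h1 := hz (‖η‖⁻¹ • η) (by simp [norm_smul, hn.ne'])
    simp only [chartCovector_smul, hP.smul, abs_inv, abs_norm] at h1
    constructor
    · refine le_of_mul_le_mul_left ?_ (inv_pos.2 hn)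
      linarith [h1.1]
    · refine le_of_mul_le_mul_left ?_ (inv_pos.2 hn)
      linarith [h1.2]
  · intro η hη
    have hη0 : η ≠ 0 := by
      rintro rfl
      simp at hη
    have hpos : 0 < P x₀ (chartCovector e x₀ η) :=
      lt_of_le_of_ne (hP.nonneg _ _) fun h =>
        hη0 (chartCovector_eq_zero he hx₀ (hN _ _ h.symm))
    have h1 := hP.continuousAt_uncurry_chartCovector he hx₀ η
    have h2 : ContinuousAt (fun q : M × (EuclideanSpace ℝ (Fin n) →L[ℝ] ℝ) =>
        P x₀ (chartCovector e x₀ q.2)) (x₀, η) :=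
      ContinuousAt.comp (f := fun q : M × (EuclideanSpace ℝ (Fin n) →L[ℝ] ℝ) => (x₀, q.2))
        (x := (x₀, η)) h1 (by fun_prop)
    have h3 := h1.tendsto.eventually_lt (h2.tendsto.const_mul (1 + ε)) (by
      dsimp only; nlinarith)
    have h4 := h2.tendsto.eventually_lt (h1.tendsto.const_mul (1 + ε)) (by
      dsimp only; nlinarith)
    filter_upwards [h3, h4] with q hq1 hq2 using ⟨hq1.le, hq2.le⟩

end IsContinuousSeminorm

end Seminorm

theorem _root_.AbsolutelyContinuousOnInterval.of_dist_le {X Y : Type*} [PseudoMetricSpace X]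
    [PseudoMetricSpace Y] {f : ℝ → X} {g : ℝ → Y} {a b K : ℝ}
    (hf : AbsolutelyContinuousOnInterval f a b)
    (h : ∀ s ∈ uIcc a b, ∀ t ∈ uIcc a b, dist (g s) (g t) ≤ K * dist (f s) (f t)) :
    AbsolutelyContinuousOnInterval g a b := by
  rw [absolutelyContinuousOnInterval_iff] at hf ⊢
  intro ε hε
  -- `K` may be zero or negative, so the argument uses the positive constant `|K| + 1`.
  have hK : 0 < |K| + 1 := by positivity
  obtain ⟨δ, hδ, hd⟩ := hf (ε / (|K| + 1)) (by positivity)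
  refine ⟨δ, hδ, fun E hE hs => ?_⟩
  calc ∑ i ∈ Finset.range E.1, dist (g (E.2 i).1) (g (E.2 i).2)
      ≤ ∑ i ∈ Finset.range E.1, (|K| + 1) * dist (f (E.2 i).1) (f (E.2 i).2) := by
        refine Finset.sum_le_sum fun i hi => (h _ (hE.1 i hi).1 _ (hE.1 i hi).2).trans ?_
        gcongr
        linarith [le_abs_self K]
    _ = (|K| + 1) * ∑ i ∈ Finset.range E.1, dist (f (E.2 i).1) (f (E.2 i).2) :=
        (Finset.mul_sum _ _ _).symm
    _ < (|K| + 1) * (ε / (|K| + 1)) := by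
        have := hd E hE hs
        gcongr
    _ = ε := by field_simp

/-! ### Subunit curves in their three forms, and the control distance. -/

section Curves

variable {n : ℕ} {M : Type*} [TopologicalSpace M] [ChartedSpace (EuclideanSpace ℝ (Fin n)) M]

/-- The integrated form of the subunit condition, tested on smooth functions. -/
def IsWeaklySubunit (P : ∀ x : M, Cotangent n x → ℝ) (γ : ℝ → M) : Prop :=
  ∀ h : M → ℝ, ContMDiff (𝓡 n) 𝓘(ℝ, ℝ) ∞ h → ∀ s t c : ℝ, s ≤ t →
    (∀ r ∈ Icc s t, P (γ r) (differential n h (γ r)) ≤ c) → |h (γ t) - h (γ s)| ≤ c * (t - s)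

/-- The infinitesimal form of the subunit condition, tested on smooth functions. -/
def IsLocallySubunit (P : ∀ x : M, Cotangent n x → ℝ) (γ : ℝ → M) : Prop :=
  ∀ h : M → ℝ, ContMDiff (𝓡 n) 𝓘(ℝ, ℝ) ∞ h → ∀ t₀ c : ℝ,
    P (γ t₀) (differential n h (γ t₀)) < c →
      ∀ᶠ q : ℝ × ℝ in 𝓝 (t₀, t₀), |h (γ q.1) - h (γ q.2)| ≤ c * |q.1 - q.2|

theorem IsWeaklySubunit.mono {P Q : ∀ x : M, Cotangent n x → ℝ} (hPQ : ∀ x ξ, P x ξ ≤ Q x ξ)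
    {γ : ℝ → M} (h : IsWeaklySubunit P γ) : IsWeaklySubunit Q γ :=
  fun f hf s t c hst hc => h f hf s t c hst fun r hr => (hPQ _ _).trans (hc r hr)

theorem IsWeaklySubunit.reverse {P : ∀ x : M, Cotangent n x → ℝ} {γ : ℝ → M}
    (h : IsWeaklySubunit P γ) (T : ℝ) : IsWeaklySubunit P fun t => γ (T - t) := by
  intro f hf s t c hst hc
  have h1 := h f hf (T - t) (T - s) c (by linarith) fun r hr => by
    have h2 : P (γ (T - (T - r))) (differential n f (γ (T - (T - r)))) ≤ c :=
      hc (T - r) ⟨by linarith [hr.2], by linarith [hr.1]⟩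
    rwa [sub_sub_cancel] at h2
  rw [abs_sub_comm] at h1
  have h2 : T - s - (T - t) = t - s := by ring
  rwa [h2] at h1

/-- The bound is additive in time, so an interval containing `T` is cut there and the two increments
are added. -/
theorem IsWeaklySubunit.concat {P : ∀ x : M, Cotangent n x → ℝ} {γ γ' : ℝ → M}
    (h : IsWeaklySubunit P γ) (h' : IsWeaklySubunit P γ') {T : ℝ} (hT : γ T = γ' 0) :
    IsWeaklySubunit P fun t => if t ≤ T then γ t else γ' (t - T) := by
  set β : ℝ → M := fun t => if t ≤ T then γ t else γ' (t - T) with hβ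
  have hl : ∀ t ≤ T, β t = γ t := fun t ht => if_pos ht
  have hr : ∀ t, T ≤ t → β t = γ' (t - T) := by
    intro t ht
    rcases ht.eq_or_lt with rfl | ht
    · rw [hl _ le_rfl, hT, sub_self]
    · exact if_neg ht.not_ge
  have left : ∀ f : M → ℝ, ContMDiff (𝓡 n) 𝓘(ℝ, ℝ) ∞ f → ∀ s t c : ℝ, s ≤ t → t ≤ T →
      (∀ r ∈ Icc s t, P (β r) (differential n f (β r)) ≤ c) →
        |f (β t) - f (β s)| ≤ c * (t - s) := by
    intro f hf s t c hst htT hc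
    rw [hl t htT, hl s (hst.trans htT)]
    exact h f hf s t c hst fun r hr => by
      have := hc r hr
      rwa [hl r (hr.2.trans htT)] at this
  have right : ∀ f : M → ℝ, ContMDiff (𝓡 n) 𝓘(ℝ, ℝ) ∞ f → ∀ s t c : ℝ, s ≤ t → T ≤ s →
      (∀ r ∈ Icc s t, P (β r) (differential n f (β r)) ≤ c) →
        |f (β t) - f (β s)| ≤ c * (t - s) := by
    intro f hf s t c hst hTs hc
    rw [hr t (hTs.trans hst), hr s hTs]
    have h1 := h' f hf (s - T) (t - T) c (by linarith) fun r hr' => by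
      have := hc (r + T) ⟨by linarith [hr'.1], by linarith [hr'.2]⟩
      rwa [hr (r + T) (by linarith [hr'.1]), add_sub_cancel_right] at this
    have h2 : t - T - (s - T) = t - s := by ring
    rwa [h2] at h1
  intro f hf s t c hst hc
  rcases le_total t T with htT | htT
  · exact left f hf s t c hst htT hc
  rcases le_total T s with hTs | hTs
  · exact right f hf s t c hst hTs hc
  have h1 := left f hf s T c hTs le_rfl fun r hr => hc r ⟨hr.1, hr.2.trans htT⟩
  have h2 := right f hf T t c htT le_rfl fun r hr => hc r ⟨hTs.trans hr.1, hr.2⟩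
  have h3 := abs_sub_le (f (β t)) (f (β T)) (f (β s))
  nlinarith

theorem hasDerivAt_comp_of_hasMFDerivAt {h : M → ℝ} (hh : ContMDiff (𝓡 n) 𝓘(ℝ, ℝ) ∞ h)
    {γ : ℝ → M} {t : ℝ} {v : TangentSpace (𝓡 n) (γ t)}
    (hv : HasMFDerivAt 𝓘(ℝ, ℝ) (𝓡 n) γ t (ContinuousLinearMap.toSpanSingleton ℝ v)) :
    HasDerivAt (fun r => h (γ r)) (differential n h (γ t) v) t := by
  have hd : HasMFDerivAt 𝓘(ℝ, ℝ) 𝓘(ℝ, ℝ) (h ∘ γ) t _ :=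
    ((hh (γ t)).mdifferentiableAt (by simp)).hasMFDerivAt.comp t hv
  have hd' : HasFDerivAt (fun r => h (γ r))
      ((differential n h (γ t) : EuclideanSpace ℝ (Fin n) →L[ℝ] ℝ).comp
        (ContinuousLinearMap.toSpanSingleton ℝ (v : EuclideanSpace ℝ (Fin n)))) t := hd.hasFDerivAt
  simpa using hd'.hasDerivAt

theorem differential_eq_zero_of_notMem_tsupport {χ : M → ℝ} {z : M} (hz : z ∉ tsupport χ) :
    differential n χ z = 0 := by
  have h : χ =ᶠ[𝓝 z] fun _ => 0 := notMem_tsupport_iff_eventuallyEq.1 hz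
  unfold differential
  rw [h.mfderiv_eq]
  exact mfderiv_const

variable {P : ∀ x : M, Cotangent n x → ℝ} (hP : IsContinuousSeminorm P)
include hP

theorem IsContinuousSeminorm.exists_bound {χ : M → ℝ} (hχ : ContMDiff (𝓡 n) 𝓘(ℝ, ℝ) ∞ χ)
    (hc : HasCompactSupport χ) : ∃ C : ℝ, 0 < C ∧ ∀ z, P z (differential n χ z) ≤ C := by
  obtain ⟨C, hC⟩ := hc.exists_bound_of_continuousOn
    (hP.continuous_differential χ hχ).continuousOn
  refine ⟨|C| + 1, by positivity, fun z => ?_⟩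
  by_cases hz : z ∈ tsupport χ
  · linarith [hC z hz, le_abs_self C, Real.le_norm_self (P z (differential n χ z))]
  · rw [differential_eq_zero_of_notMem_tsupport hz, hP.zero]
    positivity

/-- Rescaling `ξ` into the unit ball gives the bound. The divisor is `P x ξ + ε`, since `P x ξ` may
vanish. -/
theorem IsContinuousSeminorm.abs_apply_le {x : M} {v : TangentSpace (𝓡 n) x}
    (hv : dualNorm P x v ≤ 1) (ξ : Cotangent n x) : |ξ v| ≤ P x ξ := by
  refine le_of_forall_pos_le_add fun ε hε => ?_
  have ha : 0 < P x ξ + ε := by linarith [hP.nonneg x ξ]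
  have h1 : P x ((P x ξ + ε)⁻¹ • ξ) ≤ 1 := by
    rw [hP.smul, abs_of_pos (inv_pos.2 ha), inv_mul_le_one₀ ha]
    linarith
  have h2 : ENNReal.ofReal |((P x ξ + ε)⁻¹ • ξ) v| ≤ 1 :=
    (le_iSup₂ (f := fun (ξ : Cotangent n x) (_ : P x ξ ≤ 1) => ENNReal.ofReal |ξ v|) _ h1).trans hv
  have h3 : |(P x ξ + ε)⁻¹ * ξ v| ≤ 1 := ENNReal.ofReal_le_one.1 h2
  rwa [abs_mul, abs_of_pos (inv_pos.2 ha), inv_mul_le_one₀ ha] at h3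

variable [IsManifold (𝓡 n) ∞ M]

/-- While `γ` remains in a chart, `h ∘ γ` is a Lipschitz function of an absolutely continuous curve.
It is thus the integral of its derivative `dh(γ')`, which is at most `P(dh)` in absolute value. -/
theorem IsSubunitCurve.abs_sub_le {γ : ℝ → M} {a b : ℝ} (hγ : IsSubunitCurve P γ a b)
    {h : M → ℝ} (hh : ContMDiff (𝓡 n) 𝓘(ℝ, ℝ) ∞ h) {s t c : ℝ} (hst : s ≤ t)
    (hsub : Icc s t ⊆ Icc a b)
    (hc : ∀ r ∈ Icc s t, P (γ r) (differential n h (γ r)) ≤ c) :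
    |h (γ t) - h (γ s)| ≤ c * (t - s) := by
  have hcont : ContinuousOn (fun r => h (γ r)) (Icc s t) :=
    hh.continuous.comp_continuousOn (hγ.1.1.mono hsub)
  -- the estimate on short intervals
  have hloc : ∀ x ∈ Ico s t, ∀ᶠ z in 𝓝[>] x, |h (γ z) - h (γ x)| ≤ c * (z - x) := by
    intro x hx
    set e := chartAt (EuclideanSpace ℝ (Fin n)) (γ x) with he
    have hxe : γ x ∈ e.source := mem_chart_source _ _
    have hH : ContDiffAt ℝ 1 (h ∘ e.symm) (e (γ x)) := by
      have h1 : ContMDiffAt (𝓡 n) (𝓡 n) ∞ e.symm (e (γ x)) :=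
        contMDiffAt_symm_of_mem_maximalAtlas
          (IsManifold.subset_maximalAtlas (chart_mem_atlas _ _)) (e.map_source hxe)
      exact ((hh _).comp _ h1).contDiffAt.of_le (by simp)
    obtain ⟨K, N, hN, hK⟩ := hH.exists_lipschitzOnWith
    have hnhds : e.source ∩ e ⁻¹' N ∈ 𝓝 (γ x) :=
      inter_mem (e.open_source.mem_nhds hxe) ((e.continuousAt hxe) hN)
    have hγx : ContinuousWithinAt γ (Icc s t) x := hγ.1.1.mono hsub x ⟨hx.1, hx.2.le⟩
    obtain ⟨δ, hδ, hball⟩ := Metric.mem_nhdsWithin_iff.1 (hγx hnhds)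
    filter_upwards [Ioo_mem_nhdsGT hx.2, Ioo_mem_nhdsGT (show x < x + δ by linarith)] with z hz hz'
    have hIcc : Icc x z ⊆ Icc s t := Icc_subset_Icc hx.1 hz.2.le
    have hmem : ∀ r ∈ Icc x z, γ r ∈ e.source ∩ e ⁻¹' N := fun r hr =>
      hball ⟨by rw [Metric.mem_ball, Real.dist_eq, abs_of_nonneg (by linarith [hr.1])]
                linarith [hr.2, hz'.2], hIcc hr⟩
    have hac : AbsolutelyContinuousOnInterval (fun r => h (γ r)) x z := by
      refine (hγ.1.2 e (chart_mem_atlas _ _) x z hz.1.le (hIcc.trans hsub)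
        fun r hr => (hmem r hr).1).of_dist_le (K := K) fun r hr r' hr' => ?_
      rw [uIcc_of_le hz.1.le] at hr hr'
      have := hK.dist_le_mul _ (hmem r hr).2 _ (hmem r' hr').2
      simpa [Function.comp_def, e.left_inv (hmem r hr).1, e.left_inv (hmem r' hr').1] using this
    have hint := hac.integral_deriv_eq_sub
    have hae : ∀ᵐ r, r ∈ uIoc x z → ‖deriv (fun r => h (γ r)) r‖ ≤ c := by
      filter_upwards [hγ.2, (finite_singleton z).countable.ae_notMem volume] with r hr hrz hrm
      rw [uIoc_of_le hz.1.le] at hrm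
      have hrz' : r < z := lt_of_le_of_ne hrm.2 hrz
      have hrI : r ∈ Icc x z := ⟨hrm.1.le, hrm.2⟩
      have hax := hsub (hIcc (left_mem_Icc.2 hz.1.le))
      have hzb := hsub (hIcc (right_mem_Icc.2 hz.1.le))
      obtain ⟨v, hv, hv1⟩ := hr ⟨hax.1.trans_lt hrm.1, hrz'.trans_le hzb.2⟩
      have hd' := hasDerivAt_comp_of_hasMFDerivAt hh hv
      rw [hd'.deriv]
      exact (hP.abs_apply_le hv1 _).trans (hc r (hIcc hrI))
    have h2 := intervalIntegral.norm_integral_le_of_norm_le_const_ae hae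
    rw [hint, abs_of_nonneg (by linarith [hz.1])] at h2
    exact h2
  -- The estimates on short intervals bound the right slopes of `|h ∘ γ - h (γ s)|` by `c`; a
  -- comparison principle for continuous functions makes this global on `[s, t]`, with no
  -- subdivision into charts.
  have key := image_le_of_liminf_slope_right_le_deriv_boundary
    (f := fun r => |h (γ r) - h (γ s)|) (a := s) (b := t) (hcont.sub continuousOn_const).abs
    (B := fun r => c * (r - s)) (B' := fun _ => c) (by simp) (by fun_prop)
    (fun x _ => by
      have := ((hasDerivAt_id x).sub_const s).const_mul c
      simpa using this.hasDerivWithinAt) ?_ (right_mem_Icc.2 hst)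
  · exact key
  · intro x hx r hr
    refine ((hloc x hx).and self_mem_nhdsWithin).frequently.mono fun z hz => ?_
    have hxz : 0 < z - x := sub_pos.2 hz.2
    rw [slope_def_field, div_lt_iff₀ hxz]
    have := abs_sub_abs_le_abs_sub (h (γ z) - h (γ s)) (h (γ x) - h (γ s))
    rw [sub_sub_sub_cancel_right] at this
    nlinarith [hz.1]

omit [IsManifold (𝓡 n) ∞ M] in
/-- A curve which is weakly subunit on `[0, T]` becomes weakly subunit on the whole line when it is
extended by constants. -/
theorem exists_isWeaklySubunit_of_Icc {γ : ℝ → M} {T : ℝ} (hT : 0 < T)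
    (hγ : ∀ h : M → ℝ, ContMDiff (𝓡 n) 𝓘(ℝ, ℝ) ∞ h → ∀ s t c : ℝ, s ≤ t → Icc s t ⊆ Icc 0 T →
      (∀ r ∈ Icc s t, P (γ r) (differential n h (γ r)) ≤ c) →
        |h (γ t) - h (γ s)| ≤ c * (t - s)) :
    ∃ γ' : ℝ → M, IsWeaklySubunit P γ' ∧ (∀ t ≤ 0, γ' t = γ 0) ∧ ∀ t, T ≤ t → γ' t = γ T := by
  -- Clamping to `[0, T]` is monotone and `1`-Lipschitz, so time increments only shrink. By the
  -- intermediate value theorem every time between `f s` and `f t` is attained on `[s, t]`, where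
  -- the bound by `c` is given.
  set f : ℝ → ℝ := fun t => max 0 (min t T) with hf
  have hfc : Continuous f := by fun_prop
  have hfm : Monotone f := fun s t hst => max_le_max le_rfl (min_le_min hst le_rfl)
  have hfI : ∀ t, f t ∈ Icc 0 T := fun t => ⟨le_max_left _ _, max_le hT.le (min_le_right _ _)⟩
  have hfl : ∀ s t, s ≤ t → f t - f s ≤ t - s := by
    intro s t hst
    simp only [hf]
    rcases max_cases 0 (min t T) with h | h <;> rcases max_cases 0 (min s T) with h' | h' <;>
      rcases min_cases t T with h'' | h'' <;> rcases min_cases s T with h₃ | h₃ <;> linarith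
  refine ⟨fun t => γ (f t), ?_, fun t ht => ?_, fun t ht => ?_⟩
  · intro h hh s t c hst hc
    have h1 := hγ h hh (f s) (f t) c (hfm hst) (Icc_subset_Icc (hfI s).1 (hfI t).2) ?_
    · have h0 : 0 ≤ c := (hP.nonneg _ _).trans (hc s (left_mem_Icc.2 hst))
      exact h1.trans (mul_le_mul_of_nonneg_left (hfl s t hst) h0)
    · intro r hr
      obtain ⟨r', hr', rfl⟩ := intermediate_value_Icc hst hfc.continuousOn hr
      exact hc r' hr'
  · simp [hf, ht]
  · simp [hf, ht, hT.le]

theorem IsSubunitCurve.exists_isWeaklySubunit {γ : ℝ → M} {T : ℝ} (hT : 0 < T)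
    (hγ : IsSubunitCurve P γ 0 T) :
    ∃ γ' : ℝ → M, IsWeaklySubunit P γ' ∧ (∀ t ≤ 0, γ' t = γ 0) ∧ ∀ t, T ≤ t → γ' t = γ T :=
  exists_isWeaklySubunit_of_Icc hP hT fun _ hh _ _ _ hst hsub hc =>
    hγ.abs_sub_le hP hh hst hsub hc

variable [T2Space M]

/-- Weakly subunit curves are locally equicontinuous. -/
theorem IsContinuousSeminorm.equicontinuous {p : M} {U : Set M} (hU : U ∈ 𝓝 p) :
    ∃ V ∈ 𝓝 p, ∃ δ : ℝ, 0 < δ ∧ ∀ γ, IsWeaklySubunit P γ → ∀ t₀, γ t₀ ∈ V →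
      ∀ t, |t - t₀| < δ → γ t ∈ U := by
  obtain ⟨χ, hχ, hχc, hχU, hχ1⟩ := exists_bump (n := n) hU
  obtain ⟨C, hC, hb⟩ := hP.exists_bound hχ hχc
  -- Along a weakly subunit curve `χ` changes at speed at most `C`. Starting above `1 / 2`, it
  -- remains positive for time `1 / (2C)`, so the curve stays in the support of `χ`.
  refine ⟨{z | 1 / 2 < χ z}, hχ.continuous.continuousAt.eventually_const_lt (by
    rw [hχ1.self_of_nhds]; norm_num), 1 / (2 * C), by positivity, fun γ hγ t₀ h0 t ht => ?_⟩
  have hle : |χ (γ t) - χ (γ t₀)| ≤ C * |t - t₀| := by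
    rcases le_total t₀ t with h | h
    · rw [abs_of_nonneg (sub_nonneg.2 h)]
      exact hγ χ hχ t₀ t C h fun r _ => hb _
    · rw [abs_sub_comm, abs_sub_comm t, abs_of_nonneg (sub_nonneg.2 h)]
      exact hγ χ hχ t t₀ C h fun r _ => hb _
  have h2 : C * |t - t₀| < 1 / 2 := by
    calc C * |t - t₀| < C * (1 / (2 * C)) := by gcongr
      _ = 1 / 2 := by field_simp
  have h3 := (abs_lt.1 (hle.trans_lt h2)).1
  have h4 : 1 / 2 < χ (γ t₀) := h0
  exact hχU (subset_tsupport χ (ne_of_gt (show 0 < χ (γ t) by linarith)))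

/-- The curve remains for time `δ` in the set where `P(dh) < c`. The point is that `V` and `δ` do
not depend on `γ`; this uniformity lets the estimate pass to limits of curves. -/
theorem IsContinuousSeminorm.eventually_abs_sub_le {p : M} {h : M → ℝ}
    (hh : ContMDiff (𝓡 n) 𝓘(ℝ, ℝ) ∞ h) {c : ℝ} (hc : P p (differential n h p) < c) :
    ∃ V ∈ 𝓝 p, ∃ δ : ℝ, 0 < δ ∧ ∀ γ, IsWeaklySubunit P γ → ∀ t₀, γ t₀ ∈ V →
      ∀ s t, |s - t₀| < δ → |t - t₀| < δ → |h (γ s) - h (γ t)| ≤ c * |s - t| := by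
  obtain ⟨V, hV, δ, hδ, H⟩ := hP.equicontinuous
    ((hP.continuous_differential h hh).continuousAt.eventually_lt_const hc)
  refine ⟨V, hV, δ, hδ, fun γ hγ t₀ h0 s t hs ht => ?_⟩
  wlog hst : t ≤ s generalizing s t
  · rw [abs_sub_comm, abs_sub_comm s]
    exact this t s ht hs (le_of_not_ge hst)
  rw [abs_of_nonneg (sub_nonneg.2 hst)]
  refine hγ h hh t s c hst fun r hr => (H γ hγ t₀ h0 r ?_).le
  rw [abs_lt] at hs ht ⊢
  exact ⟨by linarith [hr.1], by linarith [hr.2]⟩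

theorem IsWeaklySubunit.isLocallySubunit {γ : ℝ → M} (hγ : IsWeaklySubunit P γ) :
    IsLocallySubunit P γ := by
  intro h hh t₀ c hc
  obtain ⟨V, hV, δ, hδ, H⟩ := hP.eventually_abs_sub_le hh hc
  filter_upwards [prod_mem_nhds (Metric.ball_mem_nhds t₀ hδ) (Metric.ball_mem_nhds t₀ hδ)]
    with q hq
  exact H γ hγ t₀ (mem_of_mem_nhds hV) _ _ hq.1 hq.2

omit hP in
-- Continuity is not part of the hypothesis: it comes from testing with a cut-off function, which
-- must stay positive along the curve for times near `t₀`.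
theorem IsLocallySubunit.continuous {γ : ℝ → M} (hγ : IsLocallySubunit P γ) : Continuous γ := by
  rw [continuous_iff_continuousAt]
  intro t₀ U hU
  obtain ⟨χ, hχ, -, hχU, hχ1⟩ := exists_bump (n := n) hU
  have h1 := hγ χ hχ t₀ _ (lt_add_one _)
  have h2 : ∀ᶠ t in 𝓝 t₀, |χ (γ t) - χ (γ t₀)| ≤
      (P (γ t₀) (differential n χ (γ t₀)) + 1) * |t - t₀| :=
    (Continuous.prodMk_left t₀).continuousAt.eventually h1
  have h3 : ∀ᶠ t in 𝓝 t₀, (P (γ t₀) (differential n χ (γ t₀)) + 1) * |t - t₀| < 1 :=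
    Filter.Tendsto.eventually_lt_const (v := (P (γ t₀) (differential n χ (γ t₀)) + 1) * |t₀ - t₀|)
      (by simp) (Continuous.tendsto (by fun_prop) t₀)
  refine mem_map.2 ?_
  filter_upwards [h2, h3] with t ht2 ht3
  have h4 := (abs_lt.1 (ht2.trans_lt ht3)).1
  have h5 : χ (γ t₀) = 1 := hχ1.self_of_nhds
  exact hχU (subset_tsupport χ (ne_of_gt (show 0 < χ (γ t) by linarith)))

omit hP in
-- The chart coordinates, extended from a neighbourhood to global functions, are admissible test
-- functions; their Lipschitz constants add up.
theorem IsLocallySubunit.exists_lipschitzOnWith {γ : ℝ → M} (hγ : IsLocallySubunit P γ)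
    {e : OpenPartialHomeomorph M (EuclideanSpace ℝ (Fin n))}
    (he : e ∈ atlas (EuclideanSpace ℝ (Fin n)) M) {t₀ : ℝ} (ht₀ : γ t₀ ∈ e.source) :
    ∃ K : NNReal, ∃ N ∈ 𝓝 t₀, LipschitzOnWith K (fun r => e (γ r)) N := by
  obtain ⟨U, hUo, hxU, hUe, -, hU⟩ := exists_extension he ht₀
  have hi : ∀ i : Fin n, ∃ c : ℝ, 0 ≤ c ∧ ∀ᶠ q : ℝ × ℝ in 𝓝 (t₀, t₀),
      |e (γ q.1) i - e (γ q.2) i| ≤ c * |q.1 - q.2| := by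
    intro i
    obtain ⟨h, hh, heq⟩ := hU (fun y => y i)
      (EuclideanSpace.proj i : EuclideanSpace ℝ (Fin n) →L[ℝ] ℝ).contDiff
    refine ⟨|P (γ t₀) (differential n h (γ t₀))| + 1, by positivity, ?_⟩
    have hc : ContinuousAt γ t₀ := hγ.continuous.continuousAt
    have hUn := hc (hUo.mem_nhds hxU)
    filter_upwards [hγ h hh t₀ _ (lt_of_le_of_lt (le_abs_self _) (lt_add_one _)),
      prod_mem_nhds hUn hUn] with q hq hqU
    rwa [heq _ hqU.1, heq _ hqU.2] at hq
  choose c hc0 hc using hi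
  obtain ⟨N, hN, N', hN', hNN⟩ := mem_nhds_prod_iff.1 (eventually_all.2 hc)
  refine ⟨(∑ i, c i).toNNReal, N ∩ N', inter_mem hN hN',
    LipschitzOnWith.of_dist_le_mul fun s hs t ht => ?_⟩
  rw [Real.coe_toNNReal _ (Finset.sum_nonneg fun i _ => hc0 i), dist_eq_norm, Real.dist_eq]
  calc ‖e (γ s) - e (γ t)‖
      = ‖∑ i, (e (γ s) - e (γ t)) i • (EuclideanSpace.single i (1 : ℝ))‖ := by
        conv_lhs => rw [← (EuclideanSpace.basisFun (Fin n) ℝ).sum_repr (e (γ s) - e (γ t))]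
        simp
    _ ≤ ∑ i, c i * |s - t| := by
        refine (norm_sum_le _ _).trans (Finset.sum_le_sum fun i _ => ?_)
        have := hNN (show (s, t) ∈ N ×ˢ N' from ⟨hs.1, ht.2⟩) i
        simpa [norm_smul] using this
    _ = (∑ i, c i) * |s - t| := (Finset.sum_mul _ _ _).symm

omit hP in
-- Every covector is the differential of a global smooth function, whose derivative along `γ` is
-- bounded by each `c > 1` when `P(ξ) ≤ 1`.
theorem IsLocallySubunit.dualNorm_le {γ : ℝ → M} (hγ : IsLocallySubunit P γ) {t : ℝ}
    {v : TangentSpace (𝓡 n) (γ t)}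
    (hv : HasMFDerivAt 𝓘(ℝ, ℝ) (𝓡 n) γ t (ContinuousLinearMap.toSpanSingleton ℝ v)) :
    dualNorm P (γ t) v ≤ 1 := by
  refine iSup₂_le fun ξ hξ => ENNReal.ofReal_le_one.2 (le_of_forall_gt_imp_ge_of_dense
    fun c hc => ?_)
  obtain ⟨h, hh, rfl⟩ := exists_differential_eq (γ t) ξ
  have hd' := hasDerivAt_comp_of_hasMFDerivAt hh hv
  have h1 := hγ h hh t c (hξ.trans_lt hc)
  have h2 : ∀ᶠ r in 𝓝 t, |h (γ r) - h (γ t)| ≤ c * |r - t| :=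
    (Continuous.prodMk_left t).continuousAt.eventually h1
  exact hd'.le_of_lip' (by linarith) h2

omit hP in
/-- Locally subunit curves are subunit. -/
theorem IsLocallySubunit.isSubunitCurve {γ : ℝ → M} (hγ : IsLocallySubunit P γ) (a b : ℝ) :
    IsSubunitCurve P γ a b := by
  refine ⟨⟨hγ.continuous.continuousOn, fun e he s t hst _ hm => ?_⟩, ?_⟩
  · have hl : LocallyLipschitzOn (Icc s t) fun r => e (γ r) := fun r hr => by
      obtain ⟨K, N, hN, hK⟩ := hγ.exists_lipschitzOnWith he (hm hr)
      exact ⟨K, N, mem_nhdsWithin_of_mem_nhds hN, hK⟩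
    obtain ⟨K, hK⟩ := hl.exists_lipschitzOnWith_of_compact isCompact_Icc
    rw [← uIcc_of_le hst] at hK
    exact hK.absolutelyContinuousOnInterval
  · suffices h : ∀ᵐ t ∂(volume : Measure ℝ), MDifferentiableAt 𝓘(ℝ, ℝ) (𝓡 n) γ t by
      filter_upwards [h] with t ht _
      let L : ℝ →L[ℝ] EuclideanSpace ℝ (Fin n) := mfderiv 𝓘(ℝ, ℝ) (𝓡 n) γ t
      have hL : L = ContinuousLinearMap.toSpanSingleton ℝ (L 1) := by ext1; simp
      have hv : HasMFDerivAt 𝓘(ℝ, ℝ) (𝓡 n) γ t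
          (ContinuousLinearMap.toSpanSingleton ℝ (L 1 : TangentSpace (𝓡 n) (γ t))) :=
        Eq.subst (motive := fun L' : ℝ →L[ℝ] EuclideanSpace ℝ (Fin n) =>
          HasMFDerivAt 𝓘(ℝ, ℝ) (𝓡 n) γ t L') hL ht.hasMFDerivAt
      exact ⟨_, hv, hγ.dualNorm_le hv⟩
    -- Differentiability almost everywhere is a local question, and in a chart `γ` is locally
    -- Lipschitz.
    refine measure_null_of_locally_null _ fun t₀ _ => ?_
    set e := chartAt (EuclideanSpace ℝ (Fin n)) (γ t₀) with he
    obtain ⟨K, N, hN, hK⟩ := hγ.exists_lipschitzOnWith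
      (chart_mem_atlas (EuclideanSpace ℝ (Fin n)) (γ t₀)) (mem_chart_source _ _)
    have hs : γ ⁻¹' e.source ∈ 𝓝 t₀ :=
      hγ.continuous.continuousAt (e.open_source.mem_nhds (mem_chart_source _ _))
    obtain ⟨O, hO, hOo, htO⟩ := mem_nhds_iff.1 (inter_mem hN hs)
    refine ⟨O ∩ _, inter_comm _ O ▸ inter_mem_nhdsWithin _ (hOo.mem_nhds htO), ?_⟩
    have hae := (hK.mono fun r hr => (hO hr).1).ae_differentiableWithinAt_of_mem_real (s := O)
    refine measure_mono_null (fun t ht => ?_) hae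
    intro hd
    refine ht.2 ?_
    have h1 : DifferentiableAt ℝ (fun r => e (γ r)) t :=
      (hd ht.1).differentiableAt (hOo.mem_nhds ht.1)
    have hts : γ t ∈ e.source := (hO ht.1).2
    have h2 : MDifferentiableAt (𝓡 n) (𝓡 n) e.symm (e (γ t)) :=
      (mdifferentiable_of_mem_atlas_inf (chart_mem_atlas _ _)).mdifferentiableAt_symm
        (e.map_source hts)
    have h3 : MDifferentiableAt 𝓘(ℝ, ℝ) (𝓡 n) (e.symm ∘ fun r => e (γ r)) t :=
      MDifferentiableAt.comp t h2 h1.mdifferentiableAt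
    refine h3.congr_of_eventuallyEq ?_
    filter_upwards [hOo.mem_nhds ht.1] with r hr
    exact (e.left_inv (hO hr).2).symm

omit hP in
theorem IsLocallySubunit.controlDist_le {γ : ℝ → M} (hγ : IsLocallySubunit P γ) {T : ℝ}
    (hT : 0 < T) : controlDist P (γ 0) (γ T) ≤ ENNReal.ofReal T :=
  iInf₂_le T ⟨hT, γ, hγ.isSubunitCurve 0 T, rfl, rfl⟩

theorem IsWeaklySubunit.controlDist_le {γ : ℝ → M} (hγ : IsWeaklySubunit P γ) {T : ℝ}
    (hT : 0 < T) : controlDist P (γ 0) (γ T) ≤ ENNReal.ofReal T :=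
  (hγ.isLocallySubunit hP).controlDist_le hT

omit [T2Space M] in
theorem exists_isWeaklySubunit_of_controlDist_lt {x y : M} {c : ℝ≥0∞}
    (h : controlDist P x y < c) : ∃ T : ℝ, 0 < T ∧ ENNReal.ofReal T < c ∧ ∃ γ : ℝ → M,
      IsWeaklySubunit P γ ∧ (∀ t ≤ 0, γ t = x) ∧ ∀ t, T ≤ t → γ t = y := by
  unfold controlDist at h
  simp only [iInf_lt_iff] at h
  obtain ⟨T, ⟨hT, γ, hγ, rfl, rfl⟩, hc⟩ := h
  exact ⟨T, hT, hc, hγ.exists_isWeaklySubunit hP hT⟩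

/-- The constant curve is subunit on every interval. Only positive durations are allowed, so zero
appears as an infimum. -/
theorem controlDist_self (x : M) : controlDist P x x = 0 := by
  have hγ : IsWeaklySubunit P fun _ : ℝ => x := fun h _ s t c hst hc => by
    have := (hP.nonneg _ _).trans (hc s (left_mem_Icc.2 hst))
    simpa using mul_nonneg this (sub_nonneg.2 hst)
  refine le_antisymm (le_of_forall_gt_imp_ge_of_dense fun c hc => ?_) zero_le
  obtain ⟨r, hr0, hr⟩ := ENNReal.lt_iff_exists_nnreal_btwn.1 hc
  have h1 := hγ.controlDist_le hP (T := r) (by exact_mod_cast hr0)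
  rw [ENNReal.ofReal_coe_nnreal] at h1
  exact h1.trans hr.le

theorem controlDist_comm_le (x y : M) : controlDist P x y ≤ controlDist P y x := by
  refine le_of_forall_gt_imp_ge_of_dense fun c hc => ?_
  obtain ⟨T, hT, hTc, γ, hγ, h0, h1⟩ := exists_isWeaklySubunit_of_controlDist_lt hP hc
  have := (hγ.reverse T).controlDist_le hP hT
  simp only [sub_zero, sub_self, h0 0 le_rfl, h1 T le_rfl] at this
  exact this.trans hTc.le

theorem controlDist_comm (x y : M) : controlDist P x y = controlDist P y x :=
  (controlDist_comm_le hP x y).antisymm (controlDist_comm_le hP y x)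

theorem controlDist_triangle (x y z : M) :
    controlDist P x z ≤ controlDist P x y + controlDist P y z := by
  refine ENNReal.le_of_forall_pos_le_add fun ε hε hfin => ?_
  have hε' : (ε / 2 : ℝ≥0∞) ≠ 0 := by simp [hε.ne']
  have hx := (ENNReal.add_lt_top.1 hfin).1
  have hy := (ENNReal.add_lt_top.1 hfin).2
  obtain ⟨T, hT, hTc, γ, hγ, h0, h1⟩ := exists_isWeaklySubunit_of_controlDist_lt hP
    (ENNReal.lt_add_right hx.ne hε')
  obtain ⟨T', hT', hTc', γ', hγ', h0', h1'⟩ := exists_isWeaklySubunit_of_controlDist_lt hP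
    (ENNReal.lt_add_right hy.ne hε')
  have hc := (hγ.concat hγ' (T := T) (by rw [h1 T le_rfl, h0' 0 le_rfl])).controlDist_le hP
    (add_pos hT hT')
  simp only [hT.le, if_true, h0 0 le_rfl, add_sub_cancel_left, h1' T' le_rfl,
    (lt_add_of_pos_right T hT').not_ge, if_false] at hc
  refine hc.trans ?_
  rw [ENNReal.ofReal_add hT.le hT'.le]
  calc _ ≤ (controlDist P x y + ε / 2) + (controlDist P y z + ε / 2) := by gcongr
    _ = controlDist P x y + controlDist P y z + (ε / 2 + ε / 2) := by ring
    _ = _ := by rw [ENNReal.add_halves]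

theorem controlDist_mono {Q : ∀ x : M, Cotangent n x → ℝ} (hQ : IsContinuousSeminorm Q)
    (hPQ : ∀ x ξ, P x ξ ≤ Q x ξ) (x y : M) : controlDist Q x y ≤ controlDist P x y := by
  refine le_of_forall_gt_imp_ge_of_dense fun c hc => ?_
  obtain ⟨T, hT, hTc, γ, hγ, h0, h1⟩ := exists_isWeaklySubunit_of_controlDist_lt hP hc
  have := (hγ.mono hPQ).controlDist_le hQ hT
  rw [h0 0 le_rfl, h1 T le_rfl] at this
  exact this.trans hTc.le

omit [T2Space M] in
/-- Smooth functions with `P(dξ) ≤ 1` are `1`-Lipschitz for the control distance. -/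
theorem ofReal_abs_sub_le_controlDist {h : M → ℝ} (hh : ContMDiff (𝓡 n) 𝓘(ℝ, ℝ) ∞ h)
    (h1 : ∀ z, P z (differential n h z) ≤ 1) (x y : M) :
    ENNReal.ofReal |h x - h y| ≤ controlDist P x y := by
  refine le_of_forall_gt_imp_ge_of_dense fun c hc => ?_
  obtain ⟨T, hT, hTc, γ, hγ, h0, hT1⟩ := exists_isWeaklySubunit_of_controlDist_lt hP hc
  have := hγ h hh 0 T 1 hT.le fun r _ => h1 _
  rw [h0 0 le_rfl, hT1 T le_rfl, abs_sub_comm, one_mul, sub_zero] at this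
  exact (ENNReal.ofReal_le_ofReal this).trans hTc.le

end Curves

/-! ### Limits of subunit curves for a decreasing sequence of seminorms. -/

section Limit

variable {n : ℕ} {M : Type*} [TopologicalSpace M] [ChartedSpace (EuclideanSpace ℝ (Fin n)) M]
  [IsManifold (𝓡 n) ∞ M] [T2Space M]

/-- The control distance of a decreasing limit of continuous seminorms, the first of which is
complete, is at most the supremum of the control distances. -/
theorem controlDist_le_iSup {P : ∀ x : M, Cotangent n x → ℝ}
    {Q : ℕ → ∀ x : M, Cotangent n x → ℝ} (hQ : ∀ m, IsContinuousSeminorm (Q m))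
    (hanti : ∀ k m, k ≤ m → ∀ x ξ, Q m x ξ ≤ Q k x ξ)
    (hlim : ∀ x ξ c, P x ξ < c → ∃ k, Q k x ξ < c)
    (hcomplete : IsCompleteSeminorm (Q 0)) (x y : M) :
    controlDist P x y ≤ ⨆ m, controlDist (Q m) x y := by
  refine le_of_forall_gt_imp_ge_of_dense fun c hc => ?_
  obtain ⟨T, hT, hTc⟩ := ENNReal.lt_iff_exists_nnreal_btwn.1 hc
  have hT0 : 0 < (T : ℝ) := by exact_mod_cast zero_le.trans_lt hT
  -- Each curve reaches `y` before time `T` and waits there, so all of them share the interval `[0,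
  -- T]`.
  have hex : ∀ m, ∃ γ : ℝ → M, IsWeaklySubunit (Q m) γ ∧ (∀ t ≤ 0, γ t = x) ∧
      ∀ t, (T : ℝ) ≤ t → γ t = y := by
    intro m
    obtain ⟨S, -, hS, γ, hγ, h0, h1⟩ := exists_isWeaklySubunit_of_controlDist_lt (hQ m)
      ((le_iSup (fun m => controlDist (Q m) x y) m).trans_lt hT)
    rw [← ENNReal.ofReal_coe_nnreal, ENNReal.ofReal_lt_ofReal_iff hT0] at hS
    exact ⟨γ, hγ, h0, fun t ht => h1 t (hS.le.trans ht)⟩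
  choose γ hγ h0 h1 using hex
  have hK := hcomplete {x} isCompact_singleton T hT0
  have hball : ∀ z, controlDist (Q 0) x z ≤ ENNReal.ofReal T →
      z ∈ closure (closedBallAround (Q 0) {x} (T : ℝ)) := fun z hz =>
    subset_closure (by simpa [closedBallAround] using hz)
  -- All the curves are subunit for the largest seminorm `Q 0`, so completeness confines them to one
  -- compact set.
  have hmem : ∀ t m, γ m t ∈ closure (closedBallAround (Q 0) {x} (T : ℝ)) := by
    intro t m
    have hw : IsWeaklySubunit (Q 0) (γ m) := (hγ m).mono (hanti 0 m (Nat.zero_le m))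
    rcases le_or_gt t 0 with ht | ht
    · rw [h0 m t ht]
      exact hball x (by rw [controlDist_self (hQ 0)]; exact zero_le)
    · rcases le_total t T with htT | htT
      · have := hw.controlDist_le (hQ 0) ht
        rw [h0 m 0 le_rfl] at this
        exact hball _ (this.trans (ENNReal.ofReal_le_ofReal htT))
      · have := hw.controlDist_le (hQ 0) hT0
        rw [h0 m 0 le_rfl, h1 m T le_rfl] at this
        rw [h1 m t htT]
        exact hball _ this
  -- A fixed nonprincipal ultrafilter gives limits at all times at once, with no extraction of
  -- subsequences.
  have hlimit : ∀ t, ∃ p : M, Tendsto (fun m => γ m t) (hyperfilter ℕ) (𝓝 p) := by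
    intro t
    obtain ⟨p, -, hp⟩ := hK.ultrafilter_le_nhds' ((hyperfilter ℕ).map fun m => γ m t)
      (mem_map.2 (univ_mem' (hmem t)))
    exact ⟨p, hp⟩
  choose β hβ using hlimit
  have hβx : β 0 = x := tendsto_nhds_unique (hβ 0) (by
    simp only [h0 _ 0 le_rfl]; exact tendsto_const_nhds)
  have hβy : β T = y := tendsto_nhds_unique (hβ T) (by
    simp only [h1 _ T le_rfl]; exact tendsto_const_nhds)
  -- If `P(dh) < a` at `β t₀`, then `Q k (dh) < a` there for some `k`. For `m ≥ k` the curves are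
  -- subunit for `Q k` and, along the ultrafilter, meet `V` at time `t₀`, so their common local
  -- estimate passes to the limit.
  have hloc : IsLocallySubunit P β := by
    intro h hh t₀ a ha
    obtain ⟨k, hk⟩ := hlim _ _ _ ha
    obtain ⟨V, hV, δ, hδ, H⟩ := (hQ k).eventually_abs_sub_le hh hk
    filter_upwards [prod_mem_nhds (Metric.ball_mem_nhds t₀ hδ) (Metric.ball_mem_nhds t₀ hδ)]
      with q hq
    have ht : Tendsto (fun m => |h (γ m q.1) - h (γ m q.2)|) (hyperfilter ℕ)
        (𝓝 |h (β q.1) - h (β q.2)|) :=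
      (((hh.continuous.tendsto _).comp (hβ q.1)).sub
        ((hh.continuous.tendsto _).comp (hβ q.2))).abs
    refine le_of_tendsto ht ?_
    have hge : ∀ᶠ m in (hyperfilter ℕ : Filter ℕ), k ≤ m :=
      Nat.hyperfilter_le_atTop (eventually_ge_atTop k)
    filter_upwards [(hβ t₀) hV, hge] with m hm hkm
    exact H (γ m) ((hγ m).mono (hanti k m hkm)) t₀ hm _ _ hq.1 hq.2
  have := hloc.controlDist_le hT0
  rw [hβx, hβy, ENNReal.ofReal_coe_nnreal] at this
  exact this.trans hTc.le

end Limit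

/-! ### Mollification of Lipschitz functions on euclidean space. -/

section Mollification

variable {n : ℕ}

/-- Seminorms on the dual of a euclidean space are attained at vectors (Hahn--Banach). -/
theorem exists_vector_of_seminorm {p : (EuclideanSpace ℝ (Fin n) →L[ℝ] ℝ) → ℝ}
    (hadd : ∀ η ζ, p (η + ζ) ≤ p η + p ζ) (hsmul : ∀ (c : ℝ) η, p (c • η) = |c| * p η)
    (η₀ : EuclideanSpace ℝ (Fin n) →L[ℝ] ℝ) :
    ∃ v : EuclideanSpace ℝ (Fin n), η₀ v = p η₀ ∧ ∀ η, |η v| ≤ p η := by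
  have hp0 : p 0 = 0 := by simpa using hsmul 0 0
  have hneg : ∀ η, p (-η) = p η := fun η => by
    rw [← neg_one_smul ℝ η, hsmul]
    simp
  have hpos : ∀ η, 0 ≤ p η := fun η => by
    have := hadd η (-η)
    rw [hneg, add_neg_cancel, hp0] at this
    linarith
  by_cases h0 : η₀ = 0
  · exact ⟨0, by simp [h0, hp0], fun η => by simpa using hpos η⟩
  -- The functional taking `η₀` to `p η₀` is dominated by `p` on the line through `η₀` and extends.
  -- In finite dimension the extension is evaluation at the vector `v` whose coordinates are its
  -- values on the coordinate forms.
  obtain ⟨g, hg, hgle⟩ := exists_extension_of_le_sublinear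
    (LinearPMap.mkSpanSingleton η₀ (p η₀) h0) p
    (fun c hc η => by rw [hsmul, abs_of_pos hc]) hadd (by
      rintro ⟨ζ, hζ⟩
      obtain ⟨c, rfl⟩ := Submodule.mem_span_singleton.1 hζ
      rw [LinearPMap.mkSpanSingleton'_apply]
      simp only [smul_eq_mul, RingHom.id_apply, hsmul]
      exact mul_le_mul_of_nonneg_right (le_abs_self c) (hpos _))
  set v : EuclideanSpace ℝ (Fin n) := WithLp.toLp 2 fun i =>
    g (EuclideanSpace.proj i : EuclideanSpace ℝ (Fin n) →L[ℝ] ℝ) with hv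
  have hgv : ∀ η, η v = g η := by
    intro η
    conv_lhs => rw [eq_sum_smul_proj η]
    conv_rhs => rw [eq_sum_smul_proj η]
    rw [map_sum]
    simp [hv]
  refine ⟨v, ?_, fun η => ?_⟩
  · rw [hgv]
    refine (hg ⟨η₀, Submodule.mem_span_singleton_self η₀⟩).trans ?_
    exact LinearPMap.mkSpanSingleton_apply ℝ ℝ h0 (p η₀)
  · rw [hgv, abs_le]
    constructor
    · have := hgle (-η)
      rw [map_neg, hneg] at this
      linarith
    · exact hgle η

/-- Mollification of a function which is Lipschitz for the dual of the norm `p` on covectors. -/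
theorem exists_smooth_approx {p : (EuclideanSpace ℝ (Fin n) →L[ℝ] ℝ) → ℝ}
    (hadd : ∀ η ζ, p (η + ζ) ≤ p η + p ζ) (hsmul : ∀ (c : ℝ) η, p (c • η) = |c| * p η)
    {κ : ℝ} (hκ0 : 0 < κ) (hκ : ∀ η, ‖η‖ ≤ κ * p η) {f : EuclideanSpace ℝ (Fin n) → ℝ}
    {x₀ : EuclideanSpace ℝ (Fin n)} {r L : ℝ} (hr : 0 < r) (hL : 0 < L)
    (hf : ∀ a ∈ Metric.ball x₀ r, ∀ b ∈ Metric.ball x₀ r, ∀ T : ℝ, 0 < T →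
      (∀ η : EuclideanSpace ℝ (Fin n) →L[ℝ] ℝ, |η (b - a)| ≤ T * p η) → |f a - f b| ≤ L * T)
    {δ : ℝ} (hδ : 0 < δ) :
    ∃ F : EuclideanSpace ℝ (Fin n) → ℝ, ContDiff ℝ ∞ F ∧ ∀ a ∈ Metric.ball x₀ (r / 2),
      |F a - f a| ≤ δ ∧ p (fderiv ℝ F a) ≤ L := by
  have hpos : ∀ η, 0 ≤ p η := fun η =>
    nonneg_of_mul_nonneg_right ((norm_nonneg _).trans (hκ η)) hκ0
  have hlip : ∀ a ∈ Metric.ball x₀ r, ∀ b ∈ Metric.ball x₀ r,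
      |f a - f b| ≤ L * (κ * ‖b - a‖) := by
    intro a ha b hb
    rcases eq_or_ne a b with rfl | hab
    · simp
    have hn : 0 < ‖b - a‖ := norm_pos_iff.2 (sub_ne_zero.2 hab.symm)
    refine hf a ha b hb _ (mul_pos hκ0 hn) fun η => ?_
    calc |η (b - a)| ≤ ‖η‖ * ‖b - a‖ := η.le_opNorm _
      _ ≤ κ * p η * ‖b - a‖ := by gcongr; exact hκ η
      _ = κ * ‖b - a‖ * p η := by ring
  have hcont : ContinuousOn f (Metric.ball x₀ r) :=
    (LipschitzOnWith.of_dist_le_mul (K := (L * κ).toNNReal) fun a ha b hb => by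
      rw [Real.coe_toNNReal _ (by positivity), Real.dist_eq, dist_comm, dist_eq_norm, mul_assoc]
      exact hlip a ha b hb).continuousOn
  have hx₀ : x₀ ∈ Metric.ball x₀ r := Metric.mem_ball_self hr
  -- Nothing is known about `f` outside the ball; cutting it off there makes it bounded and
  -- measurable, so that the convolution is defined.
  set f₀ := indicator (Metric.ball x₀ r) f with hf₀
  have hf₀eq : ∀ a ∈ Metric.ball x₀ r, f₀ a = f a := fun a ha => indicator_of_mem ha f
  have hmeas : AEStronglyMeasurable f₀ volume :=
    (aestronglyMeasurable_indicator_iff Metric.isOpen_ball.measurableSet).2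
      (hcont.aestronglyMeasurable Metric.isOpen_ball.measurableSet)
  have hbdd : ∀ a, ‖f₀ a‖ ≤ |f x₀| + L * (κ * r) := by
    intro a
    by_cases ha : a ∈ Metric.ball x₀ r
    · rw [hf₀eq a ha, Real.norm_eq_abs]
      have h1 := hlip x₀ hx₀ a ha
      have h2 : ‖a - x₀‖ ≤ r := by
        rw [← dist_eq_norm]; exact (Metric.mem_ball.1 ha).le
      have h3 : L * (κ * ‖a - x₀‖) ≤ L * (κ * r) := by gcongr
      have h4 := abs_sub_abs_le_abs_sub (f a) (f x₀)
      rw [abs_sub_comm] at h4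
      linarith
    · rw [hf₀, indicator_of_notMem ha, norm_zero]
      positivity
  have hloc : LocallyIntegrable f₀ volume :=
    (locallyIntegrable_const (|f x₀| + L * (κ * r))).mono hmeas
      (Eventually.of_forall fun a => (hbdd a).trans (Real.le_norm_self _))
  -- The bound `r / 2` keeps the translates of the half ball inside the ball, and `δ / (L κ)` limits
  -- the oscillation of `f` over the support of the mollifier to `δ`.
  set R : ℝ := min (r / 2) (δ / (L * κ)) with hR
  have hR0 : 0 < R := lt_min (by positivity) (by positivity)
  let φ : ContDiffBump (0 : EuclideanSpace ℝ (Fin n)) := ⟨R / 2, R, by positivity, by linarith⟩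
  have hmem : ∀ a ∈ Metric.ball x₀ (r / 2), ∀ t, ‖t‖ < R → a - t ∈ Metric.ball x₀ r := by
    intro a ha t ht
    rw [Metric.mem_ball, dist_eq_norm] at ha ⊢
    have h1 : a - t - x₀ = (a - x₀) - t := by abel
    rw [h1]
    have := norm_sub_le (a - x₀) t
    have := ht.trans_le (min_le_left _ _)
    linarith
  set F := convolution (φ.normed volume) f₀ (ContinuousLinearMap.lsmul ℝ ℝ) volume with hF
  have hFapp : ∀ a, F a = ∫ t, φ.normed volume t * f₀ (a - t) := fun a => rfl
  have hconv : ∀ a, Integrable (fun t => φ.normed volume t * f₀ (a - t)) volume := fun a =>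
    φ.hasCompactSupport_normed.convolutionExists_left (ContinuousLinearMap.lsmul ℝ ℝ)
      φ.continuous_normed hloc a
  have hFsmooth : ContDiff ℝ ∞ F :=
    φ.hasCompactSupport_normed.contDiff_convolution_left (ContinuousLinearMap.lsmul ℝ ℝ)
      φ.contDiff_normed hloc
  -- The Lipschitz condition involves only the difference `b - a`, so it holds for all translates of
  -- the pair and passes to their average.
  have hFlip : ∀ a ∈ Metric.ball x₀ (r / 2), ∀ b ∈ Metric.ball x₀ (r / 2), ∀ T : ℝ, 0 < T →
      (∀ η : EuclideanSpace ℝ (Fin n) →L[ℝ] ℝ, |η (b - a)| ≤ T * p η) →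
        |F a - F b| ≤ L * T := by
    intro a ha b hb T hT hη
    rw [hFapp, hFapp, ← integral_sub (hconv a) (hconv b), ← Real.norm_eq_abs]
    refine (norm_integral_le_of_norm_le (g := fun t => φ.normed volume t * (L * T))
      (φ.integrable_normed.mul_const _) (Eventually.of_forall fun t => ?_)).trans (le_of_eq ?_)
    · rw [← mul_sub, norm_mul, Real.norm_of_nonneg (φ.nonneg_normed t)]
      by_cases ht : ‖t‖ < R
      · refine mul_le_mul_of_nonneg_left ?_ (φ.nonneg_normed t)
        rw [hf₀eq _ (hmem a ha t ht), hf₀eq _ (hmem b hb t ht), Real.norm_eq_abs]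
        refine hf _ (hmem a ha t ht) _ (hmem b hb t ht) T hT fun η => ?_
        rw [sub_sub_sub_cancel_right]
        exact hη η
      · have h0 : φ.normed volume t = 0 := by
          rw [← Function.notMem_support, φ.support_normed_eq]
          simpa using ht
        simp [h0]
    · rw [integral_mul_const, φ.integral_normed, one_mul]
  refine ⟨F, hFsmooth, fun a ha => ⟨?_, ?_⟩⟩
  · have har : a ∈ Metric.ball x₀ r := Metric.ball_subset_ball (by linarith) ha
    have h1 := φ.dist_normed_convolution_le (x₀ := a) (ε := δ) hmeas fun b hb => by
      have hba : ‖b - a‖ < R := by rw [← dist_eq_norm]; exact hb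
      have hbr : b ∈ Metric.ball x₀ r := by
        have := hmem a ha (a - b) (by rwa [norm_sub_rev])
        rwa [sub_sub_cancel] at this
      rw [hf₀eq a har, hf₀eq b hbr, Real.dist_eq, abs_sub_comm]
      refine (hlip a har b hbr).trans ?_
      have h2 : ‖b - a‖ ≤ δ / (L * κ) := (hba.trans_le (min_le_right _ _)).le
      calc L * (κ * ‖b - a‖) ≤ L * (κ * (δ / (L * κ))) := by gcongr
        _ = δ := by field_simp
    rwa [Real.dist_eq, hf₀eq a har] at h1
  -- A vector `v` of dual norm at most one with `dF(v) = p(dF)` turns the bound on `p(dF)` into a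
  -- bound on the growth of `F` along the line in direction `v`.
  · obtain ⟨v, hv, hvle⟩ := exists_vector_of_seminorm hadd hsmul (fderiv ℝ F a)
    have hd : HasDerivAt (fun t : ℝ => F (a + t • v)) (fderiv ℝ F a v) 0 := by
      have h1 : HasDerivAt (fun t : ℝ => a + t • v) v 0 := by
        simpa using ((hasDerivAt_id (0 : ℝ)).smul_const v).const_add a
      have h2 : HasFDerivAt F (fderiv ℝ F a) (a + (0 : ℝ) • v) := by
        simpa using (hFsmooth.differentiable (by simp) a).hasFDerivAt
      exact h2.comp_hasDerivAt (0 : ℝ) h1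
    have hev : ∀ᶠ t : ℝ in 𝓝 0, a + t • v ∈ Metric.ball x₀ (r / 2) :=
      Tendsto.eventually_mem (Continuous.tendsto (by fun_prop) 0)
        (by simpa using Metric.isOpen_ball.mem_nhds ha)
    have h3 := hd.le_of_lip' hL.le (by
      filter_upwards [hev] with t ht
      rcases eq_or_ne t 0 with rfl | ht0
      · simp
      rw [zero_smul, add_zero, sub_zero, norm_sub_rev]
      refine hFlip a ha _ ht |t| (abs_pos.2 ht0) fun η => ?_
      rw [add_sub_cancel_left, map_smul, smul_eq_mul, abs_mul]
      gcongr
      exact hvle η)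
    rw [hv] at h3
    exact (le_abs_self _).trans h3

end Mollification

/-! ### Control distance along segments in a chart. -/

section LocalLipschitz

variable {n : ℕ} {M : Type*} [TopologicalSpace M] [ChartedSpace (EuclideanSpace ℝ (Fin n)) M]
  [IsManifold (𝓡 n) ∞ M]
  {P : ∀ x : M, Cotangent n x → ℝ} (hP : IsContinuousSeminorm P)
  {e : OpenPartialHomeomorph M (EuclideanSpace ℝ (Fin n))}
  (he : e ∈ atlas (EuclideanSpace ℝ (Fin n)) M)
include hP he

/-- An upper bound for the control distance by the length of a segment in a chart. -/
theorem controlDist_symm_le [T2Space M] {U : Set (EuclideanSpace ℝ (Fin n))} (hU : Convex ℝ U)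
    (hUe : U ⊆ e.target) {a b : EuclideanSpace ℝ (Fin n)} (ha : a ∈ U) (hb : b ∈ U) {T : ℝ}
    (hT : 0 < T)
    (hab : ∀ q ∈ U, ∀ η, |η (b - a)| ≤ T * P (e.symm q) (chartCovector e (e.symm q) η)) :
    controlDist P (e.symm a) (e.symm b) ≤ ENNReal.ofReal T := by
  -- The segment is traversed at constant speed in time `T`; `hab` then says that the dual norm of
  -- its velocity is at most one for the seminorm at every point of `U`.
  set ℓ : ℝ → EuclideanSpace ℝ (Fin n) := fun t => a + (t / T) • (b - a) with hℓ
  have hℓ0 : ℓ 0 = a := by simp [hℓ]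
  have hℓT : ℓ T = b := by simp [hℓ, hT.ne']
  have hℓU : ∀ t ∈ Icc 0 T, ℓ t ∈ U := fun t ht =>
    hU.add_smul_sub_mem ha hb ⟨div_nonneg ht.1 hT.le, (div_le_one hT).2 ht.2⟩
  have hℓd : ∀ t, HasDerivAt ℓ (T⁻¹ • (b - a)) t := fun t => by
    have := (((hasDerivAt_id t).div_const T).smul_const (b - a)).const_add a
    rwa [one_div] at this
  suffices hw : ∃ γ : ℝ → M, IsWeaklySubunit P γ ∧ (∀ t ≤ 0, γ t = e.symm (ℓ 0)) ∧
      ∀ t, T ≤ t → γ t = e.symm (ℓ T) by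
    obtain ⟨γ, hγ, h0, h1⟩ := hw
    have := hγ.controlDist_le hP hT
    rwa [h0 0 le_rfl, h1 T le_rfl, hℓ0, hℓT] at this
  refine exists_isWeaklySubunit_of_Icc hP (γ := fun t => e.symm (ℓ t)) hT ?_
  intro h hh s t c hst hsub hc
  have hder : ∀ r ∈ Icc s t, HasDerivWithinAt (fun r => h (e.symm (ℓ r)))
      (fderiv ℝ (h ∘ e.symm) (ℓ r) (T⁻¹ • (b - a))) (Icc s t) r ∧
      ‖fderiv ℝ (h ∘ e.symm) (ℓ r) (T⁻¹ • (b - a))‖ ≤ c := by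
    intro r hr
    have hrU := hℓU r (hsub hr)
    have hrt := hUe hrU
    have hd : DifferentiableAt ℝ (h ∘ e.symm) (ℓ r) := by
      have h1 : ContMDiffAt (𝓡 n) (𝓡 n) ∞ e.symm (ℓ r) :=
        contMDiffAt_symm_of_mem_maximalAtlas (IsManifold.subset_maximalAtlas he) hrt
      exact ((hh _).comp _ h1).contDiffAt.differentiableAt (by simp)
    refine ⟨(hd.hasFDerivAt.comp_hasDerivAt r (hℓd r)).hasDerivWithinAt, ?_⟩
    have hz : e.symm (ℓ r) ∈ e.source := e.map_target hrt
    have heq : h =ᶠ[𝓝 (e.symm (ℓ r))] (h ∘ e.symm) ∘ e := by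
      filter_upwards [e.open_source.mem_nhds hz] with w hw
      simp [e.left_inv hw]
    have hdd := differential_of_eventuallyEq_comp he hz (by rwa [e.right_inv hrt]) heq
    rw [e.right_inv hrt] at hdd
    have h2 := hab _ hrU (fderiv ℝ (h ∘ e.symm) (ℓ r))
    rw [← hdd] at h2
    rw [map_smul, norm_smul, Real.norm_eq_abs, Real.norm_eq_abs, abs_of_pos (inv_pos.2 hT),
      inv_mul_le_iff₀ hT]
    exact h2.trans (mul_le_mul_of_nonneg_left (hc r hr) hT.le)
  have := (convex_Icc s t).norm_image_sub_le_of_norm_hasDerivWithin_le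
    (fun r hr => (hder r hr).1) (fun r hr => (hder r hr).2) (left_mem_Icc.2 hst)
    (right_mem_Icc.2 hst)
  rwa [Real.norm_eq_abs, Real.norm_of_nonneg (sub_nonneg.2 hst)] at this

end LocalLipschitz

/-! ### Smooth approximation of functions Lipschitz for a control distance. -/

section Smoothing

variable {n : ℕ} {M : Type*} [TopologicalSpace M] [ChartedSpace (EuclideanSpace ℝ (Fin n)) M]

theorem hasMFDerivAt_sum {ι : Type*} (s : Finset ι) {f : ι → M → ℝ} {z : M}
    {f' : ι → Cotangent n z} (hf : ∀ i, HasMFDerivAt (𝓡 n) 𝓘(ℝ, ℝ) (f i) z (f' i)) :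
    HasMFDerivAt (𝓡 n) 𝓘(ℝ, ℝ) (fun w => ∑ i ∈ s, f i w) z (∑ i ∈ s, f' i) := by
  classical
  induction s using Finset.induction_on with
  | empty => exact hasMFDerivAt_const (0 : ℝ) z
  | insert a s ha ih =>
    have h : (fun w => ∑ i ∈ insert a s, f i w) = f a + fun w => ∑ i ∈ s, f i w :=
      funext fun w => Finset.sum_insert ha
    have h' : ∑ i ∈ insert a s, f' i = f' a + ∑ i ∈ s, f' i := Finset.sum_insert ha
    rw [h]
    exact ((hf a).add ih).congr_mfderiv h'.symm

theorem differential_sum_mul {ι : Type*} (s : Finset ι) {ρ h : ι → M → ℝ}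
    (hρ : ∀ i, ContMDiff (𝓡 n) 𝓘(ℝ, ℝ) ∞ (ρ i)) (hh : ∀ i, ContMDiff (𝓡 n) 𝓘(ℝ, ℝ) ∞ (h i))
    (z : M) : differential n (fun z => ∑ i ∈ s, ρ i z * h i z) z =
      ∑ i ∈ s, (ρ i z • differential n (h i) z + h i z • differential n (ρ i) z) :=
  (hasMFDerivAt_sum s fun i => ((hρ i z).mdifferentiableAt (by simp)).hasMFDerivAt.mul
    ((hh i z).mdifferentiableAt (by simp)).hasMFDerivAt).mfderiv

theorem differential_sum {ι : Type*} (s : Finset ι) {ρ : ι → M → ℝ}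
    (hρ : ∀ i, ContMDiff (𝓡 n) 𝓘(ℝ, ℝ) ∞ (ρ i)) (z : M) :
    differential n (fun z => ∑ i ∈ s, ρ i z) z = ∑ i ∈ s, differential n (ρ i) z :=
  (hasMFDerivAt_sum s fun i => ((hρ i z).mdifferentiableAt (by simp)).hasMFDerivAt).mfderiv

theorem differential_const_smul {h : M → ℝ} (hh : ContMDiff (𝓡 n) 𝓘(ℝ, ℝ) ∞ h) (c : ℝ) (z : M) :
    differential n (fun z => c * h z) z = c • differential n h z :=
  const_smul_mfderiv ((hh z).mdifferentiableAt (by simp)) c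

variable [IsManifold (𝓡 n) ∞ M] [T2Space M]
  {P : ∀ x : M, Cotangent n x → ℝ} (hP : IsContinuousSeminorm P)
  (hN : ∀ x ξ, P x ξ = 0 → ξ = 0)
include hP hN

omit hN in
theorem IsContinuousSeminorm.continuous_chartCovector_left
    {e : OpenPartialHomeomorph M (EuclideanSpace ℝ (Fin n))}
    (he : e ∈ atlas (EuclideanSpace ℝ (Fin n)) M) {x₀ : M} (hx₀ : x₀ ∈ e.source) :
    Continuous fun η => P x₀ (chartCovector e x₀ η) :=
  continuous_iff_continuousAt.2 fun η =>
    ContinuousAt.comp (f := fun η : EuclideanSpace ℝ (Fin n) →L[ℝ] ℝ => (x₀, η)) (x := η)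
      (hP.continuousAt_uncurry_chartCovector he hx₀ η) (by fun_prop)

/-- A continuous norm has a positive lower bound on the compact unit sphere, and homogeneity does
the rest. -/
theorem exists_norm_le_mul {e : OpenPartialHomeomorph M (EuclideanSpace ℝ (Fin n))}
    (he : e ∈ atlas (EuclideanSpace ℝ (Fin n)) M) {x₀ : M} (hx₀ : x₀ ∈ e.source) :
    ∃ κ : ℝ, 0 < κ ∧ ∀ η, ‖η‖ ≤ κ * P x₀ (chartCovector e x₀ η) := by
  have hK : IsCompact (Metric.sphere (0 : EuclideanSpace ℝ (Fin n) →L[ℝ] ℝ) 1) :=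
    haveI := FiniteDimensional.proper_real (EuclideanSpace ℝ (Fin n) →L[ℝ] ℝ)
    isCompact_sphere _ _
  obtain ⟨c, hc, hle⟩ := hK.exists_forall_le'
    (hP.continuous_chartCovector_left he hx₀).continuousOn (a := 0) fun η hη => by
      refine lt_of_le_of_ne (hP.nonneg _ _) fun h => ?_
      rw [chartCovector_eq_zero he hx₀ (hN _ _ h.symm)] at hη
      simp at hη
  refine ⟨c⁻¹, inv_pos.2 hc, fun η => ?_⟩
  rw [le_inv_mul_iff₀ hc]
  by_cases hη : η = 0
  · simpa [hη] using hP.nonneg _ _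
  have hn : 0 < ‖η‖ := norm_pos_iff.2 hη
  have h1 := hle (‖η‖⁻¹ • η) (by simp [norm_smul, hn.ne'])
  rw [chartCovector_smul, hP.smul, abs_inv, abs_norm, le_inv_mul_iff₀ hn] at h1
  linarith

variable {u : M → ℝ} (hu : ∀ z w, ENNReal.ofReal |u z - u w| ≤ controlDist P z w)
include hu

/-- Local smooth approximation of a function which is `1`-Lipschitz for the control distance. -/
theorem exists_local_approx {ε : ℝ} (hε : 0 < ε) (x₀ : M) :
    ∃ U : Set M, IsOpen U ∧ x₀ ∈ U ∧ (∃ K, IsCompact K ∧ U ⊆ K) ∧ ∀ δ : ℝ, 0 < δ →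
      ∃ h : M → ℝ, ContMDiff (𝓡 n) 𝓘(ℝ, ℝ) ∞ h ∧
        ∀ z ∈ U, |h z - u z| ≤ δ ∧ P z (differential n h z) ≤ 1 + ε := by
  set e := chartAt (EuclideanSpace ℝ (Fin n)) x₀ with he'
  have he : e ∈ atlas (EuclideanSpace ℝ (Fin n)) M := chart_mem_atlas _ _
  have hx₀ : x₀ ∈ e.source := mem_chart_source _ _
  -- The norm is frozen at `x₀` at a cost of one factor `1 + τ`, and compared back at the end at the
  -- cost of another. Since `τ ≤ 1`, the product is at most `1 + 3τ`.
  obtain ⟨τ, hτ, hτ2⟩ : ∃ τ : ℝ, 0 < τ ∧ (1 + τ) * (1 + τ) ≤ 1 + ε := by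
    refine ⟨min 1 (ε / 3), by positivity, ?_⟩
    have h1 := min_le_left 1 (ε / 3)
    have h2 := min_le_right 1 (ε / 3)
    have h3 : 0 < min 1 (ε / 3) := by positivity
    nlinarith
  obtain ⟨κ, hκ0, hκ⟩ := exists_norm_le_mul hP hN he hx₀
  obtain ⟨U₁, hU₁o, hxU₁, hU₁e, hU₁K, hU₁⟩ := exists_extension he hx₀
  obtain ⟨N, hNc, hNo, hxN⟩ := eventually_nhds_iff.1 (hP.eventually_comparable he hx₀ hN hτ)
  have hO : IsOpen (e.target ∩ e.symm ⁻¹' N) := e.isOpen_inter_preimage_symm hNo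
  obtain ⟨r, hr, hball⟩ := Metric.isOpen_iff.1 hO (e x₀)
    ⟨e.map_source hx₀, by rwa [mem_preimage, e.left_inv hx₀]⟩
  -- In the chart, `u` is Lipschitz for the dual of the frozen norm: segments in the ball bound the
  -- control distance from above.
  have hlip : ∀ a ∈ Metric.ball (e x₀) r, ∀ b ∈ Metric.ball (e x₀) r, ∀ T : ℝ, 0 < T →
      (∀ η : EuclideanSpace ℝ (Fin n) →L[ℝ] ℝ, |η (b - a)| ≤ T * P x₀ (chartCovector e x₀ η)) →
        |(u ∘ e.symm) a - (u ∘ e.symm) b| ≤ (1 + τ) * T := by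
    intro a ha b hb T hT hη
    have h1 := controlDist_symm_le hP he (convex_ball _ _) (fun q hq => (hball hq).1) ha hb
      (T := (1 + τ) * T) (by positivity) fun q hq η => by
        refine (hη η).trans ?_
        have := (hNc _ (hball hq).2 η).2
        calc T * P x₀ (chartCovector e x₀ η)
            ≤ T * ((1 + τ) * P (e.symm q) (chartCovector e (e.symm q) η)) := by gcongr
          _ = _ := by ring
    exact (ENNReal.ofReal_le_ofReal_iff (by positivity)).1 ((hu _ _).trans h1)
  have hVo : IsOpen (e.source ∩ e ⁻¹' Metric.ball (e x₀) (r / 2)) :=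
    e.isOpen_inter_preimage Metric.isOpen_ball
  refine ⟨U₁ ∩ (N ∩ (e.source ∩ e ⁻¹' Metric.ball (e x₀) (r / 2))),
    hU₁o.inter (hNo.inter hVo), ⟨hxU₁, hxN, hx₀, Metric.mem_ball_self (by positivity)⟩, ?_, ?_⟩
  · obtain ⟨K, hK, hUK⟩ := hU₁K
    exact ⟨K, hK, inter_subset_left.trans hUK⟩
  -- The neighbourhood does not depend on `δ`. This matters for the gluing, where `δ` is chosen
  -- after the partition of unity.
  intro δ hδ
  obtain ⟨F, hF, hFa⟩ := exists_smooth_approx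
    (p := fun η => P x₀ (chartCovector e x₀ η))
    (fun η ζ => by rw [chartCovector_add]; exact hP.add_le _ _ _)
    (fun c η => by rw [chartCovector_smul]; exact hP.smul _ _ _) hκ0 hκ hr
    (by positivity : 0 < 1 + τ) hlip hδ
  obtain ⟨h, hh, heq⟩ := hU₁ F hF
  refine ⟨h, hh, fun z hz => ?_⟩
  obtain ⟨hz1, hzN, hze, hzb⟩ := hz
  obtain ⟨ha, hb⟩ := hFa _ hzb
  constructor
  · rw [heq z hz1]
    rwa [Function.comp_apply, e.left_inv hze] at ha
  · rw [differential_of_eventuallyEq_comp he hze (hF.differentiable (by simp) _)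
      (eventually_of_mem (hU₁o.mem_nhds hz1) heq)]
    calc _ ≤ (1 + τ) * P x₀ (chartCovector e x₀ (fderiv ℝ F (e z))) := (hNc z hzN _).1
      _ ≤ (1 + τ) * (1 + τ) := by gcongr
      _ ≤ 1 + ε := hτ2

variable [SigmaCompactSpace M]

/-- Global smooth approximation of a compactly supported function which is `1`-Lipschitz for the
control distance. -/
theorem exists_global_approx {K₀ : Set M} (hK₀ : IsCompact K₀) (hu0 : ∀ z ∉ K₀, u z = 0) {ε : ℝ}
    (hε : 0 < ε) :
    ∃ w : M → ℝ, ContMDiff (𝓡 n) 𝓘(ℝ, ℝ) ∞ w ∧ HasCompactSupport w ∧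
      ∀ z, |w z - u z| ≤ ε ∧ P z (differential n w z) ≤ 1 + 2 * ε := by
  choose U hUo hxU hUK hU using fun x₀ => exists_local_approx hP hN hu hε x₀
  obtain ⟨ρ, hρ⟩ := SmoothPartitionOfUnity.exists_isSubordinate (𝓡 n) (isClosed_univ (X := M)) U hUo
    (fun x _ => mem_iUnion.2 ⟨x, hxU x⟩)
  have hρs : ∀ i, ContMDiff (𝓡 n) 𝓘(ℝ, ℝ) ∞ (ρ i) := fun i => (ρ i).contMDiff
  have hρc : ∀ i, HasCompactSupport (ρ i) := fun i => by
    obtain ⟨K, hK, hUK⟩ := hUK i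
    exact hK.of_isClosed_subset (isClosed_tsupport _) ((hρ i).trans hUK)
  -- Only the finitely many members whose supports meet `K₀` are kept: they sum to one near `K₀`,
  -- and `u` vanishes elsewhere.
  have hfin : {i | (tsupport (ρ i) ∩ K₀).Nonempty}.Finite :=
    ρ.locallyFinite.closure.finite_nonempty_inter_compact hK₀
  set I := hfin.toFinset with hI
  have hsum1 : ∀ z ∈ K₀, ∀ᶠ w in 𝓝 z, ∑ i ∈ I, ρ i w = 1 := by
    intro z hz
    filter_upwards [ρ.eventually_finsupport_subset z] with w hw
    refine ρ.sum_finsupport' w (mem_univ w) (hw.trans fun i hi => ?_)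
    rw [hI, Finite.mem_toFinset]
    exact ⟨z, (ρ.mem_fintsupport_iff z i).1 hi, hz⟩
  have hsum_le : ∀ z, ∑ i ∈ I, ρ i z ≤ 1 := by
    intro z
    classical
    rw [← ρ.sum_finsupport' z (mem_univ z) (Finset.subset_union_right (s₁ := I))]
    exact Finset.sum_le_sum_of_subset_of_nonneg Finset.subset_union_left
      fun i _ _ => ρ.nonneg i z
  choose C hC0 hC using fun i => hP.exists_bound (hρs i) (hρc i)
  -- The approximation error on the `i`-th piece is weighed against the bound `C i` on `P(dρᵢ)`, so
  -- that the errors in the differential sum to at most `ε`. The `+ 1` covers an empty index set.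
  have hδ : ∀ i, ∃ δ : ℝ, 0 < δ ∧ δ ≤ ε ∧ δ * C i ≤ ε / (I.card + 1) := by
    intro i
    refine ⟨min ε (ε / (I.card + 1) / C i), lt_min hε (div_pos (by positivity) (hC0 i)),
      min_le_left _ _, ?_⟩
    rw [← le_div_iff₀ (hC0 i)]
    exact min_le_right _ _
  choose δ hδ0 hδε hδC using hδ
  choose h hh hhz using fun i => hU i (δ i) (hδ0 i)
  set w : M → ℝ := fun z => ∑ i ∈ I, ρ i z * h i z with hw
  have hsub : ∀ i z, ρ i z ≠ 0 → z ∈ U i := fun i z hz => hρ i (subset_tsupport _ hz)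
  have hwu : ∀ z, u z * ∑ i ∈ I, ρ i z = u z := by
    intro z
    by_cases hz : z ∈ K₀
    · rw [(hsum1 z hz).self_of_nhds, mul_one]
    · rw [hu0 z hz, zero_mul]
  refine ⟨w, ?_, ?_, fun z => ⟨?_, ?_⟩⟩
  · exact contMDiff_finsetSum fun i _ => (hρs i).mul (hh i)
  · refine HasCompactSupport.intro (I.isCompact_biUnion fun i _ => hρc i) fun z hz => ?_
    refine Finset.sum_eq_zero fun i hi => ?_
    have : z ∉ tsupport (ρ i) := fun h => hz (mem_iUnion₂.2 ⟨i, hi, h⟩)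
    rw [image_eq_zero_of_notMem_tsupport this, zero_mul]
  · calc |w z - u z| = |∑ i ∈ I, ρ i z * (h i z - u z)| := by
          congr 1
          simp only [mul_sub, Finset.sum_sub_distrib, ← Finset.sum_mul]
          rw [mul_comm _ (u z), hwu]
      _ ≤ ∑ i ∈ I, |ρ i z * (h i z - u z)| := Finset.abs_sum_le_sum_abs _ _
      _ ≤ ∑ i ∈ I, ρ i z * ε := by
          refine Finset.sum_le_sum fun i _ => ?_
          rw [abs_mul, abs_of_nonneg (ρ.nonneg i z)]
          by_cases h0 : ρ i z = 0
          · simp [h0]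
          · exact mul_le_mul_of_nonneg_left
              ((hhz i z (hsub i z h0)).1.trans (hδε i)) (ρ.nonneg i z)
      _ ≤ ε := by
          rw [← Finset.sum_mul]
          exact mul_le_of_le_one_left hε.le (hsum_le z)
  -- The differentials of the `ρᵢ` cancel on `K₀`, and `u` vanishes off it. Subtracting this zero
  -- replaces `hᵢ dρᵢ` by the small `(hᵢ - u) dρᵢ`, so `u` itself is never differentiated.
  · have hd0 : u z • ∑ i ∈ I, differential n (ρ i) z = 0 := by
      by_cases hz : z ∈ K₀
      · rw [← differential_sum I hρs]
        have h1 : (fun z => ∑ i ∈ I, ρ i z) =ᶠ[𝓝 z] fun _ => (1 : ℝ) := hsum1 z hz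
        have h2 : differential n (fun z => ∑ i ∈ I, ρ i z) z = 0 := by
          unfold differential
          rw [h1.mfderiv_eq]
          exact mfderiv_const
        rw [h2, smul_zero]
      · rw [hu0 z hz, zero_smul]
    have hdw : differential n w z = ∑ i ∈ I, ρ i z • differential n (h i) z +
        ∑ i ∈ I, (h i z - u z) • differential n (ρ i) z := by
      rw [hw, differential_sum_mul I hρs hh, Finset.sum_add_distrib]
      have h1 : ∑ i ∈ I, (h i z - u z) • differential n (ρ i) z =
          ∑ i ∈ I, h i z • differential n (ρ i) z - u z • ∑ i ∈ I, differential n (ρ i) z := by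
        rw [Finset.smul_sum, ← Finset.sum_sub_distrib]
        exact Finset.sum_congr rfl fun i _ => sub_smul (h i z) (u z)
          (differential n (ρ i) z : EuclideanSpace ℝ (Fin n) →L[ℝ] ℝ)
      rw [h1, hd0, sub_zero]
    rw [hdw]
    refine (hP.add_le _ _ _).trans ?_
    have h1 : P z (∑ i ∈ I, ρ i z • differential n (h i) z) ≤ 1 + ε := by
      refine (hP.sum_le _ _ _).trans ?_
      calc ∑ i ∈ I, P z (ρ i z • differential n (h i) z) ≤ ∑ i ∈ I, ρ i z * (1 + ε) := by
            refine Finset.sum_le_sum fun i _ => ?_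
            rw [hP.smul, abs_of_nonneg (ρ.nonneg i z)]
            by_cases h0 : ρ i z = 0
            · simp [h0]
            · exact mul_le_mul_of_nonneg_left (hhz i z (hsub i z h0)).2 (ρ.nonneg i z)
        _ ≤ 1 + ε := by
            rw [← Finset.sum_mul]
            exact mul_le_of_le_one_left (by positivity) (hsum_le z)
    have h2 : P z (∑ i ∈ I, (h i z - u z) • differential n (ρ i) z) ≤ ε := by
      refine (hP.sum_le _ _ _).trans ?_
      calc ∑ i ∈ I, P z ((h i z - u z) • differential n (ρ i) z)
          ≤ ∑ i ∈ I, ε / (I.card + 1) := by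
            refine Finset.sum_le_sum fun i _ => ?_
            rw [hP.smul]
            by_cases hz : z ∈ tsupport (ρ i)
            · exact (mul_le_mul (hhz i z (hρ i hz)).1 (hC i z) (hP.nonneg _ _)
                (hδ0 i).le).trans (hδC i)
            · rw [differential_eq_zero_of_notMem_tsupport hz, hP.zero, mul_zero]
              positivity
        _ = I.card * (ε / (I.card + 1)) := by rw [Finset.sum_const, nsmul_eq_mul]
        _ ≤ ε := by
            rw [mul_div_assoc', div_le_iff₀ (by positivity)]
            linarith
    linarith

omit hu in
/-- For a complete continuous norm, the control distance is attained by test functions. -/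
theorem controlDist_le_iSup_test (hcomplete : IsCompleteSeminorm P) (x y : M) :
    controlDist P x y ≤ ⨆ (ξ : M → ℝ) (_ : ContMDiff (𝓡 n) 𝓘(ℝ, ℝ) ∞ ξ ∧ HasCompactSupport ξ ∧
      ∀ z, P z (differential n ξ z) ≤ 1), ENNReal.ofReal |ξ x - ξ y| := by
  refine le_of_forall_lt_imp_le_of_dense fun c hc => ?_
  obtain ⟨R, hcR, hR⟩ := ENNReal.lt_iff_exists_nnreal_btwn.1 hc
  lift c to NNReal using (hcR.trans ENNReal.coe_lt_top).ne
  have hcR' : (c : ℝ) < R := by exact_mod_cast hcR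
  have hR0 : 0 < (R : ℝ) := c.2.trans_lt hcR'
  -- Truncated subtraction gives the value `0` both beyond distance `R` and at infinite distance.
  set u : M → ℝ := fun z => ((R : ℝ≥0∞) - controlDist P x z).toReal with hudef
  have hutop : ∀ z, (R : ℝ≥0∞) - controlDist P x z ≠ ⊤ := fun z =>
    ENNReal.sub_ne_top ENNReal.coe_ne_top
  have hu' : ∀ z w, ENNReal.ofReal (u z - u w) ≤ controlDist P z w := by
    intro z w
    rw [ENNReal.ofReal_sub _ ENNReal.toReal_nonneg, ENNReal.ofReal_toReal (hutop z),
      ENNReal.ofReal_toReal (hutop w), tsub_le_iff_right]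
    have h1 := controlDist_triangle hP x z w
    rw [tsub_le_iff_right]
    calc (R : ℝ≥0∞) ≤ (R - controlDist P x w) + controlDist P x w := le_tsub_add
      _ ≤ (R - controlDist P x w) + (controlDist P x z + controlDist P z w) := by gcongr
      _ = _ := by ring
  have hu : ∀ z w, ENNReal.ofReal |u z - u w| ≤ controlDist P z w := by
    intro z w
    rcases abs_cases (u z - u w) with h | h
    · rw [h.1]; exact hu' z w
    · rw [h.1, neg_sub, controlDist_comm hP]; exact hu' w z
  have hux : u x = R := by simp [hudef, controlDist_self hP]
  have huy : u y = 0 := by simp [hudef, tsub_eq_zero_of_le hR.le]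
  have hK := hcomplete {x} isCompact_singleton R hR0
  have hu0 : ∀ z ∉ closure (closedBallAround P {x} (R : ℝ)), u z = 0 := by
    intro z hz
    have h1 : ¬ controlDist P x z ≤ R := fun h =>
      hz (subset_closure (by simpa [closedBallAround] using h))
    simp [hudef, tsub_eq_zero_of_le (not_le.1 h1).le]
  -- This solves `(R - 2ε) / (1 + 2ε) = c`: `w` is within `ε` of `u` at `x` and at `y`, and is then
  -- divided by `1 + 2ε`.
  set ε : ℝ := (R - c) / (2 * (1 + c)) with hε
  have hc1 : 0 < 1 + (c : ℝ) := by have := c.2; positivity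
  have hε0 : 0 < ε := div_pos (by linarith) (by positivity)
  obtain ⟨w, hw, hwc, hwz⟩ := exists_global_approx hP hN hu hK hu0 hε0
  have ha : 0 < (1 + 2 * ε)⁻¹ := by positivity
  refine le_iSup₂_of_le (fun z => (1 + 2 * ε)⁻¹ * w z)
    ⟨contMDiff_const.mul hw, hwc.mul_left, fun z => ?_⟩ ?_
  · rw [differential_const_smul hw, hP.smul, abs_of_pos ha, inv_mul_le_iff₀ (by positivity)]
    simpa using (hwz z).2
  · rw [← mul_sub, abs_mul, abs_of_pos ha, ← ENNReal.ofReal_coe_nnreal]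
    refine ENNReal.ofReal_le_ofReal ?_
    rw [le_inv_mul_iff₀ (by positivity)]
    have h1 := (abs_le.1 (hwz x).1).1
    have h2 := (abs_le.1 (hwz y).1).2
    rw [hux] at h1
    rw [huy] at h2
    have h3 : ε * (2 * (1 + c)) = R - c := by
      rw [hε, div_mul_cancel₀]; positivity
    have h4 := le_abs_self (w x - w y)
    nlinarith

end Smoothing

/-! ### Suprema of homogeneous functions over unit balls. -/

section UnitSup

theorem sSup_unit_const_mul {V : Type*} (N Q : V → ℝ) {a : ℝ} (ha : 0 ≤ a) :
    sSup {r : ℝ | ∃ v, N v ≤ 1 ∧ r = a * Q v} = a * sSup {r : ℝ | ∃ v, N v ≤ 1 ∧ r = Q v} := by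
  rw [← smul_eq_mul a (sSup _), ← Real.sSup_smul_of_nonneg ha]
  congr 1
  ext r
  rw [Set.mem_smul_set]
  constructor
  · rintro ⟨v, hv, rfl⟩
    exact ⟨Q v, ⟨v, hv, rfl⟩, rfl⟩
  · rintro ⟨_, ⟨v, hv, rfl⟩, rfl⟩
    exact ⟨v, hv, rfl⟩

variable {V : Type*} [NormedAddCommGroup V] [NormedSpace ℝ V]

/-- A norm `N` and a seminorm-like function `Q` on `V`, both continuous. -/
structure IsUnitPair (N Q : V → ℝ) : Prop where
  continuous_norm : Continuous N
  continuous_fun : Continuous Q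
  norm_smul : ∀ (c : ℝ) v, N (c • v) = |c| * N v
  fun_smul : ∀ (c : ℝ) v, Q (c • v) = |c| * Q v
  norm_pos : ∀ v, v ≠ 0 → 0 < N v
  fun_nonneg : ∀ v, 0 ≤ Q v

namespace IsUnitPair

variable {N Q : V → ℝ} (h : IsUnitPair N Q)
include h

theorem norm_zero : N 0 = 0 := by simpa using h.norm_smul 0 0

theorem fun_zero : Q 0 = 0 := by simpa using h.fun_smul 0 0

theorem norm_nonneg (v : V) : 0 ≤ N v := by
  rcases eq_or_ne v 0 with rfl | hv
  · exact h.norm_zero.ge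
  · exact (h.norm_pos v hv).le

/-- A homogeneous inequality holds if it holds on the unit sphere. -/
theorem le_mul_of_sphere {C : ℝ} (hC : ∀ v ∈ Metric.sphere (0 : V) 1, Q v ≤ C * N v) (v : V) :
    Q v ≤ C * N v := by
  rcases eq_or_ne v 0 with rfl | hv
  · rw [h.norm_zero, h.fun_zero, mul_zero]
  have hn : 0 < ‖v‖ := norm_pos_iff.2 hv
  have h1 := hC (‖v‖⁻¹ • v) (by simp [_root_.norm_smul, hn.ne'])
  rw [h.norm_smul, h.fun_smul, abs_inv, abs_norm, mul_left_comm] at h1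
  exact le_of_mul_le_mul_left h1 (inv_pos.2 hn)

theorem nonempty : {r : ℝ | ∃ v, N v ≤ 1 ∧ r = Q v}.Nonempty :=
  ⟨Q 0, 0, by rw [h.norm_zero]; exact zero_le_one, rfl⟩

theorem sSup_le {C : ℝ} (hC0 : 0 ≤ C) (hC : ∀ v, Q v ≤ C * N v) :
    sSup {r : ℝ | ∃ v, N v ≤ 1 ∧ r = Q v} ≤ C := by
  refine csSup_le h.nonempty ?_
  rintro r ⟨v, hv, rfl⟩
  exact (hC v).trans (mul_le_of_le_one_right hC0 hv)

variable [FiniteDimensional ℝ V]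

/-- On the compact unit sphere `N` is bounded below by a positive constant and `Q` is bounded above.
-/
theorem bddAbove : BddAbove {r : ℝ | ∃ v, N v ≤ 1 ∧ r = Q v} := by
  have := FiniteDimensional.proper_real V
  have hK := isCompact_sphere (0 : V) 1
  obtain ⟨c, hc, hcN⟩ := hK.exists_forall_le' h.continuous_norm.continuousOn (a := 0)
    fun v hv => h.norm_pos v (by rintro rfl; simp at hv)
  obtain ⟨C, hC⟩ := hK.exists_bound_of_continuousOn h.continuous_fun.continuousOn
  have key := h.le_mul_of_sphere (C := |C| / c) fun v hv => by
    calc Q v ≤ |C| := (Real.le_norm_self _).trans ((hC v hv).trans (le_abs_self C))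
      _ = |C| / c * c := by field_simp
      _ ≤ |C| / c * N v := by gcongr; exact hcN v hv
  refine ⟨|C| / c, ?_⟩
  rintro r ⟨v, hv, rfl⟩
  exact (key v).trans (mul_le_of_le_one_right (by positivity) hv)

theorem le_sSup {v : V} (hv : N v ≤ 1) : Q v ≤ sSup {r : ℝ | ∃ v, N v ≤ 1 ∧ r = Q v} :=
  le_csSup h.bddAbove ⟨v, hv, rfl⟩

theorem sSup_nonneg : 0 ≤ sSup {r : ℝ | ∃ v, N v ≤ 1 ∧ r = Q v} :=
  h.fun_zero.ge.trans (h.le_sSup (v := 0) (h.norm_zero.trans_le zero_le_one))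

theorem le_sSup_mul (v : V) : Q v ≤ sSup {r : ℝ | ∃ v, N v ≤ 1 ∧ r = Q v} * N v := by
  rcases eq_or_ne v 0 with rfl | hv
  · rw [h.norm_zero, h.fun_zero, mul_zero]
  have hn := h.norm_pos v hv
  have h1 := h.le_sSup (v := (N v)⁻¹ • v) (by
    rw [h.norm_smul, abs_inv, abs_of_pos hn, inv_mul_cancel₀ hn.ne'])
  rw [h.fun_smul, abs_inv, abs_of_pos hn, inv_mul_le_iff₀ hn] at h1
  linarith

end IsUnitPair

/-- The supremum of a continuous family of homogeneous functions over the unit balls of a continuous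
family of norms is continuous. -/
theorem continuousAt_sSup_unit [FiniteDimensional ℝ V] {Y : Type*} [TopologicalSpace Y]
    {N Q : Y → V → ℝ} {y₀ : Y} (h : ∀ᶠ y in 𝓝 y₀, IsUnitPair (N y) (Q y))
    (hN : ∀ v, ContinuousAt (fun q : Y × V => N q.1 q.2) (y₀, v))
    (hQ : ∀ v, ContinuousAt (fun q : Y × V => Q q.1 q.2) (y₀, v)) :
    ContinuousAt (fun y => sSup {r : ℝ | ∃ v, N y v ≤ 1 ∧ r = Q y v}) y₀ := by
  have h₀ := h.self_of_nhds
  have := FiniteDimensional.proper_real V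
  refine tendsto_order.2 ⟨fun a ha => ?_, fun a ha => ?_⟩
  · rcases lt_or_ge a 0 with ha0 | ha0
    · filter_upwards [h] with y hy using ha0.trans_le hy.sSup_nonneg
    obtain ⟨r, ⟨v, hv, rfl⟩, hr⟩ := exists_lt_of_lt_csSup h₀.nonempty ha
    have hQ0 : 0 < Q y₀ v := ha0.trans_lt hr
    -- shrink the vector a little
    obtain ⟨c, hc1, hc2⟩ := exists_between ((div_lt_one hQ0).2 hr)
    have hc0 : 0 ≤ c := (div_nonneg ha0 hQ0.le).trans hc1.le
    have e1 : ∀ᶠ y in 𝓝 y₀, N y (c • v) < 1 := by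
      have : ContinuousAt (fun y => N y (c • v)) y₀ :=
        ContinuousAt.comp (f := fun y => (y, c • v)) (x := y₀) (hN (c • v)) (by fun_prop)
      refine this.tendsto.eventually_lt_const ?_
      rw [h₀.norm_smul, abs_of_nonneg hc0]
      exact (mul_le_of_le_one_right hc0 hv).trans_lt hc2
    have e2 : ∀ᶠ y in 𝓝 y₀, a < Q y (c • v) := by
      have : ContinuousAt (fun y => Q y (c • v)) y₀ :=
        ContinuousAt.comp (f := fun y => (y, c • v)) (x := y₀) (hQ (c • v)) (by fun_prop)
      refine this.tendsto.eventually_const_lt ?_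
      rw [h₀.fun_smul, abs_of_nonneg hc0]
      rwa [div_lt_iff₀ hQ0] at hc1
    filter_upwards [h, e1, e2] with y hy hy1 hy2
    exact hy2.trans_le (hy.le_sSup hy1.le)
  -- Upper semicontinuity: for `b` strictly above the supremum, `Q < b N` holds on the compact
  -- sphere at `y₀`, hence for all nearby `y`.
  · obtain ⟨b, hb1, hb2⟩ := exists_between ha
    have hb0 : 0 ≤ b := h₀.sSup_nonneg.trans hb1.le
    have key := (isCompact_sphere (0 : V) 1).eventually_forall_of_forall_eventually (x₀ := y₀)
      (P := fun y v => Q y v ≤ b * N y v) fun v hv => by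
        have hv0 : v ≠ 0 := by rintro rfl; simp at hv
        have hlt : Q y₀ v < b * N y₀ v :=
          (h₀.le_sSup_mul v).trans_lt (mul_lt_mul_of_pos_right hb1 (h₀.norm_pos v hv0))
        filter_upwards [(hQ v).tendsto.eventually_lt ((hN v).tendsto.const_mul b) hlt]
          with q hq using hq.le
    filter_upwards [h, key] with y hy hy1
    exact (hy.sSup_le hb0 (hy.le_mul_of_sphere hy1)).trans_lt hb2

end UnitSup

/-! ### Local frames made of global sections. -/

section Frames

variable {n : ℕ} {M : Type*} [TopologicalSpace M] [ChartedSpace (EuclideanSpace ℝ (Fin n)) M]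
  [IsManifold (𝓡 n) ∞ M] [T2Space M]
variable {V : Type*} [NormedAddCommGroup V] [NormedSpace ℝ V] [FiniteDimensional ℝ V]
  {E : M → Type*} [TopologicalSpace (TotalSpace V E)] [∀ x, TopologicalSpace (E x)]
  [∀ x, AddCommGroup (E x)] [∀ x, Module ℝ (E x)] [FiberBundle V E] [VectorBundle ℝ V E]
  [ContMDiffVectorBundle ∞ V E (𝓡 n)]

/-- Global smooth sections which form a frame near a given point. -/
theorem exists_frame (x₀ : M) :
    ∃ X : Fin (Module.finrank ℝ V) → Cₛ^∞⟮𝓡 n; V, E⟯, ∀ᶠ y in 𝓝 x₀,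
      Function.Bijective fun c : Fin (Module.finrank ℝ V) → ℝ => ∑ i, c i • X i y := by
  set t := trivializationAt V E x₀
  have hx₀ : x₀ ∈ t.baseSet := mem_baseSet_trivializationAt V E x₀
  obtain ⟨χ, hχ, -, hχs, hχ1⟩ := exists_bump (n := n) (t.open_baseSet.mem_nhds hx₀)
  set b := Module.finBasis ℝ V
  refine ⟨fun i => ⟨χ • t.localFrame b i, hχ.contMDiffOn.smul_section_of_tsupport t.open_baseSet hχs
    (t.contMDiffOn_localFrame_baseSet ∞ b i)⟩, ?_⟩
  filter_upwards [hχ1, t.open_baseSet.mem_nhds hx₀] with y hy1 hyb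
  have : (fun c : Fin (Module.finrank ℝ V) → ℝ => ∑ i, c i • (χ • t.localFrame b i) y) =
      fun c => (t.basisAt b hyb).equivFun.symm c := by
    ext c
    rw [Module.Basis.equivFun_symm_apply]
    refine Finset.sum_congr rfl fun i _ => ?_
    simp [hy1, hyb]
  change Function.Bijective (fun c : Fin (Module.finrank ℝ V) → ℝ =>
    ∑ i, c i • (χ • t.localFrame b i) y)
  rw [this]
  exact (t.basisAt b hyb).equivFun.symm.bijective

omit [IsManifold (𝓡 n) ∞ M] [T2Space M] [FiniteDimensional ℝ V]
  [ContMDiffVectorBundle ∞ V E (𝓡 n)] in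
theorem sum_smul_section_apply {ι : Type*} [Fintype ι] (c : ι → ℝ) (X : ι → Cₛ^∞⟮𝓡 n; V, E⟯)
    (y : M) : (∑ i, c i • X i) y = ∑ i, c i • X i y := by
  have h := congrFun (map_sum (ContMDiffSection.coeAddHom (𝓡 n) V ∞ E) (fun i => c i • X i)
    Finset.univ) y
  rw [Finset.sum_apply] at h
  exact h

/-- A real combination of a frame with constant coefficients suffices. Such sections give access to
the values of the symbol on each vector. -/
theorem exists_section_eq (x : M) (v : E x) : ∃ f : Cₛ^∞⟮𝓡 n; V, E⟯, f x = v := by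
  obtain ⟨X, hX⟩ := exists_frame (n := n) (V := V) (E := E) x
  obtain ⟨c, hc⟩ := hX.self_of_nhds.2 v
  exact ⟨∑ i, c i • X i, (sum_smul_section_apply _ _ _).trans hc⟩

end Frames

theorem finiteDimensional_fibre {M : Type*} [TopologicalSpace M] (V : Type*)
    [NormedAddCommGroup V] [NormedSpace ℂ V] [FiniteDimensional ℂ V] (E : M → Type*)
    [TopologicalSpace (TotalSpace V E)] [∀ x, NormedAddCommGroup (E x)]
    [∀ x, InnerProductSpace ℂ (E x)] [FiberBundle V E] [VectorBundle ℝ V E] (x : M) :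
    FiniteDimensional ℝ (E x) :=
  have : FiniteDimensional ℝ V := FiniteDimensional.complexToReal V
  ((trivializationAt V E x).continuousLinearEquivAt ℝ x
    (mem_baseSet_trivializationAt V E x)).symm.toLinearEquiv.finiteDimensional

/-! ### The symbol is linear and its operator norm is a continuous seminorm. -/

section Symbol

variable {n : ℕ} {M : Type*} [TopologicalSpace M] [ChartedSpace (EuclideanSpace ℝ (Fin n)) M]
  [IsManifold (𝓡 n) ∞ M] [T2Space M]
variable {V : Type*} [NormedAddCommGroup V] [NormedSpace ℂ V] [FiniteDimensional ℂ V]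
  {E : M → Type*} [TopologicalSpace (TotalSpace V E)] [∀ x, NormedAddCommGroup (E x)]
  [∀ x, InnerProductSpace ℂ (E x)] [FiberBundle V E] [VectorBundle ℝ V E]
  [ContMDiffVectorBundle ∞ V E (𝓡 n)]
variable {W : Type*} [NormedAddCommGroup W] [NormedSpace ℂ W] [FiniteDimensional ℂ W]
  {F : M → Type*} [TopologicalSpace (TotalSpace W F)] [∀ x, NormedAddCommGroup (F x)]
  [∀ x, InnerProductSpace ℂ (F x)] [FiberBundle W F] [VectorBundle ℝ W F]
  [ContMDiffVectorBundle ∞ W F (𝓡 n)]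

theorem re_inner_sum_sum {H : Type*} [NormedAddCommGroup H] [InnerProductSpace ℂ H] {ι κ : Type*}
    [Fintype ι] [Fintype κ] (a : ι → ℝ) (b : κ → ℝ) (u : ι → H) (w : κ → H) :
    (inner ℂ (∑ i, a i • u i) (∑ j, b j • w j)).re =
      ∑ i, ∑ j, a i * (b j * (inner ℂ (u i) (w j)).re) := by
  have hc : ∀ (r : ℝ) (u : H), r • u = (r : ℂ) • u := fun r u => rfl
  simp only [hc, sum_inner, inner_sum, Complex.re_sum, inner_smul_left, inner_smul_right,
    Complex.conj_ofReal, Complex.re_ofReal_mul, Finset.mul_sum]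
  rw [Finset.sum_comm]
  exact Finset.sum_congr rfl fun i _ => Finset.sum_congr rfl fun j _ => by ring

omit [T2Space M] [IsManifold (𝓡 n) ∞ M] [ContMDiffVectorBundle ∞ V E (𝓡 n)] in
-- Smoothness of the hermitian metric is given only in the local frames of trivialisations, so both
-- sections are expanded there with continuous real coefficients.
theorem continuous_re_inner (hE : IsSmoothHermitian n V E) (s t : Cₛ^∞⟮𝓡 n; V, E⟯) :
    Continuous fun y => (inner ℂ (s y) (t y)).re := by
  have : FiniteDimensional ℝ V := FiniteDimensional.complexToReal V
  rw [continuous_iff_continuousAt]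
  intro x₀
  set e := trivializationAt V E x₀
  have hx₀ : x₀ ∈ e.baseSet := mem_baseSet_trivializationAt V E x₀
  set b := Module.finBasis ℝ V
  have hcoord : ∀ (s : Cₛ^∞⟮𝓡 n; V, E⟯) i, ContinuousAt (fun y => b.repr (e ⟨y, s y⟩).2 i) x₀ := by
    intro s i
    have h1 := ((contMDiffAt_section x₀).1 (s.contMDiff x₀)).continuousAt
    exact (LinearMap.continuous_of_finiteDimensional (b.coord i)).continuousAt.comp h1
  have hs : ∀ (s : Cₛ^∞⟮𝓡 n; V, E⟯), ∀ y ∈ e.baseSet,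
      s y = ∑ i, b.repr (e ⟨y, s y⟩).2 i • e.symm y (b i) := by
    intro s y hy
    conv_lhs => rw [← e.symm_apply_apply_mk hy (s y), ← e.symmL_apply (R := ℝ) hy,
      ← b.sum_repr (e ⟨y, s y⟩).2, map_sum]
    refine Finset.sum_congr rfl fun i _ => ?_
    rw [map_smul, e.symmL_apply (R := ℝ) hy]
  have key : ContinuousAt (fun y => ∑ i, ∑ j, b.repr (e ⟨y, s y⟩).2 i *
      (b.repr (e ⟨y, t y⟩).2 j * (inner ℂ (e.symm y (b i)) (e.symm y (b j))).re)) x₀ := by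
    refine tendsto_finsetSum _ fun i _ => tendsto_finsetSum _ fun j _ => ?_
    refine ContinuousAt.mul (hcoord s i) (ContinuousAt.mul (hcoord t j) ?_)
    exact Complex.continuous_re.continuousAt.comp
      ((hE x₀ (b i) (b j)).continuousOn.continuousAt (e.open_baseSet.mem_nhds hx₀))
  refine key.congr ?_
  filter_upwards [e.open_baseSet.mem_nhds hx₀] with y hy
  conv_rhs => rw [hs s y hy, hs t y hy]
  exact (re_inner_sum_sum _ _ _ _).symm

omit [T2Space M] [IsManifold (𝓡 n) ∞ M] [ContMDiffVectorBundle ∞ V E (𝓡 n)] in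
-- The squared norm is a real quadratic form in the coefficients whose matrix entries are continuous
-- on `M`. Continuity jointly in point and coefficients is what `continuousAt_sSup_unit` needs.
theorem continuous_norm_sum_smul (hE : IsSmoothHermitian n V E) {ι : Type*} [Fintype ι]
    (X : ι → Cₛ^∞⟮𝓡 n; V, E⟯) :
    Continuous fun q : M × (ι → ℝ) => ‖∑ i, q.2 i • X i q.1‖ := by
  have h : ∀ q : M × (ι → ℝ), ‖∑ i, q.2 i • X i q.1‖ =
      √(∑ i, ∑ j, q.2 i * (q.2 j * (inner ℂ (X i q.1) (X j q.1)).re)) := fun q => by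
    rw [← re_inner_sum_sum, norm_eq_sqrt_re_inner (𝕜 := ℂ)]
    rfl
  simp only [h]
  refine Real.continuous_sqrt.comp (continuous_finsetSum _ fun i _ => continuous_finsetSum _
    fun j _ => ?_)
  have := (continuous_re_inner hE (X i) (X j)).comp (continuous_fst (X := M) (Y := ι → ℝ))
  have h2 : ∀ i, Continuous fun q : M × (ι → ℝ) => q.2 i := fun i => by fun_prop
  exact (h2 i).mul ((h2 j).mul this)

section Linear

variable (D : Cₛ^∞⟮𝓡 n; V, E⟯ →ₗ[ℝ] Cₛ^∞⟮𝓡 n; W, F⟯) (hD : IsFirstOrder D)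

omit [IsManifold (𝓡 n) ∞ M] [T2Space M] [FiniteDimensional ℂ V]
  [ContMDiffVectorBundle ∞ V E (𝓡 n)] [FiniteDimensional ℂ W]
  [ContMDiffVectorBundle ∞ W F (𝓡 n)] in
theorem commutator_add_right (h : C^∞⟮𝓡 n, M; 𝓘(ℝ, ℝ), ℝ⟯) (f f' : Cₛ^∞⟮𝓡 n; V, E⟯) :
    commutator D h (f + f') = commutator D h f + commutator D h f' := by
  have h1 : mulSection h (f + f') = mulSection h f + mulSection h f' := by
    ext1 y
    exact smul_add (h y) (f y) (f' y)
  have h2 : mulSection h (D f + D f') = mulSection h (D f) + mulSection h (D f') := by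
    ext1 y
    exact smul_add (h y) (D f y) (D f' y)
  unfold commutator
  rw [h1, map_add, map_add, h2]
  abel

omit [IsManifold (𝓡 n) ∞ M] [T2Space M] [FiniteDimensional ℂ V]
  [ContMDiffVectorBundle ∞ V E (𝓡 n)] [FiniteDimensional ℂ W]
  [ContMDiffVectorBundle ∞ W F (𝓡 n)] in
theorem commutator_smul_right (h : C^∞⟮𝓡 n, M; 𝓘(ℝ, ℝ), ℝ⟯) (c : ℝ) (f : Cₛ^∞⟮𝓡 n; V, E⟯) :
    commutator D h (c • f) = c • commutator D h f := by
  have h1 : mulSection h (c • f) = c • mulSection h f := by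
    ext1 y
    exact smul_comm (h y) c (f y)
  have h2 : mulSection h (c • D f) = c • mulSection h (D f) := by
    ext1 y
    exact smul_comm (h y) c (D f y)
  unfold commutator
  rw [h1, map_smul, map_smul, h2]
  ext1 y
  exact (smul_sub c (D (mulSection h f) y) (mulSection h (D f) y)).symm

omit [IsManifold (𝓡 n) ∞ M] [T2Space M] [FiniteDimensional ℂ V]
  [ContMDiffVectorBundle ∞ V E (𝓡 n)] [FiniteDimensional ℂ W]
  [ContMDiffVectorBundle ∞ W F (𝓡 n)] in
theorem commutator_add_left (h h' : C^∞⟮𝓡 n, M; 𝓘(ℝ, ℝ), ℝ⟯) (f : Cₛ^∞⟮𝓡 n; V, E⟯) :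
    commutator D (h + h') f = commutator D h f + commutator D h' f := by
  have h1 : mulSection (h + h') f = mulSection h f + mulSection h' f := by
    ext1 y
    exact add_smul (h y) (h' y) (f y)
  have h2 : mulSection (h + h') (D f) = mulSection h (D f) + mulSection h' (D f) := by
    ext1 y
    exact add_smul (h y) (h' y) (D f y)
  unfold commutator
  rw [h1, map_add, h2]
  abel

omit [IsManifold (𝓡 n) ∞ M] [T2Space M] [FiniteDimensional ℂ V]
  [ContMDiffVectorBundle ∞ V E (𝓡 n)] [FiniteDimensional ℂ W]
  [ContMDiffVectorBundle ∞ W F (𝓡 n)] in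
theorem commutator_smul_left (h : C^∞⟮𝓡 n, M; 𝓘(ℝ, ℝ), ℝ⟯) (c : ℝ) (f : Cₛ^∞⟮𝓡 n; V, E⟯) :
    commutator D (c • h) f = c • commutator D h f := by
  have h1 : mulSection (c • h) f = c • mulSection h f := by
    ext1 y
    exact mul_smul c (h y) (f y)
  have h2 : mulSection (c • h) (D f) = c • mulSection h (D f) := by
    ext1 y
    exact mul_smul c (h y) (D f y)
  unfold commutator
  rw [h1, map_smul, h2]
  ext1 y
  exact (smul_sub c (D (mulSection h f) y) (mulSection h (D f) y)).symm

omit [T2Space M] [FiniteDimensional ℂ V] [ContMDiffVectorBundle ∞ V E (𝓡 n)] [IsManifold (𝓡 n) ∞ M]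
  [FiniteDimensional ℂ W] [ContMDiffVectorBundle ∞ W F (𝓡 n)] in
include hD in
-- With `h` and `f` free to be chosen, the algebraic properties of the symbol reduce to those of the
-- commutator.
theorem symbol_eq_commutator {x : M} {ξ : Cotangent n x} {v : E x}
    {h : C^∞⟮𝓡 n, M; 𝓘(ℝ, ℝ), ℝ⟯} {f : Cₛ^∞⟮𝓡 n; V, E⟯}
    (hh : differential n (fun z => h z) x = ξ) (hf : f x = v) :
    symbol D x ξ v = commutator D h f x := by
  subst hh hf
  exact symbol_eq D hD h f x

omit [FiniteDimensional ℂ V] [ContMDiffVectorBundle ∞ V E (𝓡 n)]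
  [FiniteDimensional ℂ W] [ContMDiffVectorBundle ∞ W F (𝓡 n)] in
theorem exists_contMDiffMap_differential_eq (x : M) (ξ : Cotangent n x) :
    ∃ h : C^∞⟮𝓡 n, M; 𝓘(ℝ, ℝ), ℝ⟯, differential n (fun z => h z) x = ξ := by
  obtain ⟨h, hh, heq⟩ := exists_differential_eq x ξ
  exact ⟨⟨h, hh⟩, heq⟩

omit [FiniteDimensional ℂ W] [ContMDiffVectorBundle ∞ W F (𝓡 n)] in
include hD in
theorem symbol_add_right (x : M) (ξ : Cotangent n x) (v w : E x) :
    symbol D x ξ (v + w) = symbol D x ξ v + symbol D x ξ w := by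
  have : FiniteDimensional ℝ V := FiniteDimensional.complexToReal V
  obtain ⟨h, hh⟩ := exists_contMDiffMap_differential_eq x ξ
  obtain ⟨f, hf⟩ := exists_section_eq (n := n) (V := V) x v
  obtain ⟨f', hf'⟩ := exists_section_eq (n := n) (V := V) x w
  rw [symbol_eq_commutator D hD hh hf, symbol_eq_commutator D hD hh hf',
    symbol_eq_commutator D hD (f := f + f') hh (by rw [← hf, ← hf']; rfl), commutator_add_right]
  rfl

omit [FiniteDimensional ℂ W] [ContMDiffVectorBundle ∞ W F (𝓡 n)] in
include hD in
theorem symbol_smul_right (x : M) (ξ : Cotangent n x) (c : ℝ) (v : E x) :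
    symbol D x ξ (c • v) = c • symbol D x ξ v := by
  have : FiniteDimensional ℝ V := FiniteDimensional.complexToReal V
  obtain ⟨h, hh⟩ := exists_contMDiffMap_differential_eq x ξ
  obtain ⟨f, hf⟩ := exists_section_eq (n := n) (V := V) x v
  rw [symbol_eq_commutator D hD hh hf,
    symbol_eq_commutator D hD (f := c • f) hh (by rw [← hf]; rfl), commutator_smul_right]
  rfl

omit [IsManifold (𝓡 n) ∞ M] [T2Space M] in
theorem differential_add {h h' : M → ℝ} (hh : ContMDiff (𝓡 n) 𝓘(ℝ, ℝ) ∞ h)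
    (hh' : ContMDiff (𝓡 n) 𝓘(ℝ, ℝ) ∞ h') (x : M) :
    differential n (fun z => h z + h' z) x = differential n h x + differential n h' x :=
  mfderiv_add ((hh x).mdifferentiableAt (by simp)) ((hh' x).mdifferentiableAt (by simp))

omit [FiniteDimensional ℂ W] [ContMDiffVectorBundle ∞ W F (𝓡 n)] in
include hD in
theorem symbol_add (x : M) (ξ η : Cotangent n x) (v : E x) :
    symbol D x (ξ + η) v = symbol D x ξ v + symbol D x η v := by
  have : FiniteDimensional ℝ V := FiniteDimensional.complexToReal V
  obtain ⟨h, hh⟩ := exists_contMDiffMap_differential_eq x ξ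
  obtain ⟨h', hh'⟩ := exists_contMDiffMap_differential_eq x η
  obtain ⟨f, hf⟩ := exists_section_eq (n := n) (V := V) x v
  have hs : differential n (fun z => (h + h') z) x = ξ + η := by
    rw [← hh, ← hh']
    exact differential_add h.contMDiff h'.contMDiff x
  rw [symbol_eq_commutator D hD hh hf, symbol_eq_commutator D hD hh' hf,
    symbol_eq_commutator D hD hs hf, commutator_add_left]
  rfl

omit [FiniteDimensional ℂ W] [ContMDiffVectorBundle ∞ W F (𝓡 n)] in
include hD in
theorem symbol_smul (x : M) (c : ℝ) (ξ : Cotangent n x) (v : E x) :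
    symbol D x (c • ξ) v = c • symbol D x ξ v := by
  have : FiniteDimensional ℝ V := FiniteDimensional.complexToReal V
  obtain ⟨h, hh⟩ := exists_contMDiffMap_differential_eq x ξ
  obtain ⟨f, hf⟩ := exists_section_eq (n := n) (V := V) x v
  have hs : differential n (fun z => (c • h) z) x = c • ξ := by
    rw [← hh]
    exact differential_const_smul h.contMDiff c x
  rw [symbol_eq_commutator D hD hh hf, symbol_eq_commutator D hD hs hf, commutator_smul_left]
  rfl

omit [FiniteDimensional ℂ W] [ContMDiffVectorBundle ∞ W F (𝓡 n)] in
include hD in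
theorem isUnitPair_symbol (x : M) (ξ : Cotangent n x) :
    IsUnitPair (fun v : E x => ‖v‖) (fun v => ‖symbol D x ξ v‖) where
  continuous_norm := continuous_norm
  continuous_fun := by
    have := finiteDimensional_fibre V E x
    exact (LinearMap.continuous_of_finiteDimensional (⟨⟨symbol D x ξ, symbol_add_right D hD x ξ⟩,
      symbol_smul_right D hD x ξ⟩ : E x →ₗ[ℝ] F x)).norm
  norm_smul c v := _root_.norm_smul c v
  fun_smul c v := by rw [symbol_smul_right D hD, _root_.norm_smul, Real.norm_eq_abs]
  norm_pos v hv := norm_pos_iff.2 hv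
  fun_nonneg v := norm_nonneg _

omit [ContMDiffVectorBundle ∞ W F (𝓡 n)] in
include hD in
-- Continuity is the main point. In a frame `X`, the map `σ₁(D)(dh)` sends `∑ cᵢ Xᵢ` to `∑ cᵢ [D, h]
-- Xᵢ`, where the `[D, h] Xᵢ` are smooth sections. The operator norm becomes a supremum over a fixed
-- space of coefficients, to which `continuousAt_sSup_unit` applies.
theorem isContinuousSeminorm_opSeminorm (hE : IsSmoothHermitian n V E)
    (hF : IsSmoothHermitian n W F) : IsContinuousSeminorm (opSeminorm D) where
  add_le x ξ η := by
    have := finiteDimensional_fibre V E x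
    refine (isUnitPair_symbol D hD x (ξ + η)).sSup_le (add_nonneg
      (isUnitPair_symbol D hD x ξ).sSup_nonneg (isUnitPair_symbol D hD x η).sSup_nonneg)
      fun v => ?_
    rw [symbol_add D hD, add_mul]
    exact (norm_add_le _ _).trans (add_le_add ((isUnitPair_symbol D hD x ξ).le_sSup_mul v)
      ((isUnitPair_symbol D hD x η).le_sSup_mul v))
  smul x c ξ := by
    rw [opSeminorm, symbolNorm]
    simp only [symbol_smul D hD, _root_.norm_smul, Real.norm_eq_abs]
    exact sSup_unit_const_mul _ _ (abs_nonneg c)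
  continuous_differential h hh := by
    have : FiniteDimensional ℝ V := FiniteDimensional.complexToReal V
    rw [continuous_iff_continuousAt]
    intro x₀
    obtain ⟨X, hX⟩ := exists_frame (n := n) (V := V) (E := E) x₀
    set h' : C^∞⟮𝓡 n, M; 𝓘(ℝ, ℝ), ℝ⟯ := ⟨h, hh⟩
    have hsum : ∀ (c : Fin (Module.finrank ℝ V) → ℝ) y,
        symbol D y (differential n h y) (∑ i, c i • X i y) =
          ∑ i, c i • commutator D h' (X i) y := by
      intro c y
      let L : Cₛ^∞⟮𝓡 n; V, E⟯ →ₗ[ℝ] Cₛ^∞⟮𝓡 n; W, F⟯ :=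
        ⟨⟨commutator D h', commutator_add_right D h'⟩, commutator_smul_right D h'⟩
      have h1 : commutator D h' (∑ i, c i • X i) = ∑ i, c i • commutator D h' (X i) := by
        have := map_sum L (fun i => c i • X i) Finset.univ
        simp only [map_smul] at this
        exact this
      refine (symbol_eq_commutator D hD (h := h') (f := ∑ i, c i • X i) rfl
        (sum_smul_section_apply _ _ _)).trans ?_
      rw [h1]
      exact sum_smul_section_apply _ _ _
    have hNc := continuous_norm_sum_smul hE X
    have hQc := continuous_norm_sum_smul hF fun i => commutator D h' (X i)
    have key := continuousAt_sSup_unit (y₀ := x₀)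
      (N := fun y (c : Fin (Module.finrank ℝ V) → ℝ) => ‖∑ i, c i • X i y‖)
      (Q := fun y c => ‖∑ i, c i • commutator D h' (X i) y‖) (by
        filter_upwards [hX] with y hy
        refine ⟨hNc.comp (Continuous.prodMk_right y), hQc.comp (Continuous.prodMk_right y),
          fun a c => ?_, fun a c => ?_, fun c hc => ?_, fun c => norm_nonneg _⟩
        · simp only [Pi.smul_apply, smul_eq_mul, mul_smul, ← Finset.smul_sum, _root_.norm_smul,
            Real.norm_eq_abs]
        · simp only [Pi.smul_apply, smul_eq_mul, mul_smul, ← Finset.smul_sum, _root_.norm_smul,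
            Real.norm_eq_abs]
        · refine norm_pos_iff.2 fun h0 => hc (hy.1 ?_)
          simpa using h0)
      (fun c => hNc.continuousAt) (fun c => hQc.continuousAt)
    refine key.congr ?_
    filter_upwards [hX] with y hy
    rw [opSeminorm, symbolNorm]
    congr 1
    ext r
    constructor
    · rintro ⟨c, hc, rfl⟩
      exact ⟨_, hc, by rw [hsum]⟩
    · rintro ⟨v, hv, rfl⟩
      obtain ⟨c, rfl⟩ := hy.2 v
      exact ⟨c, hv, by rw [← hsum]⟩

end Linear

end Symbol

/-! ### Positive definite bilinear forms. -/

section Forms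

variable {V : Type*} [NormedAddCommGroup V] [NormedSpace ℝ V]

theorem isUnitPair_form (B : V →L[ℝ] V →L[ℝ] ℝ) (hB : ∀ v, v ≠ 0 → 0 < B v v) (L : V →L[ℝ] ℝ) :
    IsUnitPair (fun v => √(B v v)) (fun v => |L v|) where
  continuous_norm := by fun_prop
  continuous_fun := by fun_prop
  norm_smul c v := by
    rw [map_smul, map_smul, smul_apply, smul_eq_mul, smul_eq_mul, ← mul_assoc,
      Real.sqrt_mul (mul_self_nonneg c), Real.sqrt_mul_self_eq_abs]
  fun_smul c v := by rw [map_smul, smul_eq_mul, abs_mul]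
  norm_pos v hv := Real.sqrt_pos.2 (hB v hv)
  fun_nonneg v := abs_nonneg _

theorem form_sum_smul {ι : Type*} [Fintype ι] (B : V →L[ℝ] V →L[ℝ] ℝ) (c : ι → ℝ) (X : ι → V) :
    B (∑ i, c i • X i) (∑ i, c i • X i) = ∑ i, c i * ∑ j, c j * B (X i) (X j) := by
  simp only [map_sum, map_smul, sum_apply, smul_apply, smul_eq_mul, Finset.mul_sum]
  rw [Finset.sum_comm]
  exact Finset.sum_congr rfl fun i _ => Finset.sum_congr rfl fun j _ => by ring

end Forms

/-! ### The riemannian norm of covectors is a continuous norm. -/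

section Covectors

variable {n : ℕ} {M : Type*} [TopologicalSpace M] [ChartedSpace (EuclideanSpace ℝ (Fin n)) M]
  [IsManifold (𝓡 n) ∞ M]

theorem contMDiff_differential {h : M → ℝ} (hh : ContMDiff (𝓡 n) 𝓘(ℝ, ℝ) ∞ h) :
    ContMDiff (𝓡 n) ((𝓡 n).prod 𝓘(ℝ, EuclideanSpace ℝ (Fin n) →L[ℝ] ℝ)) ∞
      fun y => TotalSpace.mk' (EuclideanSpace ℝ (Fin n) →L[ℝ] ℝ)
        (E := fun y : M => TangentSpace (𝓡 n) y →L[ℝ] Bundle.Trivial M ℝ y) y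
        (differential n h y) := by
  intro x
  refine (contMDiffAt_hom_bundle _).2 ⟨contMDiffAt_id, ?_⟩
  have h := hh.contMDiffAt (x := x) |>.mfderiv_const (m := ∞) le_rfl
  unfold inTangentCoordinates ContinuousLinearMap.inCoordinates at h
  unfold ContinuousLinearMap.inCoordinates
  simp only [TangentBundle.continuousLinearMapAt_model_space] at h
  simp only [Bundle.Trivial.continuousLinearMapAt_trivialization,
    Bundle.Trivial.fiberBundle_trivializationAt']
  exact h

theorem continuous_differential_apply {h : M → ℝ} (hh : ContMDiff (𝓡 n) 𝓘(ℝ, ℝ) ∞ h)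
    (X : Cₛ^∞⟮𝓡 n; EuclideanSpace ℝ (Fin n), fun x : M => TangentSpace (𝓡 n) x⟯) :
    Continuous fun y => differential n h y (X y) := by
  rw [continuous_iff_continuousAt]
  intro x
  have := ContMDiffAt.clm_bundle_apply (E₂ := Bundle.Trivial M ℝ) (F₂ := ℝ)
    (contMDiff_differential hh x) (X.contMDiff x)
  exact ((contMDiffAt_section x).1 this).continuousAt

variable (g : ContMDiffRiemannianMetric (𝓡 n) ∞ (EuclideanSpace ℝ (Fin n))
    (fun x : M => TangentSpace (𝓡 n) x))

theorem continuous_metric_apply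
    (X Y : Cₛ^∞⟮𝓡 n; EuclideanSpace ℝ (Fin n), fun x : M => TangentSpace (𝓡 n) x⟯) :
    Continuous fun y => g.inner y (X y) (Y y) := by
  rw [continuous_iff_continuousAt]
  intro x
  have := ContMDiffAt.clm_bundle_apply₂ (E₃ := Bundle.Trivial M ℝ) (F₃ := ℝ)
    (g.contMDiff x) (X.contMDiff x) (Y.contMDiff x)
  exact ((contMDiffAt_section x).1 this).continuousAt

/-- The norm of a tangent vector. -/
def tangentNorm (x : M) (v : EuclideanSpace ℝ (Fin n)) : ℝ :=
  √((g.inner x : EuclideanSpace ℝ (Fin n) →L[ℝ] EuclideanSpace ℝ (Fin n) →L[ℝ] ℝ) v v)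

/-- Replacing `g(v, v)` by its square root gives a homogeneous norm on the model space, as
`IsUnitPair` requires. -/
theorem covectorNorm_eq (x : M) (ξ : Cotangent n x) :
    covectorNorm g x ξ = sSup {r : ℝ | ∃ v : EuclideanSpace ℝ (Fin n), tangentNorm g x v ≤ 1 ∧
      r = |(ξ : EuclideanSpace ℝ (Fin n) →L[ℝ] ℝ) v|} := by
  unfold covectorNorm tangentNorm
  simp only [Real.sqrt_le_one]
  rfl

theorem isUnitPair_covector (x : M) (ξ : Cotangent n x) :
    IsUnitPair (tangentNorm g x)
      (fun v => |(ξ : EuclideanSpace ℝ (Fin n) →L[ℝ] ℝ) v|) :=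
  isUnitPair_form (V := EuclideanSpace ℝ (Fin n)) (g.inner x) (g.pos x) ξ

theorem covectorNorm_nonneg (x : M) (ξ : Cotangent n x) : 0 ≤ covectorNorm g x ξ := by
  rw [covectorNorm_eq]
  exact (isUnitPair_covector g x ξ).sSup_nonneg

theorem covectorNorm_smul (x : M) (c : ℝ) (ξ : Cotangent n x) :
    covectorNorm g x (c • ξ) = |c| * covectorNorm g x ξ := by
  rw [covectorNorm_eq, covectorNorm_eq, ← sSup_unit_const_mul _ _ (abs_nonneg c)]
  simp only [← abs_mul]
  rfl

theorem eq_zero_of_covectorNorm_eq_zero (x : M) (ξ : Cotangent n x)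
    (h : covectorNorm g x ξ = 0) : ξ = 0 := by
  rw [covectorNorm_eq] at h
  ext v
  have := (isUnitPair_covector g x ξ).le_sSup_mul v
  rw [h, zero_mul] at this
  exact abs_eq_zero.1 (le_antisymm this (abs_nonneg _))

theorem isContinuousSeminorm_covectorNorm [T2Space M] :
    IsContinuousSeminorm (covectorNorm g) where
  add_le x ξ η := by
    rw [covectorNorm_eq, covectorNorm_eq g x ξ, covectorNorm_eq g x η]
    refine (isUnitPair_covector g x (ξ + η)).sSup_le (add_nonneg
      (isUnitPair_covector g x ξ).sSup_nonneg (isUnitPair_covector g x η).sSup_nonneg)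
      fun v => ?_
    rw [add_mul]
    exact (abs_add_le _ _).trans (add_le_add ((isUnitPair_covector g x ξ).le_sSup_mul v)
      ((isUnitPair_covector g x η).le_sSup_mul v))
  smul x c ξ := covectorNorm_smul g x c ξ
  continuous_differential h hh := by
    rw [continuous_iff_continuousAt]
    intro x₀
    -- As for the symbol, a frame turns the supremum over varying tangent spaces into one over a
    -- fixed space of coefficients.
    obtain ⟨X, hX⟩ := exists_frame (n := n) (V := EuclideanSpace ℝ (Fin n))
      (E := fun x : M => TangentSpace (𝓡 n) x) x₀
    set N := fun (y : M) (c : Fin (Module.finrank ℝ (EuclideanSpace ℝ (Fin n))) → ℝ) =>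
      tangentNorm g y (∑ i, c i • (X i y : EuclideanSpace ℝ (Fin n))) with hN
    set Q := fun (y : M) (c : Fin (Module.finrank ℝ (EuclideanSpace ℝ (Fin n))) → ℝ) =>
      |(differential n h y : EuclideanSpace ℝ (Fin n) →L[ℝ] ℝ)
        (∑ i, c i • (X i y : EuclideanSpace ℝ (Fin n)))| with hQ
    have h2 : ∀ i, Continuous
        fun q : M × (Fin (Module.finrank ℝ (EuclideanSpace ℝ (Fin n))) → ℝ) => q.2 i :=
      fun i => by fun_prop
    have hNc : Continuous fun q : M × (_ → ℝ) => N q.1 q.2 := by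
      refine Real.continuous_sqrt.comp (Continuous.congr ?_ fun q => (form_sum_smul
        (V := EuclideanSpace ℝ (Fin n)) (g.inner q.1) q.2 fun i => X i q.1).symm)
      refine continuous_finsetSum _ fun i _ => (h2 i).mul (continuous_finsetSum _ fun j _ =>
        (h2 j).mul ?_)
      exact (continuous_metric_apply g (X i) (X j)).comp continuous_fst
    have hQc : Continuous fun q : M × (_ → ℝ) => Q q.1 q.2 := by
      simp only [hQ, map_sum, map_smul, smul_eq_mul]
      refine continuous_abs.comp (continuous_finsetSum _ fun i _ => (h2 i).mul ?_)
      exact (continuous_differential_apply hh (X i)).comp continuous_fst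
    have key := continuousAt_sSup_unit (y₀ := x₀) (N := N) (Q := Q) (by
        filter_upwards [hX] with y hy
        have hp := isUnitPair_covector g y (differential n h y)
        have hs : ∀ (a : ℝ) (c : Fin (Module.finrank ℝ (EuclideanSpace ℝ (Fin n))) → ℝ),
            ∑ i, (a • c) i • (X i y : EuclideanSpace ℝ (Fin n)) =
              a • ∑ i, c i • (X i y : EuclideanSpace ℝ (Fin n)) := fun a c => by
          simp only [Pi.smul_apply, smul_eq_mul, mul_smul, ← Finset.smul_sum]
        refine ⟨hNc.comp (Continuous.prodMk_right y), hQc.comp (Continuous.prodMk_right y),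
          fun a c => ?_, fun a c => ?_, fun c hc => ?_, fun c => abs_nonneg _⟩
        · exact (congrArg (tangentNorm g y) (hs a c)).trans (hp.norm_smul a _)
        · exact (congrArg (fun v => |(differential n h y : EuclideanSpace ℝ (Fin n) →L[ℝ] ℝ) v|)
            (hs a c)).trans (hp.fun_smul a _)
        · refine hp.norm_pos _ fun h0 => hc (hy.1 (h0.trans ?_))
          exact (Finset.sum_eq_zero fun i _ => zero_smul ℝ (X i y)).symm)
      (fun c => hNc.continuousAt) (fun c => hQc.continuousAt)
    refine key.congr ?_
    filter_upwards [hX] with y hy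
    rw [covectorNorm_eq]
    congr 1
    ext r
    constructor
    · rintro ⟨c, hc, rfl⟩
      exact ⟨_, hc, rfl⟩
    · rintro ⟨v, hv, rfl⟩
      obtain ⟨c, rfl⟩ := hy.2 v
      exact ⟨c, hv, rfl⟩

end Covectors

/-! ### The seminorms of the operators `D_m`. -/

section Augmented

/-- The operator norm of the direct sum of a map with a multiple of an isometry of `ℂ`. -/
theorem IsUnitPair.sSup_sum_eq_max {V : Type*} [NormedAddCommGroup V] [NormedSpace ℝ V]
    [FiniteDimensional ℝ V] {N Q : V → ℝ} (h : IsUnitPair N Q) {b : ℝ} (hb : 0 ≤ b) :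
    sSup {r : ℝ | ∃ u : V × ℂ, √(N u.1 ^ 2 + ‖u.2‖ ^ 2) ≤ 1 ∧
      r = √(Q u.1 ^ 2 + (b * ‖u.2‖) ^ 2)} =
      max (sSup {r : ℝ | ∃ v, N v ≤ 1 ∧ r = Q v}) b := by
  set A := sSup {r : ℝ | ∃ v, N v ≤ 1 ∧ r = Q v}
  have hub : ∀ r ∈ {r : ℝ | ∃ u : V × ℂ, √(N u.1 ^ 2 + ‖u.2‖ ^ 2) ≤ 1 ∧
      r = √(Q u.1 ^ 2 + (b * ‖u.2‖) ^ 2)}, r ≤ max A b := by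
    rintro r ⟨u, hu, rfl⟩
    have hK : 0 ≤ max A b := hb.trans (le_max_right _ _)
    have h1 : Q u.1 ≤ max A b * N u.1 := (h.le_sSup_mul u.1).trans
      (mul_le_mul_of_nonneg_right (le_max_left _ _) (h.norm_nonneg _))
    have h2 : b * ‖u.2‖ ≤ max A b * ‖u.2‖ :=
      mul_le_mul_of_nonneg_right (le_max_right _ _) (_root_.norm_nonneg _)
    have h3 := pow_le_pow_left₀ (h.fun_nonneg u.1) h1 2
    have h4 := pow_le_pow_left₀ (mul_nonneg hb (_root_.norm_nonneg _)) h2 2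
    rw [Real.sqrt_le_one] at hu
    refine Real.sqrt_le_iff.2 ⟨hK, ?_⟩
    calc Q u.1 ^ 2 + (b * ‖u.2‖) ^ 2 ≤ max A b ^ 2 * (N u.1 ^ 2 + ‖u.2‖ ^ 2) := by
          rw [mul_pow] at h3 h4 ⊢
          linarith
      _ ≤ max A b ^ 2 := mul_le_of_le_one_right (sq_nonneg _) hu
  refine le_antisymm (csSup_le ⟨_, 0, by simp [h.norm_zero], rfl⟩ hub) (max_le ?_ ?_)
  · refine csSup_le h.nonempty ?_
    rintro r ⟨v, hv, rfl⟩
    -- The two summands are tested separately: vectors `(v, 0)` recover the supremum of `Q`, and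
    -- `(0, 1)` gives `b`.
    refine le_csSup ⟨_, hub⟩ ⟨(v, 0), ?_, ?_⟩
    · simpa [Real.sqrt_sq (h.norm_nonneg v)] using hv
    · simp [Real.sqrt_sq (h.fun_nonneg v)]
  · refine le_csSup ⟨_, hub⟩ ⟨(0, 1), ?_, ?_⟩
    · simp [h.norm_zero]
    · simp [h.fun_zero, Real.sqrt_sq hb]

variable {n : ℕ} {M : Type*} [TopologicalSpace M] [ChartedSpace (EuclideanSpace ℝ (Fin n)) M]
  [IsManifold (𝓡 n) ∞ M]

omit [IsManifold (𝓡 n) ∞ M] in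
theorem mfderiv_mul_complex {h : M → ℝ} (hh : ContMDiff (𝓡 n) 𝓘(ℝ, ℝ) ∞ h) {s : M → ℂ}
    (hs : ContMDiff (𝓡 n) 𝓘(ℝ, ℂ) ∞ s) (x : M) :
    (show EuclideanSpace ℝ (Fin n) →L[ℝ] ℂ from mfderiv (𝓡 n) 𝓘(ℝ, ℂ) (fun z => h z • s z) x) =
      h x • (show EuclideanSpace ℝ (Fin n) →L[ℝ] ℂ from mfderiv (𝓡 n) 𝓘(ℝ, ℂ) s x) +
        (show EuclideanSpace ℝ (Fin n) →L[ℝ] ℝ from differential n h x).smulRight (s x) := by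
  have h1 := ((hh x).mdifferentiableAt (by simp)).hasMFDerivAt
  have h2 := ((hs x).mdifferentiableAt (by simp)).hasMFDerivAt
  have h3 := HasFDerivWithinAt.smul h1.2 h2.2
  have eh : writtenInExtChartAt (𝓡 n) 𝓘(ℝ, ℝ) x h (extChartAt (𝓡 n) x x) = h x :=
    congrArg h (extChartAt_to_inv x)
  have es : writtenInExtChartAt (𝓡 n) 𝓘(ℝ, ℂ) x s (extChartAt (𝓡 n) x x) = s x :=
    congrArg s (extChartAt_to_inv x)
  rw [eh, es] at h3
  have h4 : HasMFDerivAt (𝓡 n) 𝓘(ℝ, ℂ) (fun z => h z • s z) x _ :=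
    ⟨ContinuousAt.smul h1.1 h2.1, h3⟩
  exact h4.mfderiv

/-- The real and imaginary parts of `c ξ` are `Re c` and `Im c` times the same real covector. -/
theorem complexCovectorNorm_smulRight (g : ContMDiffRiemannianMetric (𝓡 n) ∞
    (EuclideanSpace ℝ (Fin n)) (fun x : M => TangentSpace (𝓡 n) x)) (x : M) (ξ : Cotangent n x)
    (c : ℂ) :
    complexCovectorNorm g x ((ξ : EuclideanSpace ℝ (Fin n) →L[ℝ] ℝ).smulRight c) =
      covectorNorm g x ξ * ‖c‖ := by
  have h1 : Complex.reCLM.comp ((ξ : EuclideanSpace ℝ (Fin n) →L[ℝ] ℝ).smulRight c) =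
      c.re • (ξ : EuclideanSpace ℝ (Fin n) →L[ℝ] ℝ) := by
    ext v
    simp [mul_comm]
  have h2 : Complex.imCLM.comp ((ξ : EuclideanSpace ℝ (Fin n) →L[ℝ] ℝ).smulRight c) =
      c.im • (ξ : EuclideanSpace ℝ (Fin n) →L[ℝ] ℝ) := by
    ext v
    simp [mul_comm]
  have h3 := (congrArg (covectorNorm g x) h1).trans (covectorNorm_smul g x c.re ξ)
  have h4 := (congrArg (covectorNorm g x) h2).trans (covectorNorm_smul g x c.im ξ)
  have h5 : |c.re| * covectorNorm g x ξ * (|c.re| * covectorNorm g x ξ) +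
      |c.im| * covectorNorm g x ξ * (|c.im| * covectorNorm g x ξ) =
        (covectorNorm g x ξ * ‖c‖) ^ 2 := by
    rw [mul_pow, ← Complex.normSq_eq_norm_sq, Complex.normSq_apply, ← abs_mul_abs_self c.re,
      ← abs_mul_abs_self c.im]
    ring
  unfold complexCovectorNorm
  refine (congrArg Real.sqrt ?_).trans
    (Real.sqrt_sq (mul_nonneg (covectorNorm_nonneg g x ξ) (norm_nonneg c)))
  rw [← h5, ← h3, ← h4, pow_two, pow_two]

variable [T2Space M]
variable {V : Type*} [NormedAddCommGroup V] [NormedSpace ℂ V] [FiniteDimensional ℂ V]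
  {E : M → Type*} [TopologicalSpace (TotalSpace V E)] [∀ x, NormedAddCommGroup (E x)]
  [∀ x, InnerProductSpace ℂ (E x)] [FiberBundle V E] [VectorBundle ℝ V E]
  [ContMDiffVectorBundle ∞ V E (𝓡 n)]
variable {W : Type*} [NormedAddCommGroup W] [NormedSpace ℂ W]
  {F : M → Type*} [TopologicalSpace (TotalSpace W F)] [∀ x, NormedAddCommGroup (F x)]
  [∀ x, InnerProductSpace ℂ (F x)] [FiberBundle W F] [VectorBundle ℝ W F]
variable (D : Cₛ^∞⟮𝓡 n; V, E⟯ →ₗ[ℝ] Cₛ^∞⟮𝓡 n; W, F⟯) (hD : IsFirstOrder D)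
  (g : ContMDiffRiemannianMetric (𝓡 n) ∞ (EuclideanSpace ℝ (Fin n))
    (fun x : M => TangentSpace (𝓡 n) x))

omit [T2Space M] [FiniteDimensional ℂ V] [ContMDiffVectorBundle ∞ V E (𝓡 n)] in
-- This is the Leibniz rule `d(hs) - h ds = s dh`, scaled by `2⁻ᵐ`.
theorem commutator_augmented_snd (m : ℕ) (h : C^∞⟮𝓡 n, M; 𝓘(ℝ, ℝ), ℝ⟯)
    (U : Cₛ^∞⟮𝓡 n; V × ℂ, (E ×ᵇ Bundle.Trivial M ℂ)⟯) (x : M) :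
    (commutator (augmented D m) h U x).2 =
      (differential n (fun z => h z) x : EuclideanSpace ℝ (Fin n) →L[ℝ] ℝ).smulRight
        (((2 : ℝ)⁻¹ ^ m) • (U x).2 : ℂ) := by
  have key := mfderiv_mul_complex h.contMDiff (contMDiff_trivial_section (sndSection U)) x
  have : ∀ (a b : ℝ) (A B : EuclideanSpace ℝ (Fin n) →L[ℝ] ℂ)
      (L : EuclideanSpace ℝ (Fin n) →L[ℝ] ℝ) (c : ℂ), A = b • B + L.smulRight c →
      a • A - b • (a • B) = L.smulRight (a • c) := by
    rintro a b A B L c rfl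
    ext v
    simp only [smul_apply, ContinuousLinearMap.smulRight_apply, smul_add,
      smul_comm b a, smul_comm a (L v), add_sub_cancel_left]
  exact this _ _ _ _ _ _ key

include hD in
-- The computation uses the particular function and section selected in the definition of `symbol`,
-- so the first-order property of `augmented D m` is not needed. In the first component
-- `symbol_eq_commutator` for `D` applies; in the second, the Leibniz rule.
theorem norm_symbol_augmented (m : ℕ) (x : M) (ξ : Cotangent n x) (u : E x × ℂ) :
    sumNorm (fun _ w => ‖w‖) (complexCovectorNorm g) x
      (symbol (augmented D m) x ξ u : F x × ComplexCotangent n x) =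
      √(‖symbol D x ξ u.1‖ ^ 2 + ((2 : ℝ)⁻¹ ^ m * covectorNorm g x ξ * ‖u.2‖) ^ 2) := by
  have : FiniteDimensional ℝ V := FiniteDimensional.complexToReal V
  obtain ⟨f, hf⟩ := exists_section_eq (n := n) (V := V) (E := E) x u.1
  have hU : ∃ U : Cₛ^∞⟮𝓡 n; V × ℂ, (E ×ᵇ Bundle.Trivial M ℂ)⟯, U x = u := by
    let c : Cₛ^∞⟮𝓡 n; ℂ, Bundle.Trivial M ℂ⟯ :=
      ⟨fun _ => u.2, fun y => (contMDiffAt_section y).2 contMDiffAt_const⟩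
    exact ⟨pairSection f c, Prod.ext hf rfl⟩
  have hU' := Classical.epsilon_spec hU
  have hh' := Classical.epsilon_spec (exists_contMDiffMap_differential_eq x ξ)
  have e1 := symbol_eq_commutator D hD (x := x) hh'
    (f := fstSection (Classical.epsilon fun U : Cₛ^∞⟮𝓡 n; V × ℂ, (E ×ᵇ Bundle.Trivial M ℂ)⟯ =>
      U x = u)) (congrArg Prod.fst hU')
  have e2 := commutator_augmented_snd D m
    (Classical.epsilon fun h : C^∞⟮𝓡 n, M; 𝓘(ℝ, ℝ), ℝ⟯ => differential n (fun z => h z) x = ξ)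
    (Classical.epsilon fun U : Cₛ^∞⟮𝓡 n; V × ℂ, (E ×ᵇ Bundle.Trivial M ℂ)⟯ => U x = u) x
  have e3 := (congrArg (complexCovectorNorm g x) e2).trans (complexCovectorNorm_smulRight g x _ _)
  have e4 : covectorNorm g x (differential n (fun z => (Classical.epsilon
      fun h : C^∞⟮𝓡 n, M; 𝓘(ℝ, ℝ), ℝ⟯ => differential n (fun z => h z) x = ξ) z) x) =
        covectorNorm g x ξ := congrArg _ hh'
  have e5 : ∀ {a b c d : ℝ}, a = c → b = d → √(a ^ 2 + b ^ 2) = √(c ^ 2 + d ^ 2) := by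
    rintro a b c d rfl rfl
    rfl
  refine e5 (congrArg norm e1).symm (e3.trans ?_)
  have e6 : ∀ (r : ℝ) (c c' : ℂ), 0 ≤ r → c = c' → ‖r • c‖ = r * ‖c'‖ := by
    rintro r c _ hr rfl
    rw [norm_smul, Real.norm_of_nonneg hr]
  rw [e4]
  refine (congrArg _ (e6 _ _ u.2 (by positivity) (congrArg Prod.snd hU'))).trans ?_
  ring

include hD in
theorem augmentedSeminorm_eq (m : ℕ) (x : M) (ξ : Cotangent n x) :
    augmentedSeminorm g D m x ξ =
      max (opSeminorm D x ξ) ((2 : ℝ)⁻¹ ^ m * covectorNorm g x ξ) := by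
  have := finiteDimensional_fibre V E x
  refine Eq.trans ?_ ((isUnitPair_symbol D hD x ξ).sSup_sum_eq_max
    (mul_nonneg (by positivity) (covectorNorm_nonneg g x ξ)))
  unfold augmentedSeminorm symbolNorm
  refine congrArg sSup (Set.ext fun r => ?_)
  constructor
  · rintro ⟨u, hu, rfl⟩
    exact ⟨u, hu, norm_symbol_augmented D hD g m x ξ u⟩
  · rintro ⟨u, hu, rfl⟩
    exact ⟨u, hu, (norm_symbol_augmented D hD g m x ξ u).symm⟩

include hD in
theorem isContinuousSeminorm_augmentedSeminorm [FiniteDimensional ℂ W]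
    (hE : IsSmoothHermitian n V E) (hF : IsSmoothHermitian n W F) (m : ℕ) :
    IsContinuousSeminorm (augmentedSeminorm g D m) := by
  have h1 := isContinuousSeminorm_opSeminorm D hD hE hF
  have h2 := isContinuousSeminorm_covectorNorm g
  have ha : (0 : ℝ) ≤ (2 : ℝ)⁻¹ ^ m := by positivity
  refine ⟨fun x ξ η => ?_, fun x c ξ => ?_, fun h hh => ?_⟩
  · simp only [augmentedSeminorm_eq D hD]
    refine max_le ((h1.add_le x ξ η).trans (add_le_add (le_max_left _ _) (le_max_left _ _))) ?_
    refine (mul_le_mul_of_nonneg_left (h2.add_le x ξ η) ha).trans ?_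
    rw [mul_add]
    exact add_le_add (le_max_right _ _) (le_max_right _ _)
  · simp only [augmentedSeminorm_eq D hD]
    rw [h1.smul, h2.smul, mul_left_comm, mul_max_of_nonneg _ _ (abs_nonneg c)]
  · simp only [augmentedSeminorm_eq D hD]
    exact (h1.continuous_differential h hh).max
      ((h2.continuous_differential h hh).const_mul _)

include hD in
theorem opSeminorm_le_augmentedSeminorm (m : ℕ) (x : M) (ξ : Cotangent n x) :
    opSeminorm D x ξ ≤ augmentedSeminorm g D m x ξ := by
  rw [augmentedSeminorm_eq D hD]
  exact le_max_left _ _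

include hD in
theorem augmentedSeminorm_antitone {k m : ℕ} (hkm : k ≤ m) (x : M) (ξ : Cotangent n x) :
    augmentedSeminorm g D m x ξ ≤ augmentedSeminorm g D k x ξ := by
  rw [augmentedSeminorm_eq D hD, augmentedSeminorm_eq D hD]
  exact max_le_max le_rfl (mul_le_mul_of_nonneg_right
    (pow_le_pow_of_le_one (by norm_num) (by norm_num) hkm) (covectorNorm_nonneg g x ξ))

include hD in
-- Here `c` is positive, as `P_D` is nonnegative, so `2⁻ᵏ |ξ|_g` eventually drops below it.
theorem exists_augmentedSeminorm_lt (x : M) (ξ : Cotangent n x) {c : ℝ}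
    (hc : opSeminorm D x ξ < c) : ∃ k, augmentedSeminorm g D k x ξ < c := by
  have := finiteDimensional_fibre V E x
  have h0 : 0 < c := (isUnitPair_symbol D hD x ξ).sSup_nonneg.trans_lt hc
  have h1 : Tendsto (fun k : ℕ => (2 : ℝ)⁻¹ ^ k * covectorNorm g x ξ) atTop (𝓝 0) := by
    have := (tendsto_pow_atTop_nhds_zero_of_lt_one (r := (2 : ℝ)⁻¹) (by norm_num)
      (by norm_num)).mul_const (covectorNorm g x ξ)
    rwa [zero_mul] at this
  obtain ⟨k, hk⟩ := (h1.eventually_lt_const h0).exists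
  exact ⟨k, by rw [augmentedSeminorm_eq D hD]; exact max_lt hc hk⟩

include hD in
-- The riemannian term makes every `P_{D_m}` a norm, which the mollification argument requires and
-- `P_D` need not provide.
theorem eq_zero_of_augmentedSeminorm_eq_zero (m : ℕ) (x : M) (ξ : Cotangent n x)
    (h : augmentedSeminorm g D m x ξ = 0) : ξ = 0 := by
  rw [augmentedSeminorm_eq D hD] at h
  have h1 : (2 : ℝ)⁻¹ ^ m * covectorNorm g x ξ ≤ 0 := (le_max_right _ _).trans h.le
  exact eq_zero_of_covectorNorm_eq_zero g x ξ (le_antisymm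
    (nonpos_of_mul_nonpos_right h1 (by positivity)) (covectorNorm_nonneg g x ξ))

end Augmented

/-- Larger distances have smaller balls; in this way completeness passes from `D_0` to every `D_m`.
-/
theorem IsCompleteSeminorm.mono {n : ℕ} {M : Type*} [TopologicalSpace M]
    [ChartedSpace (EuclideanSpace ℝ (Fin n)) M] {P Q : ∀ x : M, Cotangent n x → ℝ}
    (hP : IsCompleteSeminorm P) (hPQ : ∀ x y, controlDist P x y ≤ controlDist Q x y) :
    IsCompleteSeminorm Q := fun K hK R hR =>
  (hP K hK R hR).of_isClosed_subset isClosed_closure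
    (closure_mono fun x hx => (iInf₂_mono fun y _ => hPQ y x).trans hx)

end ControlDistance

end

/-! ### The two formulas for the control distance. -/

open ControlDistance in
theorem mainTheorem11 {n : ℕ} {M : Type*} [TopologicalSpace M]
    [ChartedSpace (EuclideanSpace ℝ (Fin n)) M] [IsManifold (𝓡 n) ∞ M]
    [T2Space M] [SigmaCompactSpace M]
    -- a smooth complex vector bundle `E` of finite rank with a smooth hermitian metric
    {V : Type*} [NormedAddCommGroup V] [NormedSpace ℂ V] [FiniteDimensional ℂ V]
    {E : M → Type*} [TopologicalSpace (TotalSpace V E)] [∀ x, NormedAddCommGroup (E x)]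
    [∀ x, InnerProductSpace ℂ (E x)] [FiberBundle V E] [VectorBundle ℂ V E] [VectorBundle ℝ V E]
    [ContMDiffVectorBundle ∞ V E (𝓡 n)]
    (hE : ControlDistance.IsSmoothHermitian n V E)
    -- another such bundle `F`
    {W : Type*} [NormedAddCommGroup W] [NormedSpace ℂ W] [FiniteDimensional ℂ W]
    {F : M → Type*} [TopologicalSpace (TotalSpace W F)] [∀ x, NormedAddCommGroup (F x)]
    [∀ x, InnerProductSpace ℂ (F x)] [FiberBundle W F] [VectorBundle ℂ W F] [VectorBundle ℝ W F]
    [ContMDiffVectorBundle ∞ W F (𝓡 n)]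
    (hF : ControlDistance.IsSmoothHermitian n W F)
    -- a first-order differential operator and a riemannian metric
    (D : Cₛ^∞⟮𝓡 n; V, E⟯ →ₗ[ℝ] Cₛ^∞⟮𝓡 n; W, F⟯) (hD : ControlDistance.IsFirstOrder D)
    (g : ContMDiffRiemannianMetric (𝓡 n) ∞ (EuclideanSpace ℝ (Fin n))
      (fun x : M => TangentSpace (𝓡 n) x))
    (hcomplete : ControlDistance.IsCompleteSeminorm (ControlDistance.augmentedSeminorm g D 0)) :
    (∀ x y : M, ControlDistance.controlDist (ControlDistance.opSeminorm D) x y =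
      ⨆ m : ℕ, ControlDistance.controlDist (ControlDistance.augmentedSeminorm g D m) x y) ∧
    (∀ x y : M, ControlDistance.controlDist (ControlDistance.opSeminorm D) x y =
      ⨆ (ξ : M → ℝ) (_ : ContMDiff (𝓡 n) 𝓘(ℝ, ℝ) ∞ ξ ∧ HasCompactSupport ξ ∧
          ∀ z, ControlDistance.opSeminorm D z (ControlDistance.differential n ξ z) ≤ 1),
        ENNReal.ofReal |ξ x - ξ y|) := by
  have hP := isContinuousSeminorm_opSeminorm D hD hE hF
  have hQ := isContinuousSeminorm_augmentedSeminorm D hD g hE hF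
  have hPQ := opSeminorm_le_augmentedSeminorm D hD g
  have hsup : ∀ x y, controlDist (opSeminorm D) x y ≤
      ⨆ m, controlDist (augmentedSeminorm g D m) x y :=
    controlDist_le_iSup hQ (fun _ _ h => augmentedSeminorm_antitone D hD g h)
      (fun x ξ _ => exists_augmentedSeminorm_lt D hD g x ξ) hcomplete
  have htest : ∀ m x y, controlDist (augmentedSeminorm g D m) x y ≤
      ⨆ (ξ : M → ℝ) (_ : ContMDiff (𝓡 n) 𝓘(ℝ, ℝ) ∞ ξ ∧ HasCompactSupport ξ ∧
        ∀ z, opSeminorm D z (differential n ξ z) ≤ 1), ENNReal.ofReal |ξ x - ξ y| := by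
    intro m x y
    have hc : IsCompleteSeminorm (augmentedSeminorm g D m) :=
      hcomplete.mono (controlDist_mono (hQ m) (hQ 0)
        (augmentedSeminorm_antitone D hD g (Nat.zero_le m)))
    refine (controlDist_le_iSup_test (hQ m)
      (eq_zero_of_augmentedSeminorm_eq_zero D hD g m) hc x y).trans ?_
    -- A test function for `D_m` is one for `D`, because `P_D ≤ P_{D_m}`.
    exact iSup_mono fun ξ => iSup_mono' fun h =>
      ⟨⟨h.1, h.2.1, fun z => (hPQ m z _).trans (h.2.2 z)⟩, le_rfl⟩
  refine ⟨fun x y => (hsup x y).antisymm (iSup_le fun m => controlDist_mono hP (hQ m) (hPQ m) x y),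
    fun x y => ((hsup x y).trans (iSup_le fun m => htest m x y)).antisymm ?_⟩
  exact iSup₂_le fun ξ h => ofReal_abs_sub_le_controlDist hP h.1 h.2.2 x y
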